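/- Let $k$ be a perfect field of characteristic $p>0$, let $R=\bigoplus_{m\ge 0}R_m$ be a graded domain of finite type over $R_0=k$ and of dimension $d\ge 2$, and let $I\subsetneq R$ be a graded ideal with $\ell(R/I)<\infty$ and $\operatorname{proj\,dim}_R(R/I)<\infty$. Write $q=p^n$, let $I^{[q]}$ be the ideal generated by the $q$-th powers of the elements of $I$, and put $n_0=\gcd\{m\mid R_m\neq 0\}$. For $x\ge 0$ set $$f_n(x)=\frac1{q^{d-1}}\sum_{r=0}^{n_0-1}\ell\big((R/I^{[q]})_{\lfloor xq\rfloor n_0+r}\big),\qquad g_n(x)=(1-t)f_n(x)+t\,f_n\big(x+\tfrac1q\big),\quad t=xq-\lfloor xq\rfloor,$$ $$f_{R,I}(x)=\lim_{n\to\infty}g_n(x),\qquad e_{HK}(R,I)=\lim_{n\to\infty}\frac{\ell(R/I^{[q]})}{q^d},\qquad e_0=\lim_{m\to\infty}\frac{(d-1)!\,\ell(R_{mn_0})}{m^{d-1}},\qquad \tilde e_0=\frac{e_0}{(d-1)!}.$$ Then these limits exist, $g_n\to f_{R,I}$ uniformly on $[0,\infty)$, and $e_0>0$; if $R$ is generated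 as a $k$-algebra by $R_{n_0}$, then $e_0$ is the Hilbert–Samuel multiplicity $\lim_n d!\,\ell(R/\mathbf m^n)/n^d$ of $R$ with respect to $\mathbf m=\bigoplus_{m>0}R_m$. The function $f_{R,I}$ is a piecewise polynomial function on $[0,\infty)$ with finitely many pieces, of degree $d-1$ (all pieces have degree at most $d-1$, and some piece has degree exactly $d-1$). Moreover, $R/I$ has a minimal graded free resolution $F_\bullet$ with $F_i=\bigoplus_{j\in\mathbb Z}R(-j)^{\beta_{i,j}}$ of finite rank, and every such resolution satisfies $F_i=0$ for $i>d$. Put $B(j)=\beta_{0,j}-\beta_{1,j}+\cdots+(-1)^d\beta_{d,j}$. Then $B(j)=0$ for $j<0$, $B(0)=1$, the largest integer $j$ with $\beta_{i,j}\neq 0$ for some $i$ exists and has the form $n_0l$ with $l\in\mathbb N$, and: 1. for every integer $i\ge 0$ and every $x\in[i,i+1]$, $$f_{R,I}(x)=\tilde e_0\sum_{j=0}^{i}B(n_0j)\,(x-j)^{d-1};$$ 2. $f_{R,I}(x)=0$ for $x\ge l$, and $\sum_{j=0}^{l}B(n_0j)(x-j)^{d-1}=0$ for all real $x$; 3. $$e_{HK}(R,I)=\frac{e_0}{d!}\sum_{j=0}^{l-1}B(n_0j)\,(l-j)^d.$$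 -/

import Mathlib

open Filter Topology Set
open scoped Nat

noncomputable section

namespace HKDensity

universe v u

variable {k : Type v} [Field k] {R : Type u} [CommRing R] [Algebra k R]

/-- `gcd {n | R_n ≠ 0}`. -/
def gradingGcd (𝒜 : ℕ → Submodule k R) : ℕ :=
  sSup {g : ℕ | ∀ n, 𝒜 n ≠ ⊥ → g ∣ n}

/-- The `q`-th bracket power `I^[q]`, generated by the `q`-th powers of all elements of `I`. -/
def bracketPower (I : Ideal R) (q : ℕ) : Ideal R :=
  Ideal.span ((fun a : R => a ^ q) '' (I : Set R))

/-- The degree `m` component of `R / J`, i.e. the image of `R_m` in `R / J`. -/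
def quotientPiece (𝒜 : ℕ → Submodule k R) (J : Ideal R) (m : ℕ) : Submodule k (R ⧸ J) :=
  (𝒜 m).map (Ideal.Quotient.mkₐ k J).toLinearMap

/-- The length of `(R / J)_m` over `R_0 = k`. -/
def pieceLength (𝒜 : ℕ → Submodule k R) (J : Ideal R) (m : ℕ) : ℕ :=
  Module.finrank k (quotientPiece 𝒜 J m)

/-- The step function `f_n(R, I)`, for `R` of dimension `d` and `q = p ^ n`. -/
def stepFun (𝒜 : ℕ → Submodule k R) (I : Ideal R) (p d n : ℕ) (x : ℝ) : ℝ :=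
  (∑ r ∈ Finset.range (gradingGcd 𝒜),
      (pieceLength 𝒜 (bracketPower I (p ^ n)) (⌊x * (p : ℝ) ^ n⌋₊ * gradingGcd 𝒜 + r) : ℝ))
    / ((p : ℝ) ^ n) ^ (d - 1)

/-- The piecewise linear function `g_n(R, I)`: if `x = (1 - t) ⌊xq⌋ / q + t ⌊xq + 1⌋ / q`, that is,
`t` is the fractional part of `xq`, its value is `(1 - t) f_n(x) + t f_n(x + 1 / q)`. -/
def linearFun (𝒜 : ℕ → Submodule k R) (I : Ideal R) (p d n : ℕ) (x : ℝ) : ℝ :=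
  (1 - Int.fract (x * (p : ℝ) ^ n)) * stepFun 𝒜 I p d n x
    + Int.fract (x * (p : ℝ) ^ n) * stepFun 𝒜 I p d n (x + 1 / (p : ℝ) ^ n)

/-- The Hilbert-Kunz density function `f_{R,I}`, the pointwise limit of the `g_n(R, I)`. -/
def density (𝒜 : ℕ → Submodule k R) (I : Ideal R) (p d : ℕ) (x : ℝ) : ℝ :=
  limUnder atTop (fun n : ℕ => linearFun 𝒜 I p d n x)

/-- The Hilbert-Kunz function `n ↦ ℓ(R / I^[q]) / q ^ d`, `q = p ^ n`. -/
def hkRatio (I : Ideal R) (p d n : ℕ) : ℝ :=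
  ((Module.length R (R ⧸ bracketPower I (p ^ n))).toNat : ℝ) / ((p : ℝ) ^ n) ^ d

/-- The Hilbert-Kunz multiplicity `e_HK(R, I)`. -/
def hkMultiplicity (I : Ideal R) (p d : ℕ) : ℝ :=
  limUnder atTop (hkRatio I p d)

/-- `(d - 1)! ℓ(R_{m n₀}) / m ^ (d - 1)`, where `n₀ = gcd {n | R_n ≠ 0}`. -/
def hilbertRatio (𝒜 : ℕ → Submodule k R) (d m : ℕ) : ℝ :=
  ((d - 1)! : ℝ) * (Module.finrank k (𝒜 (m * gradingGcd 𝒜)) : ℝ) / (m : ℝ) ^ (d - 1)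

/-- The multiplicity `e₀` of the graded ring `R` of dimension `d`: the normalized leading
coefficient of the Hilbert function `m ↦ ℓ(R_{m n₀})`. -/
def multiplicity (𝒜 : ℕ → Submodule k R) (d : ℕ) : ℝ :=
  limUnder atTop (hilbertRatio 𝒜 d)

/-- A minimal graded free resolution
`⋯ → F₂ → F₁ → F₀ → R / I → 0`, `F_i = ⨁_a R(-shift i a)`, given by matrices. -/
structure MinimalGradedResolution (𝒜 : ℕ → Submodule k R) [GradedAlgebra 𝒜] (I : Ideal R) where
  /-- the rank of `F_i` -/
  rank : ℕ → ℕ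
  /-- the degree of the `a`-th basis element of `F_i` -/
  shift : (i : ℕ) → Fin (rank i) → ℤ
  /-- the matrix of the differential `F_{i+1} → F_i` -/
  diff : (i : ℕ) → Matrix (Fin (rank i)) (Fin (rank (i + 1))) R
  /-- the augmentation `F₀ → R / I` -/
  aug : (Fin (rank 0) → R) →ₗ[R] R ⧸ I
  /-- the differentials are homogeneous of degree zero -/
  diff_homogeneous : ∀ i a c, diff i a c = 0 ∨
    ∃ n : ℕ, shift (i + 1) c = shift i a + n ∧ diff i a c ∈ 𝒜 n
  /-- the augmentation is homogeneous of degree zero -/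
  aug_homogeneous : ∀ a, aug (Pi.single a 1) = 0 ∨
    ∃ n : ℕ, shift 0 a = n ∧ aug (Pi.single a 1) ∈ quotientPiece 𝒜 I n
  aug_surjective : Function.Surjective aug
  exact_zero : Function.Exact (diff 0).mulVecLin aug
  exact_succ : ∀ i, Function.Exact (diff (i + 1)).mulVecLin (diff i).mulVecLin
  /-- minimality: the image of `F_{i+1}` lies in `R₊ F_i` -/
  minimal : ∀ i a c, diff i a c ∈ (HomogeneousIdeal.irrelevant 𝒜).toIdeal

variable {𝒜 : ℕ → Submodule k R} [GradedAlgebra 𝒜] {I : Ideal R}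

/-- The graded Betti number `β_{i,j}`: the multiplicity of `R(-j)` in `F_i`. -/
def MinimalGradedResolution.betti (F : MinimalGradedResolution 𝒜 I) (i : ℕ) (j : ℤ) : ℕ :=
  (Finset.univ.filter fun a : Fin (F.rank i) => F.shift i a = j).card

/-- `B(j) = β_{0,j} - β_{1,j} + ⋯ + (-1)^d β_{d,j}`. -/
def MinimalGradedResolution.altBetti (F : MinimalGradedResolution 𝒜 I) (d : ℕ) (j : ℤ) : ℤ :=
  ∑ i ∈ Finset.range (d + 1), (-1) ^ i * (F.betti i j : ℤ)

/-- `f` is on `[0, ∞)` a piecewise polynomial function, with finitely many pieces, of degree `D`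
(the largest degree of a piece). -/
def IsPiecewisePolynomial (f : ℝ → ℝ) (D : ℕ) : Prop :=
  ∃ (N : ℕ) (a : ℕ → ℝ) (P : ℕ → Polynomial ℝ),
    a 0 = 0 ∧ StrictMono a ∧
    (∀ i < N, ∀ x ∈ Icc (a i) (a (i + 1)), f x = (P i).eval x) ∧
    (∀ x ∈ Ici (a N), f x = (P N).eval x) ∧
    (∀ i ≤ N, (P i).degree ≤ D) ∧
    ∃ i ≤ N, (P i).degree = D

end HKDensity

end

/-!
Let `F` be a minimal graded free resolution of `R / I`, with shifts `F_i = ⨁_a R(-s_{i,a})`, and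
write `q = p^n`.

**Exactness after Frobenius.** Since `R / I` has finite projective dimension, `F` is finite
(`exists_rank_eq_zero`), and by the inequality of Auslander and Buchsbaum its length is at most the
depth of `R` at `R₊` (`extVanishes_of_minimal`), hence at most `d` (`le_ringKrullDim_of_extVanishes`).
Depth is expressed by the vanishing of `Ext^n(R / R₊, R)`. Raising all entries of the differentials to
the `q`-th power gives a complex whose homology is killed by powers of `R₊`, because the
elements of `I` act null-homotopically on `F`; so the acyclicity lemma (`exact_of_depth`) shows that
it is again exact (`exact_map_of_minimal`). It is therefore a graded resolution of `R / I^[q]` with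
shifts `q s_{i,a}`, and counting dimensions in one degree gives
`dim (R / I^[q])_m = ∑ (-1)^i dim R_{m - q s_{i,a}}` (`pieceLength_bracketPower`).
All shifts are multiples of `n₀`; summing over `n₀` consecutive degrees yields
`∑_{r < n₀} ℓ((R / I^[q])_{u n₀ + r}) = ∑_j B(n₀ j) h(u - q j)` with `h(z) = dim R_{z n₀}`
(`sum_pieceLength_bracketPower`).

**The Hilbert function.** By Noetherian induction on homogeneous ideals, the Hilbert function is
eventually polynomial along the multiples of a common multiple of the degrees of the generators
(`eventuallyPolynomial_pieceLength`). As `R` is a domain, multiplication by homogeneous elements makes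
`h` increasing for all large steps, so `h(a) / a^D` converges to some `c > 0`; comparison with a
Noether normalization gives `D = d - 1` (`exists_tendsto_hilbert`). Thus `c = e₀ / (d - 1)!`.

**The limit.** Consequently the rescaled block lengths converge, uniformly for bounded `x`, to
`c ∑_j B(n₀ j) (x - j)₊^(d - 1)` (`exists_abs_shiftedSum_sub_le`). Since `I^[q]` contains
everything of degree at least a constant multiple of `q`, both sides vanish for large `x`. So the
convergence is uniform on `[0, ∞)` and the last polynomial piece vanishes identically
(`sum_mul_pow_eq_zero`). Summing block lengths instead of evaluating them gives the
Hilbert-Kunz multiplicity `(c / d) ∑_j B(n₀ j) (M - j)^d` for a large integer `M`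
(`tendsto_sum_shiftedSum`); the derivative of this expression in `M` is the zero polynomial, so `M`
may be replaced by `l`.
-/

noncomputable section

namespace HKDensity

universe w v u

/-! ### Vanishing of `Ext` -/

section ExtVanishing

open CategoryTheory Abelian

variable {R : Type w} [CommRing R]

/-- `Ext^n_R(K, N) = 0`, for modules `K` and `N` in the universe of `R`. -/
def ExtVanishes (R : Type w) [CommRing R] (K N : Type w) [AddCommGroup K] [Module R K]
    [AddCommGroup N] [Module R N] (n : ℕ) : Prop :=
  Subsingleton (Ext (ModuleCat.of R K) (ModuleCat.of R N) n)

variable {K A B C : Type w} [AddCommGroup K] [Module R K] [AddCommGroup A] [Module R A]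
  [AddCommGroup B] [Module R B] [AddCommGroup C] [Module R C]

theorem extVanishes_zero_iff : ExtVanishes R K A 0 ↔ ∀ f : K →ₗ[R] A, f = 0 := by
  unfold ExtVanishes
  rw [Ext.addEquiv₀.subsingleton_congr, ModuleCat.homAddEquiv.subsingleton_congr]
  exact ⟨fun h f => Subsingleton.elim _ _, fun h => ⟨fun f g => (h f).trans (h g).symm⟩⟩

theorem shortExact_of_surjective {f : A →ₗ[R] B} {g : B →ₗ[R] C} (hf : Function.Injective f)
    (hg : Function.Surjective g) (hfg : Function.Exact f g) :
    (ModuleCat.shortComplexOfCompEqZero f g hfg.linearMap_comp_eq_zero).ShortExact :=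
  ModuleCat.shortComplex_shortExact _ hfg hf hg

theorem ExtVanishes.of_shortExact {f : A →ₗ[R] B} {g : B →ₗ[R] C} (hf : Function.Injective f)
    (hg : Function.Surjective g) (hfg : Function.Exact f g) {n : ℕ}
    (hB : ExtVanishes R K B n) (hA : ExtVanishes R K A (n + 1)) : ExtVanishes R K C n := by
  have hS := shortExact_of_surjective hf hg hfg
  have key : ∀ α : Ext (ModuleCat.of R K) (ModuleCat.of R C) n, α = 0 := by
    intro α
    obtain ⟨β, hβ⟩ := Ext.covariant_sequence_exact₃ (ModuleCat.of R K) hS (n₀ := n) α rfl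
      (hA.elim _ _)
    rw [← hβ, show β = 0 from hB.elim _ _, Ext.zero_comp]
  exact ⟨fun a b => (key a).trans (key b).symm⟩

/-- The covariant long exact sequence: `Ext^{n+1}(K, A) → Ext^{n+1}(K, B)` is injective if
`Ext^n(K, C) = 0`. -/
theorem eq_zero_of_comp_eq_zero {f : A →ₗ[R] B} {g : B →ₗ[R] C} (hf : Function.Injective f)
    (hg : Function.Surjective g) (hfg : Function.Exact f g) {n : ℕ}
    (hC : ExtVanishes R K C n) (α : Ext (ModuleCat.of R K) (ModuleCat.of R A) (n + 1))
    (hα : α.comp (Ext.mk₀ (ModuleCat.ofHom f)) (add_zero _) = 0) : α = 0 := by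
  have hS := shortExact_of_surjective hf hg hfg
  obtain ⟨β, hβ⟩ := Ext.covariant_sequence_exact₁ (ModuleCat.of R K) hS (n₁ := n + 1) α hα rfl
  rw [← hβ, show β = 0 from hC.elim _ _, Ext.zero_comp]

theorem ExtVanishes.left_of_shortExact {f : A →ₗ[R] B} {g : B →ₗ[R] C}
    (hf : Function.Injective f)
    (hg : Function.Surjective g) (hfg : Function.Exact f g) {n : ℕ}
    (hC : ExtVanishes R K C n) (hB : ExtVanishes R K B (n + 1)) :
    ExtVanishes R K A (n + 1) := by
  have key : ∀ α : Ext (ModuleCat.of R K) (ModuleCat.of R A) (n + 1), α = 0 := fun α =>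
    eq_zero_of_comp_eq_zero hf hg hfg hC α (hB.elim _ _)
  exact ⟨fun a b => (key a).trans (key b).symm⟩

theorem ExtVanishes.pi {n r : ℕ} (h : ExtVanishes R K R n) : ExtVanishes R K (Fin r → R) n := by
  classical
  have key : ∀ α : Ext (ModuleCat.of R K) (ModuleCat.of R (Fin r → R)) n, α = 0 := by
    intro α
    have hid : (𝟙 (ModuleCat.of R (Fin r → R))) =
        ∑ a : Fin r, ModuleCat.ofHom (LinearMap.proj a : (Fin r → R) →ₗ[R] R) ≫
          ModuleCat.ofHom (LinearMap.single R (fun _ : Fin r => R) a) := by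
      apply ModuleCat.hom_ext
      ext i j
      simp [ModuleCat.hom_sum, Pi.single_apply]
    rw [← Ext.comp_mk₀_id α, hid, Ext.mk₀_sum, Ext.comp_sum]
    refine Finset.sum_eq_zero fun a _ => ?_
    rw [← Ext.mk₀_comp_mk₀, ← Ext.comp_assoc_of_third_deg_zero]
    rw [show α.comp (Ext.mk₀ (ModuleCat.ofHom
      (LinearMap.proj a : (Fin r → R) →ₗ[R] R))) (add_zero n) = 0 from h.elim _ _,
      Ext.zero_comp]
  exact ⟨fun a b => (key a).trans (key b).symm⟩

/-- A direct summand of `Ext(K, R^r)` with `r > 0` is `Ext(K, R)`. -/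
theorem ExtVanishes.of_pi {n r : ℕ} (hr : 0 < r) (h : ExtVanishes R K (Fin r → R) n) :
    ExtVanishes R K R n := by
  classical
  have key : ∀ α : Ext (ModuleCat.of R K) (ModuleCat.of R R) n, α = 0 := by
    intro α
    have hid : (𝟙 (ModuleCat.of R R)) =
        ModuleCat.ofHom (LinearMap.single R (fun _ : Fin r => R) ⟨0, hr⟩) ≫
          ModuleCat.ofHom (LinearMap.proj ⟨0, hr⟩ : (Fin r → R) →ₗ[R] R) := by
      apply ModuleCat.hom_ext
      ext
      simp
    rw [← Ext.comp_mk₀_id α, hid, ← Ext.mk₀_comp_mk₀, ← Ext.comp_assoc_of_third_deg_zero]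
    rw [show α.comp (Ext.mk₀ (ModuleCat.ofHom
      (LinearMap.single R (fun _ : Fin r => R) ⟨0, hr⟩))) (add_zero n) = 0 from h.elim _ _,
      Ext.zero_comp]
  exact ⟨fun a b => (key a).trans (key b).symm⟩

/-- A matrix with entries in the annihilator of `K` acts as zero on `Ext(K, -)`. -/
theorem comp_mulVecLin_eq_zero {n r s : ℕ} (D : Matrix (Fin r) (Fin s) R)
    (hD : ∀ a c, D a c ∈ Module.annihilator R K)
    (α : Ext (ModuleCat.of R K) (ModuleCat.of R (Fin s → R)) n) :
    α.comp (Ext.mk₀ (ModuleCat.ofHom D.mulVecLin)) (add_zero n) = 0 := by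
  classical
  have hsum : ModuleCat.ofHom D.mulVecLin =
      ∑ a : Fin r, ∑ c : Fin s, D a c • ModuleCat.ofHom
        ((LinearMap.single R (fun _ : Fin r => R) a).comp
          (LinearMap.proj c : (Fin s → R) →ₗ[R] R)) := by
    apply ModuleCat.hom_ext
    ext i j
    simp [ModuleCat.hom_sum, Pi.single_apply, Finset.sum_apply]
  rw [hsum, Ext.mk₀_sum, Ext.comp_sum]
  refine Finset.sum_eq_zero fun a _ => ?_
  rw [Ext.mk₀_sum, Ext.comp_sum]
  refine Finset.sum_eq_zero fun c _ => ?_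
  rw [Ext.mk₀_smul, Ext.comp_smul]
  generalize α.comp (Ext.mk₀ _) (add_zero n) = β
  rw [← Ext.mk₀_id_comp β, ← Ext.smul_comp, ← Ext.mk₀_smul]
  have : D a c • 𝟙 (ModuleCat.of R K) = 0 := by
    apply ModuleCat.hom_ext
    ext x
    exact Module.mem_annihilator.mp (hD a c) x
  rw [this, Ext.mk₀_zero, Ext.zero_comp]

end ExtVanishing

/-! ### Depth, acyclicity and lengths of minimal complexes -/

section Complexes

open CategoryTheory

variable {R : Type w} [CommRing R]

theorem exact_rangeRestrict {M N P : Type*} [AddCommGroup M] [Module R M] [AddCommGroup N]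
    [Module R N] [AddCommGroup P] [Module R P] {f : M →ₗ[R] N} {g : N →ₗ[R] P}
    (h : Function.Exact f g) :
    Function.Exact (LinearMap.range f).subtype g.rangeRestrict := by
  intro x
  have h1 : g.rangeRestrict x = 0 ↔ g x = 0 := by
    rw [← Subtype.coe_inj]; rfl
  rw [h1, h x]
  simp

theorem exact_comp_rangeRestrict {M N P : Type*} [AddCommGroup M] [Module R M] [AddCommGroup N]
    [Module R N] [AddCommGroup P] [Module R P] {f : M →ₗ[R] N} {g : N →ₗ[R] P}
    (h : Function.Exact f g) : Function.Exact f g.rangeRestrict := by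
  intro x
  have h1 : g.rangeRestrict x = 0 ↔ g x = 0 := by
    rw [← Subtype.coe_inj]; rfl
  rw [h1, h x]

variable {rank : ℕ → ℕ} {D : (i : ℕ) → Matrix (Fin (rank i)) (Fin (rank (i + 1))) R}
  {K : Type w} [AddCommGroup K] [Module R K]

/-- In a complex of free modules of length `s`, exact to the left of `F_j`, the boundaries in `F_j`
have depth at least `j + 1` as soon as `R` has depth at least `s`. -/
theorem extVanishes_range {s : ℕ} (hs : ∀ i, s < i → rank i = 0)
    (hR : ∀ n < s, ExtVanishes R K R n) (m : ℕ) :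
    ∀ j, s ≤ j + m →
      (∀ i, j ≤ i → Function.Exact (D (i + 1)).mulVecLin (D i).mulVecLin) →
      ∀ n ≤ j, ExtVanishes R K (LinearMap.range (D j).mulVecLin) n := by
  have hzero : ∀ j, s ≤ j → ∀ n, ExtVanishes R K (LinearMap.range (D j).mulVecLin) n := by
    intro j hj n
    have hr : rank (j + 1) = 0 := hs _ (by omega)
    have : IsEmpty (Fin (rank (j + 1))) := by rw [hr]; infer_instance
    have hbot : Subsingleton (LinearMap.range (D j).mulVecLin) := by
      refine ⟨fun a b => Subtype.ext ?_⟩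
      obtain ⟨_, x, rfl⟩ := a
      obtain ⟨_, y, rfl⟩ := b
      rw [Subsingleton.elim x y]
    have hz : Limits.IsZero (ModuleCat.of R (LinearMap.range (D j).mulVecLin)) :=
      ModuleCat.isZero_of_subsingleton _
    refine ⟨fun a b => ?_⟩
    have h1 : 𝟙 (ModuleCat.of R (LinearMap.range (D j).mulVecLin)) = 0 := hz.eq_of_src _ _
    rw [← Abelian.Ext.comp_mk₀_id a, ← Abelian.Ext.comp_mk₀_id b, h1, Abelian.Ext.mk₀_zero,
      Abelian.Ext.comp_zero, Abelian.Ext.comp_zero]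
  induction m with
  | zero => exact fun j hj _ n _ => hzero j hj n
  | succ m ih =>
    intro j hj hex n hn
    by_cases hjs : s ≤ j
    · exact hzero j hjs n
    · exact ExtVanishes.of_shortExact (LinearMap.range (D (j + 1)).mulVecLin).injective_subtype
        (LinearMap.surjective_rangeRestrict _) (exact_rangeRestrict (hex j le_rfl))
        (hR n (by omega)).pi
        (ih (j + 1) (by omega) (fun i hi => hex i (by omega)) (n + 1) (by omega))

/-- The acyclicity lemma: a complex of finite free modules of length at most the depth of `R` at
the maximal ideal `m` is exact in positive degrees if its homology there is supported at `m`. -/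
theorem exact_of_depth [IsNoetherianRing R] (m : Ideal R) [m.IsMaximal] {s : ℕ}
    (hs : ∀ i, s < i → rank i = 0) (hR : ∀ n < s, ExtVanishes R (R ⧸ m) R n)
    (hD : ∀ i, D i * D (i + 1) = 0)
    (hsupp : ∀ i v, (D i).mulVecLin v = 0 → ∀ x ∈ m,
      ∃ N : ℕ, x ^ N • v ∈ LinearMap.range (D (i + 1)).mulVecLin) (i : ℕ) :
    Function.Exact (D (i + 1)).mulVecLin (D i).mulVecLin := by
  suffices H : ∀ t i, s ≤ i + t → Function.Exact (D (i + 1)).mulVecLin (D i).mulVecLin from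
    H s i (by omega)
  have hle : ∀ i v, v ∈ Set.range (D (i + 1)).mulVecLin → (D i).mulVecLin v = 0 := by
    rintro i _ ⟨w, rfl⟩
    simp [hD i]
  have htriv : ∀ i, s ≤ i → Function.Exact (D (i + 1)).mulVecLin (D i).mulVecLin := by
    intro i hi
    have hr : rank (i + 1) = 0 := hs _ (by omega)
    have : IsEmpty (Fin (rank (i + 1))) := by rw [hr]; infer_instance
    exact fun v => ⟨fun _ => ⟨0, Subsingleton.elim _ _⟩, hle i v⟩
  intro t
  induction t with
  | zero => exact fun i hi => htriv i hi
  | succ t ih =>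
    intro i hi
    by_cases his : s ≤ i
    · exact htriv i his
    refine fun v => ⟨fun hv => ?_, hle i v⟩
    have hex : ∀ j, i + 1 ≤ j → Function.Exact (D (j + 1)).mulVecLin (D j).mulVecLin :=
      fun j hj => ih j (by omega)
    set B := LinearMap.range (D (i + 1)).mulVecLin with hB
    have hB1 : ExtVanishes R (R ⧸ m) B 1 :=
      extVanishes_range hs hR s (i + 1) (by omega) hex 1 (by omega)
    have hQ : ExtVanishes R (R ⧸ m) ((Fin (rank (i + 1)) → R) ⧸ B) 0 :=
      ExtVanishes.of_shortExact B.injective_subtype B.mkQ_surjective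
        (LinearMap.exact_subtype_mkQ B) (hR 0 (by omega)).pi hB1
    rw [extVanishes_zero_iff] at hQ
    -- a cycle which is not a boundary spans a submodule of `F_{i+1} / B` with associated prime `m`,
    -- which contradicts `Hom(R / m, F_{i+1} / B) = 0`
    by_contra hvB
    have hv0 : B.mkQ v ≠ 0 := by
      rw [Ne, Submodule.mkQ_apply, Submodule.Quotient.mk_eq_zero]
      exact hvB
    obtain ⟨P, hP, hPle⟩ := exists_le_isAssociatedPrime_of_isNoetherianRing R _ hv0
    have hmP : m ≤ P := by
      intro x hx
      obtain ⟨N, hN⟩ := hsupp i v hv x hx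
      refine hP.isPrime.mem_of_pow_mem N (hPle ?_)
      rw [Submodule.mem_colon_singleton, Submodule.mem_bot, ← map_smul, Submodule.mkQ_apply,
        Submodule.Quotient.mk_eq_zero]
      exact hN
    have hPm : m = P := Ideal.IsMaximal.eq_of_le ‹_› hP.isPrime.ne_top hmP
    obtain ⟨hPp, w, hw⟩ := isAssociatedPrime_iff.mp hP
    have hmw : ∀ x ∈ m, x • w = 0 := by
      intro x hx
      rw [hPm, hw, Submodule.mem_colon_singleton, Submodule.mem_bot] at hx
      exact hx
    have hf := hQ (Submodule.liftQ m (LinearMap.toSpanSingleton R _ w) hmw)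
    have hw0 : w = 0 := by
      have : (1 : R) • w = 0 := LinearMap.congr_fun hf (Submodule.Quotient.mk 1)
      rwa [one_smul] at this
    refine hPp.ne_top ?_
    rw [hw, hw0, Ideal.eq_top_iff_one, Submodule.mem_colon_singleton]
    simp

/-- The inequality of Auslander and Buchsbaum: a finite minimal exact complex of free modules over
a domain is at most as long as the depth of the domain. -/
theorem extVanishes_of_minimal [IsDomain R] (m : Ideal R) (hm : m ≠ ⊥) {s : ℕ}
    (hs : ∀ i, s < i → rank i = 0) (hpos : 0 < rank s) (hmin : ∀ i a c, D i a c ∈ m)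
    (hex : ∀ i, Function.Exact (D (i + 1)).mulVecLin (D i).mulVecLin) (n : ℕ) (hn : n < s) :
    ExtVanishes R (R ⧸ m) R n := by
  obtain ⟨x, hxm, hx0⟩ := Submodule.exists_mem_ne_zero_of_ne_bot hm
  have htf : ∀ f : R ⧸ m, x • f = 0 := by
    intro f
    obtain ⟨y, rfl⟩ := Ideal.Quotient.mk_surjective f
    rw [Algebra.smul_def, Ideal.Quotient.algebraMap_eq, ← map_mul, Ideal.Quotient.eq_zero_iff_mem]
    exact m.mul_mem_right _ hxm
  have hann : ∀ i a c, D i a c ∈ Module.annihilator R (R ⧸ m) := by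
    intro i a c
    rw [Ideal.annihilator_quotient]
    exact hmin i a c
  have hB0 : ∀ i, ExtVanishes R (R ⧸ m) (LinearMap.range (D i).mulVecLin) 0 := by
    intro i
    rw [extVanishes_zero_iff]
    intro f
    ext
    have h1 : x • f 1 = 0 := by rw [← map_smul, htf, map_zero]
    have h2 : (f 1 : Fin (rank i) → R) = 0 := by
      have := congrArg Subtype.val h1
      exact (smul_eq_zero.mp this).resolve_left hx0
    simpa using congrFun h2 _
  induction n using Nat.strong_induction_on with
  | _ n ih =>
  cases n with
  | zero =>
    rw [extVanishes_zero_iff]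
    intro f
    ext
    have h1 : x • f 1 = 0 := by rw [← map_smul, htf, map_zero]
    simpa [hx0] using h1
  | succ n =>
    -- climb from `Hom(R / m, im D_{i₀}) = 0` to `Ext^n(R / m, im D_{i₀ + n}) = 0`; then the last map
    -- `D_{s-1}` is injective on `Ext^{n+1}(R / m, -)`, but by minimality it also acts as zero
    obtain ⟨i₀, rfl⟩ : ∃ i₀, s = i₀ + n + 2 := ⟨s - n - 2, by omega⟩
    have hchain : ∀ j ≤ n, ExtVanishes R (R ⧸ m) (LinearMap.range (D (i₀ + j)).mulVecLin) j := by
      intro j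
      induction j with
      | zero => exact fun _ => hB0 _
      | succ j ihj =>
        intro hj
        exact ExtVanishes.left_of_shortExact
          (LinearMap.range (D (i₀ + j + 1)).mulVecLin).injective_subtype
          (LinearMap.surjective_rangeRestrict _) (exact_rangeRestrict (hex (i₀ + j)))
          (ihj (by omega)) (ih (j + 1) (by omega) (by omega)).pi
    have hinj : Function.Injective (D (i₀ + n + 1)).mulVecLin := by
      rw [← LinearMap.ker_eq_bot, eq_bot_iff]
      intro v hv
      obtain ⟨w, rfl⟩ := (hex (i₀ + n + 1) v).mp hv
      have : IsEmpty (Fin (rank (i₀ + n + 1 + 1 + 1))) := by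
        rw [hs _ (by omega)]; infer_instance
      rw [Subsingleton.elim w 0, map_zero]
      exact Submodule.zero_mem _
    refine ExtVanishes.of_pi hpos ?_
    have key : ∀ α : Abelian.Ext (ModuleCat.of R (R ⧸ m))
        (ModuleCat.of R (Fin (rank (i₀ + n + 1 + 1)) → R)) (n + 1), α = 0 := fun α =>
      eq_zero_of_comp_eq_zero hinj (LinearMap.surjective_rangeRestrict (D (i₀ + n)).mulVecLin)
        (exact_comp_rangeRestrict (hex (i₀ + n))) (hchain n le_rfl) α
        (comp_mulVecLin_eq_zero _ (hann _) α)
    exact ⟨fun a b => (key a).trans (key b).symm⟩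

/-- Each member of a regular sequence lowers the dimension of the support. -/
theorem length_le_supportDim [IsNoetherianRing R] (rs : List R) :
    ∀ (M : Type w) [AddCommGroup M] [Module R M] [Module.Finite R M],
      RingTheory.Sequence.IsRegular M rs →
        (rs.length : WithBot ℕ∞) ≤ Module.supportDim R M := by
  induction rs with
  | nil =>
    intro M _ _ _ h
    have : Nontrivial M := h.nontrivial
    have := Module.supportDim_ne_bot_of_nontrivial R M
    simp only [List.length_nil, Nat.cast_zero]
    exact Order.krullDim_nonneg_iff.mpr (by
      by_contra hemp
      rw [not_nonempty_iff] at hemp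
      exact this Order.krullDim_eq_bot)
  | cons x rs ih =>
    intro M _ _ _ h
    rw [RingTheory.Sequence.isRegular_cons_iff] at h
    have h1 := ih (QuotSMulTop x M) h.2
    have h2 : Module.supportDim R (QuotSMulTop x M) + 1 ≤ Module.supportDim R M := by
      exact Module.supportDim_quotSMulTop_succ_le_of_notMem_minimalPrimes
        fun _ => h.1.notMem_of_mem_minimalPrimes
    refine le_trans ?_ h2
    rw [List.length_cons, Nat.cast_add, Nat.cast_one]
    gcongr

/-- The depth, measured by `Ext`, is at most the dimension: by Rees' theorem the vanishing provides
a regular sequence of length `s` in `m`. -/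
theorem le_ringKrullDim_of_extVanishes [IsNoetherianRing R] (m : Ideal R) (hm : m ≠ ⊤) {s : ℕ}
    (h : ∀ n < s, ExtVanishes R (R ⧸ m) R n) : (s : WithBot ℕ∞) ≤ ringKrullDim R := by
  obtain ⟨rs, hlen, -, hreg⟩ := ModuleCat.exists_isRegular_of_exists_subsingleton_ext m s
    (ModuleCat.of R R) (by
      rw [show m • (⊤ : Submodule R R) = m from by simp]
      exact lt_top_iff_ne_top.mpr hm) (ModuleCat.of R (R ⧸ m))
    (by rw [Module.support_eq_zeroLocus, Ideal.annihilator_quotient]) h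
  rw [← hlen, ← Module.supportDim_self_eq_ringKrullDim]
  exact length_le_supportDim rs R hreg

/-- An idempotent matrix `e` with entries in a proper ideal is zero, as `det (1 - e) ≠ 0`. -/
theorem eq_zero_of_isIdempotentElem [IsDomain R] {n : ℕ} (m : Ideal R) (hm : m ≠ ⊤)
    (e : Matrix (Fin n) (Fin n) R) (he : IsIdempotentElem e) (hem : ∀ a c, e a c ∈ m) : e = 0 := by
  have hdet : (1 - e).det ≠ 0 := by
    intro h0
    have h1 : (Ideal.Quotient.mk m) (1 - e).det = 1 := by
      rw [RingHom.map_det]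
      have : (Ideal.Quotient.mk m).mapMatrix (1 - e) = 1 := by
        rw [map_sub, map_one, sub_eq_self]
        ext a c
        simpa using Ideal.Quotient.eq_zero_iff_mem.mpr (hem a c)
      rw [this, Matrix.det_one]
    rw [h0, map_zero] at h1
    have := Ideal.Quotient.nontrivial_iff.mpr hm
    exact zero_ne_one h1
  have h2 : (1 - e) * e = 0 := by rw [sub_mul, one_mul, he.eq, sub_self]
  have h3 : (1 - e).det • e = 0 := by
    rw [← Matrix.one_mul ((1 - e).det • e), Matrix.mul_smul, ← Matrix.smul_mul,
      ← Matrix.adjugate_mul, Matrix.mul_assoc, h2, Matrix.mul_zero]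
  exact (smul_eq_zero.mp h3).resolve_left hdet

/-- If `F_{i+1} → F_i` is zero in a minimal exact complex, then the complex vanishes from
`F_{i+1}` on. -/
theorem rank_eq_zero_of_minimal (m : Ideal R) (hm : m ≠ ⊤)
    (hmin : ∀ i a c, D i a c ∈ m)
    (hex : ∀ i, Function.Exact (D (i + 1)).mulVecLin (D i).mulVecLin) {i : ℕ}
    (h0 : D i = 0) (j : ℕ) (hij : i < j) : rank j = 0 := by
  have step : ∀ i, D i = 0 → rank (i + 1) = 0 := by
    intro i h0
    by_contra hr
    obtain ⟨w, hw⟩ := (hex i (Pi.single ⟨0, Nat.pos_of_ne_zero hr⟩ 1)).mp (by simp [h0])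
    have h1 := congrFun hw ⟨0, Nat.pos_of_ne_zero hr⟩
    rw [Pi.single_eq_same, Matrix.mulVecLin_apply, Matrix.mulVec, dotProduct] at h1
    exact hm ((Ideal.eq_top_iff_one m).mpr (h1 ▸ Ideal.sum_mem _ fun c _ =>
      m.mul_mem_right _ (hmin _ _ _)))
  obtain ⟨t, rfl⟩ : ∃ t, j = i + 1 + t := ⟨j - (i + 1), by omega⟩
  clear hij
  induction t with
  | zero => exact step i h0
  | succ t ih =>
    refine step (i + 1 + t) ?_
    ext a
    exact (Fin.cast ih a).elim0

/-- A minimal resolution of a module of finite projective dimension is finite. -/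
theorem exists_rank_eq_zero [IsDomain R] (m : Ideal R) (hm : m ≠ ⊤) {M : Type w} [AddCommGroup M]
    [Module R M] (hmin : ∀ i a c, D i a c ∈ m)
    (hex : ∀ i, Function.Exact (D (i + 1)).mulVecLin (D i).mulVecLin)
    (aug : (Fin (rank 0) → R) →ₗ[R] M) (haug : Function.Surjective aug)
    (hex0 : Function.Exact (D 0).mulVecLin aug)
    (hpd : projectiveDimension (ModuleCat.of R M) < ⊤) :
    ∃ s, ∀ i, s < i → rank i = 0 := by
  obtain ⟨n, hn⟩ : ∃ n : ℕ, HasProjectiveDimensionLT (ModuleCat.of R M) (n + 2) := by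
    induction h : projectiveDimension (ModuleCat.of R M) using WithBot.recBotCoe with
    | bot =>
      exact ⟨0, (projectiveDimension_lt_iff (n := 2)).mp (by rw [h]; exact WithBot.bot_lt_coe _)⟩
    | coe a =>
      rw [h] at hpd
      induction a using ENat.recTopCoe with
      | top => exact absurd hpd (lt_irrefl _)
      | coe a =>
        refine ⟨a, (projectiveDimension_lt_iff (n := a + 2)).mp ?_⟩
        rw [h]
        have : ((a : ℕ∞)) < ((a + 2 : ℕ) : ℕ∞) := by exact_mod_cast (by omega : a < a + 2)
        exact WithBot.coe_lt_coe.mpr this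
  have hproj : ∀ r : ℕ, Projective (ModuleCat.of R (Fin r → R)) := fun r =>
    (IsProjective.iff_projective _).mp inferInstance
  have hLT : ∀ (r t : ℕ), HasProjectiveDimensionLT (ModuleCat.of R (Fin r → R)) (t + 1) := by
    intro r t
    have := hproj r
    exact hasProjectiveDimensionLT_of_ge _ 1 _ (by omega)
  have hchain : ∀ i t, i + t = n →
      HasProjectiveDimensionLT (ModuleCat.of R (LinearMap.range (D i).mulVecLin)) (t + 1) := by
    intro i
    induction i with
    | zero =>
      intro t ht
      obtain rfl : t = n := by omega
      exact (shortExact_of_surjective (LinearMap.range (D 0).mulVecLin).injective_subtype haug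
        (by intro x; rw [hex0 x]; simp)).hasProjectiveDimensionLT_X₁ (t + 1) (hLT _ _) hn
    | succ i ih =>
      intro t ht
      exact (shortExact_of_surjective (LinearMap.range (D (i + 1)).mulVecLin).injective_subtype
        (LinearMap.surjective_rangeRestrict _)
        (exact_rangeRestrict (hex i))).hasProjectiveDimensionLT_X₁ (t + 1) (hLT _ _)
          (ih (t + 1) (by omega))
  have hP : Module.Projective R (LinearMap.range (D n).mulVecLin) := by
    have := projective_iff_hasProjectiveDimensionLT_one.mpr (hchain n 0 (by omega))
    exact (IsProjective.iff_projective _).mpr this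
  refine ⟨n + 1, fun i hi => rank_eq_zero_of_minimal m hm hmin hex (i := n + 1) ?_ i hi⟩
  -- `σ` splits `F_{n+1} → im D_n`, and `e` is the resulting projection onto the kernel
  obtain ⟨σ, hσ⟩ := Module.projective_lifting_property (D n).mulVecLin.rangeRestrict LinearMap.id
    (LinearMap.surjective_rangeRestrict _)
  set e : (Fin (rank (n + 1)) → R) →ₗ[R] (Fin (rank (n + 1)) → R) :=
    LinearMap.id - σ.comp (D n).mulVecLin.rangeRestrict with he
  have hDe : ∀ v, (D n).mulVecLin (e v) = 0 := by
    intro v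
    have h1 : (D n).mulVecLin.rangeRestrict (e v) = 0 := by
      have := LinearMap.congr_fun hσ ((D n).mulVecLin.rangeRestrict v)
      simp only [LinearMap.comp_apply, LinearMap.id_apply] at this
      simp only [he, LinearMap.sub_apply, LinearMap.id_apply, LinearMap.comp_apply, map_sub, this,
        sub_self]
    exact congrArg Subtype.val h1
  have hek : ∀ v, (D n).mulVecLin v = 0 → e v = v := by
    intro v hv
    have h1 : (D n).mulVecLin.rangeRestrict v = 0 := Subtype.ext hv
    simp [he, h1]
  have hzero : LinearMap.toMatrix' e = 0 := by
    refine eq_zero_of_isIdempotentElem m hm _ ?_ ?_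
    · rw [IsIdempotentElem, ← LinearMap.toMatrix'_mul]
      congr 1
      exact LinearMap.ext fun v => hek _ (hDe v)
    · intro a c
      obtain ⟨w, hw⟩ := (hex n (e (Pi.single c 1))).mp (hDe _)
      rw [LinearMap.toMatrix'_apply, ← hw, Matrix.mulVecLin_apply, Matrix.mulVec, dotProduct]
      exact Ideal.sum_mem _ fun b _ => m.mul_mem_right _ (hmin _ _ _)
  have he0 : e = 0 := by
    rw [← LinearMap.toMatrix'.map_eq_zero_iff]; exact hzero
  rw [← Matrix.toLin'.map_eq_zero_iff]
  refine LinearMap.ext fun v => ?_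
  have hv : (D n).mulVecLin ((D (n + 1)).mulVecLin v) = 0 := (hex n _).mpr ⟨v, rfl⟩
  have := hek _ hv
  rw [he0] at this
  simpa [Matrix.toLin'_apply] using this.symm

end Complexes

/-! ### Frobenius powers of minimal resolutions -/

section Frobenius

variable {R : Type w} [CommRing R]

theorem exists_mul_eq_of_range_le {a b c : ℕ} (A : Matrix (Fin a) (Fin b) R)
    (B : Matrix (Fin a) (Fin c) R)
    (h : ∀ j, A.mulVecLin (Pi.single j 1) ∈ LinearMap.range B.mulVecLin) :
    ∃ H : Matrix (Fin c) (Fin b) R, B * H = A := by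
  choose w hw using h
  refine ⟨Matrix.of fun i j => w j i, ?_⟩
  ext i j
  have := congrFun (hw j) i
  rw [Matrix.mulVecLin_apply, Matrix.mulVecLin_apply, Matrix.mulVec_single_one] at this
  exact this

variable {rank : ℕ → ℕ} {D : (i : ℕ) → Matrix (Fin (rank i)) (Fin (rank (i + 1))) R}

theorem mul_eq_zero_of_exact
    (hex : ∀ i, Function.Exact (D (i + 1)).mulVecLin (D i).mulVecLin) (i : ℕ) :
    D i * D (i + 1) = 0 := by
  rw [← Matrix.toLin'.map_eq_zero_iff]
  refine LinearMap.ext fun v => ?_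
  have := (hex i _).mpr ⟨v, rfl⟩
  simpa [Matrix.toLin'_apply] using this

/-- Multiplication by an element which annihilates the resolved module is null-homotopic on a free
resolution. -/
theorem exists_homotopy (hex : ∀ i, Function.Exact (D (i + 1)).mulVecLin (D i).mulVecLin)
    {y : R} (hy : ∀ v, y • v ∈ LinearMap.range (D 0).mulVecLin) (i : ℕ) :
    ∃ (H : Matrix (Fin (rank (i + 1))) (Fin (rank i)) R)
      (H' : Matrix (Fin (rank (i + 1 + 1))) (Fin (rank (i + 1))) R),
      D (i + 1) * H' + H * D i = y • (1 : Matrix (Fin (rank (i + 1))) (Fin (rank (i + 1))) R) := by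
  have hDD := mul_eq_zero_of_exact hex
  have hstep : ∀ i (H : Matrix (Fin (rank (i + 1))) (Fin (rank i)) R),
      D i * H * D i = y • D i → ∃ H' : Matrix (Fin (rank (i + 1 + 1))) (Fin (rank (i + 1))) R,
        D (i + 1) * H' = y • 1 - H * D i := by
    intro i H hH
    refine exists_mul_eq_of_range_le _ _ fun j => ?_
    refine (hex i _).mp ?_
    rw [← LinearMap.comp_apply, ← Matrix.mulVecLin_mul]
    have : D i * (y • 1 - H * D i) = 0 := by
      rw [Matrix.mul_sub, Matrix.mul_smul, Matrix.mul_one, ← Matrix.mul_assoc, hH, sub_self]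
    rw [this]
    simp
  have hH : ∃ H : Matrix (Fin (rank (i + 1))) (Fin (rank i)) R, D i * H * D i = y • D i := by
    induction i with
    | zero =>
      obtain ⟨H, hH⟩ := exists_mul_eq_of_range_le (y • (1 : Matrix (Fin (rank 0)) (Fin (rank 0)) R))
        (D 0) (fun j => by
          have := hy (Pi.single j 1)
          rwa [Matrix.mulVecLin_apply, Matrix.smul_mulVec, Matrix.one_mulVec])
      exact ⟨H, by rw [hH, Matrix.smul_mul, Matrix.one_mul]⟩
    | succ i ih =>
      obtain ⟨H, hH⟩ := ih
      obtain ⟨H', hH'⟩ := hstep i H hH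
      refine ⟨H', ?_⟩
      rw [hH', Matrix.sub_mul, Matrix.smul_mul, Matrix.one_mul, Matrix.mul_assoc, hDD,
        Matrix.mul_zero, sub_zero]
  obtain ⟨H, hH⟩ := hH
  obtain ⟨H', hH'⟩ := hstep i H hH
  exact ⟨H, H', by rw [hH', sub_add_cancel]⟩

/-- After a change of rings along `f`, the homology of a free resolution is killed by the images of
the annihilators of the resolved module. -/
theorem smul_mem_range_map (hex : ∀ i, Function.Exact (D (i + 1)).mulVecLin (D i).mulVecLin)
    (f : R →+* R) {y : R} (hy : ∀ v, y • v ∈ LinearMap.range (D 0).mulVecLin) (i : ℕ)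
    (v : Fin (rank (i + 1)) → R) (hv : ((D i).map f).mulVecLin v = 0) :
    f y • v ∈ LinearMap.range ((D (i + 1)).map f).mulVecLin := by
  obtain ⟨H, H', h⟩ := exists_homotopy hex hy i
  have h2 := congrArg (fun A => A.map f) h
  simp only [Matrix.map_add f (map_add f), Matrix.map_mul] at h2
  have h3 : (y • (1 : Matrix (Fin (rank (i + 1))) (Fin (rank (i + 1))) R)).map f = f y • 1 := by
    ext a b
    simp [Matrix.one_apply, apply_ite f]
  rw [h3] at h2
  refine ⟨(H'.map f).mulVecLin v, ?_⟩
  have h4 := congrArg (fun A => A.mulVec v) h2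
  simp only [Matrix.add_mulVec, ← Matrix.mulVec_mulVec, Matrix.smul_mulVec, Matrix.one_mulVec] at h4
  rw [Matrix.mulVecLin_apply] at hv
  rw [hv, Matrix.mulVec_zero, add_zero] at h4
  exact h4

/-- The theorem of Peskine and Szpiro for modules of finite length: a Frobenius power of a minimal
resolution of finite length is exact in positive degrees. -/
theorem exact_map_of_minimal [IsDomain R] [IsNoetherianRing R] (m : Ideal R) [m.IsMaximal]
    (hm : m ≠ ⊥) {s : ℕ} (hs : ∀ i, s < i → rank i = 0) (hmin : ∀ i a c, D i a c ∈ m)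
    (hex : ∀ i, Function.Exact (D (i + 1)).mulVecLin (D i).mulVecLin)
    (hpos : 0 < rank s)
    (hsupp : ∀ x ∈ m, ∃ N : ℕ, ∀ v, x ^ N • v ∈ LinearMap.range (D 0).mulVecLin)
    (f : R →+* R) (q : ℕ) (hf : ∀ x, f x = x ^ q) (i : ℕ) :
    Function.Exact ((D (i + 1)).map f).mulVecLin ((D i).map f).mulVecLin := by
  refine exact_of_depth (D := fun i => (D i).map f) m hs
    (extVanishes_of_minimal m hm hs hpos hmin hex) (fun i => ?_) (fun i v hv x hx => ?_) i
  · rw [← Matrix.map_mul, mul_eq_zero_of_exact hex]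
    ext
    simp
  · obtain ⟨N, hN⟩ := hsupp x hx
    refine ⟨N * q, ?_⟩
    rw [pow_mul, ← hf]
    exact smul_mem_range_map hex f hN i v hv

end Frobenius

/-! ### Graded algebras with `R₀ = k` -/

section GradedBasics

variable {k : Type v} [Field k] {R : Type u} [CommRing R] [Algebra k R]

/-- A finite family of homogeneous algebra generators of positive degree. -/
structure HomogeneousGenerators (𝒜 : ℕ → Submodule k R) where
  /-- the number of generators -/
  card : ℕ
  /-- the generators -/
  gen : Fin card → R
  /-- their degrees -/
  deg : Fin card → ℕ
  deg_pos : ∀ i, 0 < deg i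
  mem : ∀ i, gen i ∈ 𝒜 (deg i)
  adjoin_eq_top : Algebra.adjoin k (Set.range gen) = ⊤

theorem pieceLength_add_finrank (𝒜 : ℕ → Submodule k R) (J : Ideal R) (m : ℕ)
    [FiniteDimensional k (𝒜 m)] :
    pieceLength 𝒜 J m + Module.finrank k ↥(𝒜 m ⊓ J.restrictScalars k) =
      Module.finrank k (𝒜 m) := by
  set f := (Ideal.Quotient.mkₐ k J).toLinearMap.domRestrict (𝒜 m) with hf
  have h1 := LinearMap.finrank_range_add_finrank_ker f
  have h2 : LinearMap.range f = quotientPiece 𝒜 J m := by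
    rw [hf, LinearMap.range_domRestrict]; rfl
  have h3 : (LinearMap.ker f).map (𝒜 m).subtype = 𝒜 m ⊓ J.restrictScalars k := by
    ext x
    simp only [Submodule.mem_map, LinearMap.mem_ker, Submodule.mem_inf,
      Submodule.restrictScalars_mem, hf, LinearMap.domRestrict_apply, AlgHom.toLinearMap_apply,
      Ideal.Quotient.mkₐ_eq_mk, Ideal.Quotient.eq_zero_iff_mem, Submodule.subtype_apply]
    constructor
    · rintro ⟨y, hy, rfl⟩
      exact ⟨y.2, hy⟩
    · rintro ⟨h, h'⟩
      exact ⟨⟨x, h⟩, h', rfl⟩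
  rw [← h1, h2, ← h3, pieceLength]
  congr 1
  exact (Submodule.equivMapOfInjective _ (𝒜 m).injective_subtype _).finrank_eq.symm

theorem pieceLength_eq_zero {𝒜 : ℕ → Submodule k R} {J : Ideal R} {m : ℕ} (h : ∀ r ∈ 𝒜 m, r ∈ J) :
    pieceLength 𝒜 J m = 0 := by
  have : quotientPiece 𝒜 J m = ⊥ := by
    rw [eq_bot_iff]
    rintro _ ⟨r, hr, rfl⟩
    exact Ideal.Quotient.eq_zero_iff_mem.mpr (h r hr)
  rw [pieceLength, this, finrank_bot]

theorem pieceLength_bot (𝒜 : ℕ → Submodule k R) (m : ℕ) :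
    pieceLength 𝒜 (⊥ : Ideal R) m = Module.finrank k (𝒜 m) := by
  refine (Submodule.equivMapOfInjective _ (fun x y hxy => ?_) _).finrank_eq.symm
  have := Ideal.Quotient.eq.mp hxy
  exact sub_eq_zero.mp this

variable (𝒜 : ℕ → Submodule k R) [GradedAlgebra 𝒜]

theorem exists_homogeneousGenerators [Algebra.FiniteType k R]
    (h𝒜 : ∀ r ∈ 𝒜 0, ∃ c : k, algebraMap k R c = r) : Nonempty (HomogeneousGenerators 𝒜) := by
  have : IsScalarTower k (𝒜 0) R := ⟨fun a b c => smul_mul_assoc a (b : R) c⟩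
  have : Algebra.FiniteType (𝒜 0) R := Algebra.FiniteType.of_restrictScalars_finiteType k (𝒜 0) R
  obtain ⟨s, hs, hdeg⟩ := GradedAlgebra.exists_finset_adjoin_eq_top_and_homogeneous_ne_zero 𝒜
  choose! e he0 he using hdeg
  let f := s.equivFin.symm
  refine ⟨⟨s.card, fun i => f i, fun i => e (f i), fun i => Nat.pos_of_ne_zero (he0 _ (f i).2),
    fun i => he _ (f i).2, ?_⟩⟩
  have hrange : Set.range (fun i => (f i : R)) = s := by
    ext x
    constructor
    · rintro ⟨i, rfl⟩
      exact (f i).2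
    · intro hx
      exact ⟨s.equivFin ⟨x, hx⟩, by simp [f]⟩
  rw [hrange, eq_top_iff]
  intro x _
  have hx : x ∈ Algebra.adjoin (𝒜 0) (s : Set R) := by rw [hs]; trivial
  induction hx using Algebra.adjoin_induction with
  | mem x hx => exact Algebra.subset_adjoin hx
  | algebraMap r =>
    obtain ⟨c, hc⟩ := h𝒜 r r.2
    have : algebraMap (𝒜 0) R r = algebraMap k R c := by rw [hc]; rfl
    rw [this]
    exact Subalgebra.algebraMap_mem _ _
  | add x y _ _ hx hy => exact Subalgebra.add_mem _ (hx trivial) (hy trivial)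
  | mul x y _ _ hx hy => exact Subalgebra.mul_mem _ (hx trivial) (hy trivial)

variable {𝒜}

namespace HomogeneousGenerators

theorem monomial_mem (G : HomogeneousGenerators 𝒜) (α : Fin G.card →₀ ℕ) :
    ∏ i, G.gen i ^ α i ∈ 𝒜 (∑ i, α i * G.deg i) := by
  refine SetLike.prod_mem_graded _ _ _ fun i _ => ?_
  have := SetLike.pow_mem_graded (α i) (G.mem i)
  rwa [smul_eq_mul] at this

/-- Every homogeneous element is a combination of monomials of its degree in the generators. -/
theorem mem_of_monomials_mem (G : HomogeneousGenerators 𝒜) {m : ℕ} {N : Submodule k R}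
    (hN : ∀ α : Fin G.card →₀ ℕ, ∑ i, α i * G.deg i = m → ∏ i, G.gen i ^ α i ∈ N) {r : R}
    (hr : r ∈ 𝒜 m) : r ∈ N := by
  have hmem : r ∈ Algebra.adjoin k (Set.range G.gen) := by rw [G.adjoin_eq_top]; trivial
  rw [Algebra.adjoin_range_eq_range_aeval] at hmem
  obtain ⟨P, hP⟩ := hmem
  have h1 : r = GradedAlgebra.proj 𝒜 m r := (DirectSum.decompose_of_mem_same 𝒜 hr).symm
  rw [h1, ← hP, AlgHom.toRingHom_eq_coe, RingHom.coe_coe, MvPolynomial.aeval_eq_eval₂Hom,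
    MvPolynomial.coe_eval₂Hom, MvPolynomial.eval₂_eq', map_sum]
  refine Submodule.sum_mem _ fun α _ => ?_
  rw [← Algebra.smul_def, map_smul]
  refine Submodule.smul_mem _ _ ?_
  by_cases hα : ∑ i, α i * G.deg i = m
  · rw [GradedAlgebra.proj_apply, DirectSum.decompose_of_mem_same 𝒜 (hα ▸ G.monomial_mem α)]
    exact hN α hα
  · rw [GradedAlgebra.proj_apply, DirectSum.decompose_of_mem_ne 𝒜 (G.monomial_mem α) hα]
    exact N.zero_mem

theorem finiteDimensional (G : HomogeneousGenerators 𝒜) (m : ℕ) : FiniteDimensional k (𝒜 m) := by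
  have hfin : Set.Finite {α : Fin G.card → ℕ | ∀ i, α i ≤ m} := by
    have := Set.Finite.pi' (fun _ : Fin G.card => Set.finite_Iic m)
    exact this
  have hle : 𝒜 m ≤ Submodule.span k
      ((fun α : Fin G.card → ℕ => ∏ i, G.gen i ^ α i) '' {α | ∀ i, α i ≤ m}) := by
    intro r hr
    refine G.mem_of_monomials_mem (fun α hα => Submodule.subset_span ?_) hr
    refine ⟨α, fun i => ?_, rfl⟩
    calc α i ≤ α i * G.deg i := Nat.le_mul_of_pos_right _ (G.deg_pos i)
      _ ≤ ∑ j, α j * G.deg j :=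
        Finset.single_le_sum (f := fun j => α j * G.deg j) (fun _ _ => Nat.zero_le _)
          (Finset.mem_univ i)
      _ = m := hα
  have := FiniteDimensional.span_of_finite k (hfin.image
    (fun α : Fin G.card → ℕ => ∏ i, G.gen i ^ α i))
  exact Submodule.finiteDimensional_of_le hle

/-- An ideal containing the `M`-th powers of the generators contains all elements of large degree,
with a bound linear in `M`. -/
theorem le_of_pow_mem (G : HomogeneousGenerators 𝒜) {J : Ideal R} {M : ℕ} (hM : 0 < M)
    (hJ : ∀ i, G.gen i ^ M ∈ J) {m : ℕ} (hm : (1 + ∑ i, G.deg i) * M ≤ m) :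
    ∀ r ∈ 𝒜 m, r ∈ J := by
  intro r hr
  refine G.mem_of_monomials_mem (N := J.restrictScalars k) (fun α hα => ?_) hr
  obtain ⟨i, hi⟩ : ∃ i, M ≤ α i := by
    by_contra! hlt
    have : ∑ i, α i * G.deg i ≤ ∑ i, M * G.deg i :=
      Finset.sum_le_sum fun i _ => Nat.mul_le_mul_right _ (hlt i).le
    rw [hα, ← Finset.mul_sum] at this
    have : (1 + ∑ i, G.deg i) * M = M + M * ∑ i, G.deg i := by ring
    omega
  rw [Submodule.restrictScalars_mem, ← Finset.mul_prod_erase _ _ (Finset.mem_univ i)]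
  refine J.mul_mem_right _ ?_
  rw [← Nat.sub_add_cancel hi, pow_add]
  exact J.mul_mem_left _ (hJ i)

end HomogeneousGenerators

theorem mem_irrelevant_iff_proj (r : R) :
    r ∈ (HomogeneousIdeal.irrelevant 𝒜).toIdeal ↔ GradedAlgebra.proj 𝒜 0 r = 0 :=
  HomogeneousIdeal.mem_irrelevant_iff 𝒜 r

theorem exists_algebraMap_sub_mem (h𝒜 : ∀ r ∈ 𝒜 0, ∃ c : k, algebraMap k R c = r) (r : R) :
    ∃ c : k, r - algebraMap k R c ∈ (HomogeneousIdeal.irrelevant 𝒜).toIdeal := by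
  obtain ⟨c, hc⟩ := h𝒜 _ (DirectSum.decompose 𝒜 r 0).2
  refine ⟨c, ?_⟩
  rw [mem_irrelevant_iff_proj, map_sub, hc, GradedAlgebra.proj_apply, GradedAlgebra.proj_apply,
    DirectSum.decompose_of_mem_same 𝒜 (DirectSum.decompose 𝒜 r 0).2, sub_self]

theorem irrelevant_ne_top [Nontrivial R] : (HomogeneousIdeal.irrelevant 𝒜).toIdeal ≠ ⊤ := by
  rw [Ne, Ideal.eq_top_iff_one, mem_irrelevant_iff_proj, GradedAlgebra.proj_apply,
    DirectSum.decompose_of_mem_same 𝒜 (SetLike.one_mem_graded 𝒜)]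
  exact one_ne_zero

theorem irrelevant_isMaximal [Nontrivial R] (h𝒜 : ∀ r ∈ 𝒜 0, ∃ c : k, algebraMap k R c = r) :
    (HomogeneousIdeal.irrelevant 𝒜).toIdeal.IsMaximal := by
  rw [Ideal.isMaximal_iff]
  refine ⟨fun h => irrelevant_ne_top ((Ideal.eq_top_iff_one _).mpr h), fun J x hJ hx hxJ => ?_⟩
  obtain ⟨c, hc⟩ := exists_algebraMap_sub_mem h𝒜 x
  have hc0 : c ≠ 0 := by
    rintro rfl
    rw [map_zero, sub_zero] at hc
    exact hx hc
  have h1 : algebraMap k R c ∈ J := by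
    have := J.sub_mem hxJ (hJ hc)
    rwa [sub_sub_cancel] at this
  have h2 := J.mul_mem_left (algebraMap k R c⁻¹) h1
  rwa [← map_mul, inv_mul_cancel₀ hc0, map_one] at h2

theorem le_irrelevant (h𝒜 : ∀ r ∈ 𝒜 0, ∃ c : k, algebraMap k R c = r) {I : Ideal R}
    (hI : I.IsHomogeneous 𝒜) (hI_ne : I ≠ ⊤) : I ≤ (HomogeneousIdeal.irrelevant 𝒜).toIdeal := by
  intro x hx
  rw [mem_irrelevant_iff_proj]
  obtain ⟨c, hc⟩ := h𝒜 _ (DirectSum.decompose 𝒜 x 0).2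
  have h1 : algebraMap k R c ∈ I := by
    rw [hc]; exact hI 0 hx
  rw [GradedAlgebra.proj_apply, ← hc]
  by_contra h0
  have hc0 : c ≠ 0 := by
    rintro rfl
    exact h0 (map_zero _)
  have h2 := I.mul_mem_left (algebraMap k R c⁻¹) h1
  rw [← map_mul, inv_mul_cancel₀ hc0, map_one] at h2
  exact hI_ne ((Ideal.eq_top_iff_one _).mpr h2)

/-- A homogeneous ideal of finite colength contains a power of every element of positive degree. -/
theorem exists_pow_mem (h𝒜 : ∀ r ∈ 𝒜 0, ∃ c : k, algebraMap k R c = r) {I : Ideal R}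
    (hI : I.IsHomogeneous 𝒜) (hI_ne : I ≠ ⊤) (hI_len : IsFiniteLength R (R ⧸ I)) {x : R}
    (hx : x ∈ (HomogeneousIdeal.irrelevant 𝒜).toIdeal) : ∃ N : ℕ, x ^ N ∈ I := by
  change x ∈ I.radical
  rw [Ideal.radical_eq_sInf, Ideal.mem_sInf]
  intro P ⟨hIP, hP⟩
  -- the homogeneous core of `P` is a prime ideal containing `I`, hence maximal
  set Q := (P.homogeneousCore 𝒜).toIdeal with hQ
  have hQp : Q.IsPrime := Ideal.IsPrime.homogeneousCore hP
  have hIQ : I ≤ Q := by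
    rw [← hI.toIdeal_homogeneousCore_eq_self]
    exact Ideal.homogeneousCore_mono 𝒜 hIP
  have hQm : Q.IsMaximal := by
    have hart : IsArtinianRing (R ⧸ I) := by
      have h1 := (isFiniteLength_iff_isNoetherian_isArtinian.mp hI_len).2
      exact isArtinian_of_tower R h1
    have hmap : (Q.map (Ideal.Quotient.mk I)).IsPrime :=
      Ideal.map_isPrime_of_surjective Ideal.Quotient.mk_surjective (by rwa [Ideal.mk_ker])
    have hmax := IsArtinianRing.isMaximal_of_isPrime (Q.map (Ideal.Quotient.mk I))
    have := Ideal.comap_isMaximal_of_surjective (Ideal.Quotient.mk I)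
      Ideal.Quotient.mk_surjective (K := Q.map (Ideal.Quotient.mk I))
    rwa [Ideal.comap_map_of_surjective _ Ideal.Quotient.mk_surjective, ← RingHom.ker_eq_comap_bot,
      Ideal.mk_ker, sup_eq_left.mpr hIQ] at this
  have hle : Q ≤ (HomogeneousIdeal.irrelevant 𝒜).toIdeal :=
    le_irrelevant h𝒜 (HomogeneousIdeal.isHomogeneous _) hQp.ne_top
  have : Nontrivial R := by
    by_contra hn
    rw [not_nontrivial_iff_subsingleton] at hn
    exact hI_ne (Subsingleton.elim _ _)
  have heq : Q = (HomogeneousIdeal.irrelevant 𝒜).toIdeal := hQm.eq_of_le irrelevant_ne_top hle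
  rw [← heq] at hx
  exact Ideal.toIdeal_homogeneousCore_le 𝒜 P hx

theorem bracketPower_isHomogeneous {I : Ideal R} (hI : I.IsHomogeneous 𝒜) (p n : ℕ)
    [Fact p.Prime] [CharP R p] : (bracketPower I (p ^ n)).IsHomogeneous 𝒜 := by
  have : ExpChar R p := ExpChar.prime Fact.out
  have heq : bracketPower I (p ^ n) =
      Ideal.span ((fun a : R => a ^ p ^ n) '' {a | a ∈ I ∧ SetLike.IsHomogeneousElem 𝒜 a}) := by
    refine le_antisymm (Ideal.span_le.mpr ?_) (Ideal.span_mono (Set.image_mono fun a ha => ha.1))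
    rintro _ ⟨a, ha, rfl⟩
    classical
    rw [SetLike.mem_coe]
    simp only
    rw [← DirectSum.sum_support_decompose 𝒜 a, sum_pow_char_pow]
    exact Ideal.sum_mem _ fun i _ => Ideal.subset_span
      ⟨_, ⟨hI i ha, ⟨i, (DirectSum.decompose 𝒜 a i).2⟩⟩, rfl⟩
  rw [heq]
  refine Ideal.homogeneous_span _ _ ?_
  rintro _ ⟨a, ⟨_, i, hi⟩, rfl⟩
  exact ⟨_, SetLike.pow_mem_graded (p ^ n) hi⟩

end GradedBasics

/-! ### The Hilbert function is eventually polynomial -/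

section EventuallyPolynomial

open Polynomial in
/-- Every polynomial over `ℚ` is the difference function of a polynomial. -/
theorem exists_eval_add_one_sub (Q : ℚ[X]) :
    ∃ P : ℚ[X], ∀ x : ℚ, P.eval (x + 1) - P.eval x = Q.eval x := by
  induction Q using Polynomial.induction_on' with
  | add p q hp hq =>
    obtain ⟨P, hP⟩ := hp
    obtain ⟨P', hP'⟩ := hq
    refine ⟨P + P', fun x => ?_⟩
    rw [eval_add, eval_add, eval_add, ← hP, ← hP']
    ring
  | monomial n a =>
    refine ⟨C (a / (n + 1)) * Polynomial.bernoulli (n + 1), fun x => ?_⟩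
    rw [eval_mul, eval_mul, eval_C, add_comm x 1, Polynomial.bernoulli_eval_one_add,
      eval_monomial]
    have : (n : ℚ) + 1 ≠ 0 := by positivity
    rw [Nat.add_sub_cancel, eval_C]
    push_cast
    field_simp
    ring

/-- `f(n)` agrees with a polynomial in `n` for large `n`. -/
def EventuallyPolynomial (f : ℕ → ℕ) : Prop :=
  ∃ P : Polynomial ℚ, ∀ᶠ n in atTop, (f n : ℚ) = P.eval (n : ℚ)

theorem EventuallyPolynomial.of_eventually_zero {f : ℕ → ℕ} (h : ∀ᶠ n in atTop, f n = 0) :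
    EventuallyPolynomial f :=
  ⟨0, h.mono fun n hn => by simp [hn]⟩

theorem EventuallyPolynomial.of_succ_eq {f g h : ℕ → ℕ} (hg : EventuallyPolynomial g)
    (hh : EventuallyPolynomial h) (H : ∀ n, f (n + 1) = g (n + 1) + h n) :
    EventuallyPolynomial f := by
  obtain ⟨P, hP⟩ := hg
  obtain ⟨Q, hQ⟩ := hh
  refine ⟨P + Q.comp (Polynomial.X - 1), ?_⟩
  have h1 : ∀ᶠ n in atTop, (f (n + 1) : ℚ) =
      (P + Q.comp (Polynomial.X - 1)).eval ((n + 1 : ℕ) : ℚ) := by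
    filter_upwards [(tendsto_add_atTop_nat 1).eventually hP, hQ] with n h1 h2
    rw [H, Nat.cast_add, h1, h2]
    simp
  rw [← map_add_atTop_eq_nat 1]
  exact h1

/-- A function whose differences are eventually polynomial is eventually polynomial. -/
theorem EventuallyPolynomial.of_sub {f g : ℕ → ℕ} (hg : EventuallyPolynomial g)
    (H : ∀ n, f (n + 1) = g (n + 1) + f n) : EventuallyPolynomial f := by
  obtain ⟨Q, hQ⟩ := hg
  obtain ⟨P, hP⟩ := exists_eval_add_one_sub (Q.comp (Polynomial.X + 1))
  obtain ⟨N, hN⟩ := eventually_atTop.mp hQ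
  refine ⟨P + Polynomial.C ((f N : ℚ) - P.eval (N : ℚ)), eventually_atTop.mpr ⟨N, fun n hn => ?_⟩⟩
  induction n, hn using Nat.le_induction with
  | base => simp
  | succ n hn ih =>
    have h1 := hP n
    rw [Polynomial.eval_comp] at h1
    rw [H, Nat.cast_add, hN (n + 1) (by omega), ih]
    simp only [Polynomial.eval_add, Polynomial.eval_C, Polynomial.eval_X, Polynomial.eval_one]
      at h1 ⊢
    push_cast
    linarith

end EventuallyPolynomial

section HilbertFunction

variable {k : Type v} [Field k] {R : Type u} [CommRing R] [Algebra k R]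
  {𝒜 : ℕ → Submodule k R} [GradedAlgebra 𝒜]

/-- The colon ideal `(J : y)`. -/
def colonElement (J : Ideal R) (y : R) : Ideal R :=
  Submodule.comap (LinearMap.mulLeft R y) J

theorem mem_colonElement {J : Ideal R} {y r : R} : r ∈ colonElement J y ↔ y * r ∈ J := Iff.rfl

theorem colonElement_isHomogeneous {J : Ideal R} (hJ : J.IsHomogeneous 𝒜) {y : R} {e : ℕ}
    (hy : y ∈ 𝒜 e) : (colonElement J y).IsHomogeneous 𝒜 := by
  intro i r hr
  rw [mem_colonElement] at hr ⊢
  have := hJ (e + i) hr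
  rwa [DirectSum.coe_decompose_mul_add_of_left_mem 𝒜 hy] at this

/-- The Hilbert function along the exact sequence
`0 → R / (J : y) (-e) → R / J → R / (J + y R) → 0`. -/
theorem pieceLength_add {J : Ideal R} (hJ : J.IsHomogeneous 𝒜) {y : R} {e : ℕ} (hy : y ∈ 𝒜 e)
    (m : ℕ) [FiniteDimensional k (𝒜 m)] [FiniteDimensional k (𝒜 (e + m))] :
    pieceLength 𝒜 J (e + m) =
      pieceLength 𝒜 (J ⊔ Ideal.span {y}) (e + m) + pieceLength 𝒜 (colonElement J y) m := by
  set f : 𝒜 m →ₗ[k] R ⧸ J :=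
    ((Ideal.Quotient.mkₐ k J).toLinearMap.comp (LinearMap.mulLeft k y)).domRestrict (𝒜 m) with hf
  have hfapp : ∀ r, f r = Ideal.Quotient.mk J (y * r) := fun r => rfl
  have h1 := LinearMap.finrank_range_add_finrank_ker f
  have h3 : (LinearMap.ker f).map (𝒜 m).subtype =
      𝒜 m ⊓ (colonElement J y).restrictScalars k := by
    ext x
    simp only [Submodule.mem_map, LinearMap.mem_ker, Submodule.mem_inf,
      Submodule.restrictScalars_mem, hfapp, Ideal.Quotient.eq_zero_iff_mem,
      Submodule.subtype_apply, mem_colonElement]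
    constructor
    · rintro ⟨y, hy, rfl⟩
      exact ⟨y.2, hy⟩
    · rintro ⟨h, h'⟩
      exact ⟨⟨x, h⟩, h', rfl⟩
  have h4 : Module.finrank k (LinearMap.range f) = pieceLength 𝒜 (colonElement J y) m := by
    have h5 := pieceLength_add_finrank 𝒜 (colonElement J y) m
    rw [← h3, ← (Submodule.equivMapOfInjective _ (𝒜 m).injective_subtype _).finrank_eq] at h5
    omega
  set g : quotientPiece 𝒜 J (e + m) →ₗ[k] R ⧸ (J ⊔ Ideal.span {y}) :=
    (Ideal.Quotient.factorₐ k (le_sup_left : J ≤ J ⊔ Ideal.span {y})).toLinearMap.domRestrict _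
    with hg
  have hfin : FiniteDimensional k (quotientPiece 𝒜 J (e + m)) := by
    unfold quotientPiece; infer_instance
  have h6 := LinearMap.finrank_range_add_finrank_ker g
  have h7 : LinearMap.range g = quotientPiece 𝒜 (J ⊔ Ideal.span {y}) (e + m) := by
    rw [hg, LinearMap.range_domRestrict, quotientPiece, quotientPiece, ← Submodule.map_comp]
    rfl
  have h8 : (LinearMap.ker g).map (quotientPiece 𝒜 J (e + m)).subtype = LinearMap.range f := by
    ext x
    constructor
    · rintro ⟨⟨_, r, hr, rfl⟩, hz, rfl⟩
      have hz' : r ∈ J ⊔ Ideal.span {y} := Ideal.Quotient.eq_zero_iff_mem.mp hz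
      obtain ⟨j, hj, t, ht, hjt⟩ := Submodule.mem_sup.mp hz'
      obtain ⟨s, rfl⟩ := Ideal.mem_span_singleton'.mp ht
      refine ⟨⟨_, (DirectSum.decompose 𝒜 s m).2⟩, ?_⟩
      rw [hfapp]
      have hr' : r = (DirectSum.decompose 𝒜 j (e + m) : R) +
          y * (DirectSum.decompose 𝒜 s m : R) := by
        rw [← DirectSum.coe_decompose_mul_add_of_left_mem 𝒜 hy, mul_comm y s,
          ← DirectSum.decompose_of_mem_same 𝒜 hr, ← hjt, DirectSum.decompose_add]
        rfl
      refine Ideal.Quotient.eq.mpr ?_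
      have := J.neg_mem (hJ (e + m) hj)
      rw [hr']
      convert this using 1
      ring
    · rintro ⟨r, rfl⟩
      rw [hfapp]
      refine ⟨⟨Ideal.Quotient.mk J (y * r), ⟨y * r, SetLike.mul_mem_graded hy r.2, rfl⟩⟩, ?_, rfl⟩
      exact Ideal.Quotient.eq_zero_iff_mem.mpr (Ideal.mem_sup_right
        (Ideal.mul_mem_right _ _ (Ideal.mem_span_singleton_self y)))
  rw [h7, (Submodule.equivMapOfInjective _ (Submodule.injective_subtype _) _).finrank_eq, h8,
    h4] at h6
  exact h6.symm

/-- If all generators of `R` have degree dividing `e`, then the Hilbert function of `R / J` along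
the multiples of `e` is eventually polynomial. The proof is by Noetherian induction on `J`. -/
theorem eventuallyPolynomial_pieceLength [IsNoetherianRing R] (G : HomogeneousGenerators 𝒜) {e : ℕ}
    (he : 0 < e) (hdvd : ∀ i, G.deg i ∣ e) (J : Ideal R) (hJ : J.IsHomogeneous 𝒜) :
    EventuallyPolynomial fun n => pieceLength 𝒜 J (e * n) := by
  have hfd := G.finiteDimensional
  induction J using IsNoetherian.induction with
  | _ J ih =>
  by_cases hall : ∀ i, G.gen i ^ e ∈ J
  · refine EventuallyPolynomial.of_eventually_zero (eventually_atTop.mpr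
      ⟨1 + ∑ i, G.deg i, fun n hn => ?_⟩)
    refine pieceLength_eq_zero (G.le_of_pow_mem he hall ?_)
    rw [mul_comm]
    exact Nat.mul_le_mul_left e hn
  · push Not at hall
    obtain ⟨i, hi⟩ := hall
    let y := G.gen i ^ (e / G.deg i)
    have hye : y ∈ 𝒜 e := by
      have := SetLike.pow_mem_graded (e / G.deg i) (G.mem i)
      rwa [smul_eq_mul, Nat.div_mul_cancel (hdvd i)] at this
    have hyJ : y ∉ J := fun h => hi (Ideal.pow_mem_of_pow_mem J h (Nat.div_le_self _ _))
    have hsup : EventuallyPolynomial fun n => pieceLength 𝒜 (J ⊔ Ideal.span {y}) (e * n) := by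
      refine ih _ ?_ (hJ.sup (Ideal.homogeneous_span 𝒜 _ ?_))
      · exact left_lt_sup.mpr fun h => hyJ (h (Ideal.mem_span_singleton_self y))
      · rintro _ rfl
        exact ⟨e, hye⟩
    have hrec : ∀ n, pieceLength 𝒜 J (e * (n + 1)) =
        pieceLength 𝒜 (J ⊔ Ideal.span {y}) (e * (n + 1)) +
          pieceLength 𝒜 (colonElement J y) (e * n) := by
      intro n
      rw [mul_add, mul_one, add_comm]
      exact pieceLength_add hJ hye (e * n)
    by_cases hc : colonElement J y = J
    · rw [hc] at hrec
      exact hsup.of_sub hrec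
    · refine hsup.of_succ_eq (ih _ ?_ (colonElement_isHomogeneous hJ hye)) hrec
      exact lt_of_le_of_ne (fun r hr => Ideal.mul_mem_left J y hr) (Ne.symm hc)

end HilbertFunction

/-! ### Asymptotics of the Hilbert function -/

section Asymptotics

/-- Rescaling an asymptotically monomial sequence by an approximate division by `e`. -/
theorem tendsto_comp_div {v : ℕ → ℝ} {D : ℕ} {A : ℝ}
    (hv : Tendsto (fun n => v n / (n : ℝ) ^ D) atTop (𝓝 A)) {e c : ℕ} (he : 0 < e) {s : ℕ → ℕ}
    (hs₁ : ∀ᶠ a in atTop, a ≤ e * s a + c) (hs₂ : ∀ a, e * s a ≤ a + c) :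
    Tendsto (fun a => v (s a) / (a : ℝ) ^ D) atTop (𝓝 (A / (e : ℝ) ^ D)) := by
  have heR : (0 : ℝ) < e := by exact_mod_cast he
  have hsinf : Tendsto s atTop atTop := by
    rw [tendsto_atTop]
    intro b
    filter_upwards [hs₁, eventually_ge_atTop (e * b + c)] with a h1 h2
    exact Nat.le_of_mul_le_mul_left (by omega) he
  have hratio : Tendsto (fun a : ℕ => (s a : ℝ) / a) atTop (𝓝 (1 / e)) := by
    have h0 : Tendsto (fun a : ℕ => (c : ℝ) / e / a) atTop (𝓝 0) :=
      tendsto_const_div_atTop_nhds_zero_nat _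
    rw [tendsto_iff_dist_tendsto_zero]
    refine squeeze_zero' (Eventually.of_forall fun _ => dist_nonneg) ?_ h0
    filter_upwards [hs₁, eventually_gt_atTop 0] with a h1 h2
    have ha : (0 : ℝ) < a := by exact_mod_cast h2
    have h1' : (a : ℝ) ≤ e * s a + c := by exact_mod_cast h1
    have h2' : (e : ℝ) * s a ≤ a + c := by exact_mod_cast hs₂ a
    rw [Real.dist_eq, show (s a : ℝ) / a - 1 / e = (e * s a - a) / (e * a) by field_simp,
      abs_div, abs_of_pos (mul_pos heR ha), div_div]
    gcongr
    rw [abs_le]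
    constructor <;> linarith
  have h1 := (hv.comp hsinf).mul (hratio.pow D)
  rw [one_div, inv_pow, ← div_eq_mul_inv] at h1
  refine h1.congr' ?_
  filter_upwards [hsinf.eventually_gt_atTop 0] with a ha
  have : (s a : ℝ) ≠ 0 := by exact_mod_cast ha.ne'
  simp only [Function.comp]
  rw [div_pow]
  field_simp

/-- A function which is increasing with respect to all large steps and eventually polynomial along
the multiples of `e` has an asymptotically monomial growth. -/
theorem exists_tendsto_div_pow {f : ℕ → ℕ} {b e : ℕ} (he : 0 < e)
    (hmono : ∀ c, b ≤ c → ∀ a, f a ≤ f (a + c)) (hpos : ∀ᶠ a in atTop, 0 < f a)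
    (hpoly : EventuallyPolynomial fun n => f (e * n)) :
    ∃ (D : ℕ) (C : ℝ), 0 < C ∧ Tendsto (fun a => (f a : ℝ) / (a : ℝ) ^ D) atTop (𝓝 C) := by
  obtain ⟨P, hP⟩ := hpoly
  set Q : Polynomial ℝ := P.map (algebraMap ℚ ℝ) with hQ
  have hQe : ∀ᶠ n : ℕ in atTop, (f (e * n) : ℝ) = Q.eval (n : ℝ) := by
    filter_upwards [hP] with n hn
    have := congrArg (algebraMap ℚ ℝ) hn
    rw [map_natCast, ← Polynomial.eval_map_apply, map_natCast] at this
    exact this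
  have hen : Tendsto (fun n : ℕ => e * n) atTop atTop := by
    exact tendsto_id.const_mul_atTop' he
  have hpos' : ∀ᶠ n : ℕ in atTop, 0 < f (e * n) := hen.eventually hpos
  have hQ0 : Q ≠ 0 := by
    intro h0
    obtain ⟨n, h1, h2⟩ := (hQe.and hpos').exists
    rw [h0, Polynomial.eval_zero] at h1
    have : f (e * n) = 0 := by exact_mod_cast h1
    omega
  set D := Q.natDegree
  have hlim : Tendsto (fun n : ℕ => (f (e * n) : ℝ) / (n : ℝ) ^ D) atTop
      (𝓝 Q.leadingCoeff) := by
    have h1 := (Polynomial.isEquivalent_atTop_lead Q).comp_tendsto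
      (tendsto_natCast_atTop_atTop (R := ℝ))
    have h2 : Tendsto (fun n : ℕ => Q.eval (n : ℝ) / (n : ℝ) ^ D) atTop (𝓝 Q.leadingCoeff) := by
      have h3 := h1.div (Asymptotics.IsEquivalent.refl (u := fun n : ℕ => (n : ℝ) ^ D))
      refine h3.symm.tendsto_nhds ?_
      refine tendsto_const_nhds.congr' ?_
      filter_upwards [eventually_gt_atTop 0] with n hn
      have : (n : ℝ) ^ D ≠ 0 := by positivity
      exact (mul_div_cancel_right₀ _ this).symm
    exact h2.congr' (hQe.mono fun n hn => by simp only [hn])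
  have hA : 0 < Q.leadingCoeff := by
    refine lt_of_le_of_ne (ge_of_tendsto' hlim fun n => by positivity) ?_
    exact (Polynomial.leadingCoeff_ne_zero.mpr hQ0).symm
  have heR : (0 : ℝ) < e := by exact_mod_cast he
  refine ⟨D, Q.leadingCoeff / (e : ℝ) ^ D, by positivity, ?_⟩
  -- `f a` lies between the values at multiples of `e` at distance at least `b` on both sides
  have hlow := tendsto_comp_div (c := b + e) hlim he (s := fun a => (a - b) / e)
    (Eventually.of_forall fun a => by
      have := Nat.div_add_mod (a - b) e
      have := Nat.mod_lt (a - b) he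
      omega) (fun a => by
      have := Nat.mul_div_le (a - b) e
      omega)
  have hup := tendsto_comp_div (c := b + e) hlim he (s := fun a => (a + b) / e + 1)
    (Eventually.of_forall fun a => by
      have := Nat.div_add_mod (a + b) e
      have := Nat.mod_lt (a + b) he
      rw [mul_add]
      omega) (fun a => by
      have := Nat.mul_div_le (a + b) e
      rw [mul_add]
      omega)
  refine tendsto_of_tendsto_of_tendsto_of_le_of_le' hlow hup ?_ (Eventually.of_forall fun a => ?_)
  · filter_upwards [eventually_ge_atTop b] with a ha
    have h1 := Nat.mul_div_le (a - b) e
    have h2 := hmono (a - e * ((a - b) / e)) (by omega) (e * ((a - b) / e))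
    rw [Nat.add_sub_cancel' (by omega)] at h2
    have h3 : (f (e * ((a - b) / e)) : ℝ) ≤ f a := by exact_mod_cast h2
    exact div_le_div_of_nonneg_right h3 (by positivity)
  · have h1 := Nat.div_add_mod (a + b) e
    have h1' := Nat.mod_lt (a + b) he
    have h2 := hmono (e * ((a + b) / e + 1) - a) (by rw [mul_add]; omega) a
    rw [Nat.add_sub_cancel' (by rw [mul_add]; omega)] at h2
    have h3 : (f a : ℝ) ≤ f (e * ((a + b) / e + 1)) := by exact_mod_cast h2
    exact div_le_div_of_nonneg_right h3 (by positivity)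

/-- Summation of an asymptotically monomial function. -/
theorem tendsto_sum_div_pow {f : ℕ → ℝ} {D : ℕ} {C : ℝ}
    (hf : Tendsto (fun a => f a / (a : ℝ) ^ D) atTop (𝓝 C)) :
    Tendsto (fun N => (∑ a ∈ Finset.range N, f a) / (N : ℝ) ^ (D + 1)) atTop
      (𝓝 (C / (D + 1))) := by
  set g : ℕ → ℝ := fun a => ((a + 1 : ℕ) : ℝ) ^ (D + 1) - (a : ℝ) ^ (D + 1) with hg
  have hsum : ∀ N, ∑ a ∈ Finset.range N, g a = (N : ℝ) ^ (D + 1) := by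
    intro N
    rw [Finset.sum_range_sub (fun a : ℕ => (a : ℝ) ^ (D + 1))]
    simp
  have hg0 : ∀ a, 0 ≤ g a := fun a => sub_nonneg.mpr (by gcongr; simp)
  have hglim : Tendsto (fun a => g a / (a : ℝ) ^ D) atTop (𝓝 (D + 1)) := by
    have h1 : HasDerivAt (fun x : ℝ => (1 + x) ^ (D + 1)) (D + 1) 0 := by
      have := ((hasDerivAt_id (0 : ℝ)).const_add 1).fun_pow (D + 1)
      simpa using this
    have h2 := h1.tendsto_slope
    have h3 : Tendsto (fun a : ℕ => (a : ℝ)⁻¹) atTop (𝓝[≠] 0) :=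
      (tendsto_inv_atTop_nhdsGT_zero.mono_right (nhdsGT_le_nhdsNE 0)).comp
        tendsto_natCast_atTop_atTop
    refine (h2.comp h3).congr' ?_
    filter_upwards [eventually_gt_atTop 0] with a ha
    have ha' : (a : ℝ) ≠ 0 := by positivity
    simp only [Function.comp, slope_def_field, hg]
    have : 1 + (a : ℝ)⁻¹ = (a + 1) / a := by field_simp
    rw [this, div_pow]
    push_cast
    field_simp
    simp
    ring
  -- `g a` is asymptotic to `(D + 1) a^D` and has partial sums `N^(D + 1)`
  have ho : (fun a => f a - C / (D + 1) * g a) =o[atTop] g := by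
    have hD : ((D : ℝ) + 1) ≠ 0 := by positivity
    have h1 : Tendsto (fun a => (f a - C / (D + 1) * g a) / g a) atTop (𝓝 0) := by
      have h2 := (hf.div hglim hD).sub_const (C / (D + 1))
      rw [sub_self] at h2
      refine h2.congr' ?_
      filter_upwards [eventually_gt_atTop 0, hglim.eventually_ne hD] with a ha hne
      have ha' : (a : ℝ) ^ D ≠ 0 := by positivity
      have hga : g a ≠ 0 := fun h => hne (by rw [h, zero_div])
      simp only [Pi.div_apply]
      field_simp
    rw [Asymptotics.isLittleO_iff_tendsto']
    · exact h1
    · filter_upwards [hglim.eventually_ne hD] with a hne h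
      exact absurd (by rw [h, zero_div]) hne
  have hdiv : Tendsto (fun N => ∑ a ∈ Finset.range N, g a) atTop atTop := by
    simp_rw [hsum]
    exact (tendsto_pow_atTop (by omega)).comp tendsto_natCast_atTop_atTop
  have h1 := (ho.sum_range hg0 hdiv).tendsto_div_nhds_zero
  have h2 := h1.add_const (C / (D + 1))
  rw [zero_add] at h2
  refine h2.congr' ?_
  filter_upwards [eventually_gt_atTop 0] with N hN
  have hN' : (N : ℝ) ^ (D + 1) ≠ 0 := by positivity
  rw [hsum, Finset.sum_sub_distrib, ← Finset.mul_sum, hsum]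
  field_simp
  ring

end Asymptotics

section GradingGcd

variable {k : Type v} [Field k] {R : Type u} [CommRing R] [Algebra k R] {𝒜 : ℕ → Submodule k R}

/-- As soon as `R ≠ R₀`, the supremum in the definition of `gradingGcd` is a gcd; for `R = R₀` it is
the junk value `0` of an unbounded supremum. -/
theorem gradingGcd_eq (h : ∃ m, 0 < m ∧ 𝒜 m ≠ ⊥) : gradingGcd 𝒜 = Nat.setGcd {n | 𝒜 n ≠ ⊥} := by
  obtain ⟨m, hm, hm'⟩ := h
  have hbdd : BddAbove {g : ℕ | ∀ n, 𝒜 n ≠ ⊥ → g ∣ n} :=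
    ⟨m, fun g hg => Nat.le_of_dvd hm (hg m hm')⟩
  have hmem : gradingGcd 𝒜 ∈ {g : ℕ | ∀ n, 𝒜 n ≠ ⊥ → g ∣ n} :=
    Nat.sSup_mem ⟨1, fun n _ => one_dvd n⟩ hbdd
  refine le_antisymm (Nat.le_of_dvd ?_ (Nat.dvd_setGcd_iff.mpr hmem))
    (le_csSup hbdd fun n hn => Nat.setGcd_dvd_of_mem hn)
  refine Nat.pos_of_ne_zero fun h0 => ?_
  rw [Nat.setGcd_eq_zero_iff] at h0
  exact hm.ne' (h0 hm')

theorem gradingGcd_dvd (h : ∃ m, 0 < m ∧ 𝒜 m ≠ ⊥) {n : ℕ} (hn : 𝒜 n ≠ ⊥) : gradingGcd 𝒜 ∣ n := by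
  rw [gradingGcd_eq h]
  exact Nat.setGcd_dvd_of_mem hn

theorem gradingGcd_pos (h : ∃ m, 0 < m ∧ 𝒜 m ≠ ⊥) : 0 < gradingGcd 𝒜 := by
  obtain ⟨m, hm, hm'⟩ := h
  exact Nat.pos_of_dvd_of_pos (gradingGcd_dvd ⟨m, hm, hm'⟩ hm') hm

variable [GradedAlgebra 𝒜] [IsDomain R]

/-- The degrees of the nonzero homogeneous elements of a graded domain form a numerical semigroup,
which contains all large multiples of the gcd. -/
theorem exists_forall_ne_bot (h : ∃ m, 0 < m ∧ 𝒜 m ≠ ⊥) :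
    ∃ b, ∀ c, b ≤ c → 𝒜 (gradingGcd 𝒜 * c) ≠ ⊥ := by
  let S : AddSubmonoid ℕ :=
    { carrier := {n | 𝒜 n ≠ ⊥}
      zero_mem' := by
        rw [Set.mem_ofPred_eq, Submodule.ne_bot_iff]
        exact ⟨1, SetLike.one_mem_graded 𝒜, one_ne_zero⟩
      add_mem' := by
        intro a b ha hb
        rw [Set.mem_ofPred_eq, Submodule.ne_bot_iff] at *
        obtain ⟨x, hx, hx0⟩ := ha
        obtain ⟨y, hy, hy0⟩ := hb
        exact ⟨x * y, SetLike.mul_mem_graded hx hy, mul_ne_zero hx0 hy0⟩ }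
  obtain ⟨b, hb⟩ := Nat.exists_mem_closure_of_ge {n | 𝒜 n ≠ ⊥}
  refine ⟨b, fun c hc => ?_⟩
  have hle : AddSubmonoid.closure {n | 𝒜 n ≠ ⊥} ≤ S := AddSubmonoid.closure_le.mpr fun n hn => hn
  refine hle (hb _ (hc.trans (Nat.le_mul_of_pos_left _ (gradingGcd_pos h))) ?_)
  rw [gradingGcd_eq h]
  exact dvd_mul_right _ _

theorem finrank_le_finrank_add {a b : ℕ} [FiniteDimensional k (𝒜 (a + b))] (hb : 𝒜 b ≠ ⊥) :
    Module.finrank k (𝒜 a) ≤ Module.finrank k (𝒜 (a + b)) := by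
  obtain ⟨y, hy, hy0⟩ := (Submodule.ne_bot_iff _).mp hb
  let f : 𝒜 a →ₗ[k] 𝒜 (a + b) := ((LinearMap.mulRight k y).domRestrict (𝒜 a)).codRestrict _
    fun x => SetLike.mul_mem_graded x.2 hy
  refine LinearMap.finrank_le_finrank_of_injective (f := f) fun x x' hxx => ?_
  have := congrArg Subtype.val hxx
  exact Subtype.ext (mul_right_cancel₀ hy0 this)

/-- The Hilbert function of a graded domain along the multiples of the gcd of its degrees is
asymptotic to a monomial. -/
theorem exists_tendsto_finrank_div_pow [IsNoetherianRing R] (G : HomogeneousGenerators 𝒜)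
    (h : ∃ m, 0 < m ∧ 𝒜 m ≠ ⊥) :
    ∃ (D : ℕ) (C : ℝ), 0 < C ∧ Tendsto
      (fun a : ℕ => (Module.finrank k (𝒜 (gradingGcd 𝒜 * a)) : ℝ) / (a : ℝ) ^ D) atTop (𝓝 C) := by
  obtain ⟨b, hb⟩ := exists_forall_ne_bot h
  have hfd := G.finiteDimensional
  refine exists_tendsto_div_pow (e := ∏ i, G.deg i)
    (Finset.prod_pos fun i _ => G.deg_pos i) (b := b) (fun c hc a => ?_) ?_ ?_
  · rw [mul_add]
    have := hfd (gradingGcd 𝒜 * a + gradingGcd 𝒜 * c)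
    exact finrank_le_finrank_add (hb c hc)
  · filter_upwards [eventually_ge_atTop b] with a ha
    have : Nontrivial (𝒜 (gradingGcd 𝒜 * a)) := Submodule.nontrivial_iff_ne_bot.mpr (hb a ha)
    exact Module.finrank_pos
  · have := eventuallyPolynomial_pieceLength G
      (e := gradingGcd 𝒜 * ∏ i, G.deg i)
      (Nat.mul_pos (gradingGcd_pos h) (Finset.prod_pos fun i _ => G.deg_pos i))
      (fun i => (Finset.dvd_prod_of_mem _ (Finset.mem_univ i)).mul_left _) ⊥
      (Ideal.IsHomogeneous.bot 𝒜)
    have heq : (fun n => pieceLength 𝒜 (⊥ : Ideal R) (gradingGcd 𝒜 * (∏ i, G.deg i) * n)) =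
        fun n => Module.finrank k (𝒜 (gradingGcd 𝒜 * ((∏ i, G.deg i) * n))) :=
      funext fun n => by rw [pieceLength_bot, mul_assoc]
    rwa [heq] at this

end GradingGcd

/-! ### The order of growth and the Krull dimension -/

section Growth

variable {k : Type v} [Field k] {R : Type u} [CommRing R] [Algebra k R]

theorem finrank_restrictDegree (s M : ℕ) :
    Module.finrank k (MvPolynomial.restrictDegree (Fin s) k M) = (M + 1) ^ s := by
  have e : {n : Fin s →₀ ℕ | ∀ i, n i ≤ M} ≃ (Fin s → Fin (M + 1)) :=
    { toFun n i := ⟨n.1 i, Nat.lt_succ_of_le (n.2 i)⟩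
      invFun a := ⟨Finsupp.equivFunOnFinite.symm fun i => (a i : ℕ),
        fun i => Nat.le_of_lt_succ (a i).2⟩
      left_inv n := Subtype.ext (Finsupp.ext fun i => rfl)
      right_inv a := rfl }
  have b := MvPolynomial.basisRestrictSupport k {n : Fin s →₀ ℕ | ∀ i, n i ≤ M}
  rw [MvPolynomial.restrictDegree, Module.finrank_eq_nat_card_basis b, Nat.card_congr e,
    Nat.card_eq_fintype_card, Fintype.card_fun, Fintype.card_fin, Fintype.card_fin]

theorem finite_restrictDegree (s M : ℕ) :
    FiniteDimensional k (MvPolynomial.restrictDegree (Fin s) k M) :=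
  FiniteDimensional.of_finrank_pos (by rw [finrank_restrictDegree]; positivity)

theorem restrictDegree_mono {s M N : ℕ} (h : M ≤ N) :
    MvPolynomial.restrictDegree (Fin s) k M ≤ MvPolynomial.restrictDegree (Fin s) k N :=
  MvPolynomial.restrictSupport_mono _ fun _ hn i => (hn i).trans h

open scoped Pointwise in
theorem mul_mem_restrictDegree {s M N : ℕ} {P Q : MvPolynomial (Fin s) k}
    (hP : P ∈ MvPolynomial.restrictDegree (Fin s) k M)
    (hQ : Q ∈ MvPolynomial.restrictDegree (Fin s) k N) :
    P * Q ∈ MvPolynomial.restrictDegree (Fin s) k (M + N) := by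
  have h : P * Q ∈ MvPolynomial.restrictSupport k
      ({n : Fin s →₀ ℕ | ∀ i, n i ≤ M} + {n : Fin s →₀ ℕ | ∀ i, n i ≤ N}) := by
    rw [MvPolynomial.restrictSupport_add]
    exact Submodule.mul_mem_mul hP hQ
  refine MvPolynomial.restrictSupport_mono _ ?_ h
  rintro _ ⟨a, ha, b, hb, rfl⟩ i
  exact Nat.add_le_add (ha i) (hb i)

theorem mem_restrictDegree_totalDegree {s : ℕ} (P : MvPolynomial (Fin s) k) :
    P ∈ MvPolynomial.restrictDegree (Fin s) k P.totalDegree := by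
  rw [MvPolynomial.mem_restrictDegree]
  exact fun n hn i => (MvPolynomial.monomial_le_degreeOf i hn).trans
    (MvPolynomial.degreeOf_le_totalDegree P i)

variable (𝒜 : ℕ → Submodule k R)

/-- The elements of `R` with all components in degrees less than `N`. -/
def degLT (N : ℕ) : Submodule k R :=
  LinearMap.range (∑ m : Fin N, (𝒜 m).subtype ∘ₗ
    (LinearMap.proj m : ((m : Fin N) → 𝒜 m) →ₗ[k] 𝒜 m))

variable {𝒜}

theorem mem_degLT {N : ℕ} {r : R} :
    r ∈ degLT 𝒜 N ↔ ∃ x : (m : Fin N) → 𝒜 m, ∑ m, (x m : R) = r := by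
  simp [degLT]

theorem le_degLT {m N : ℕ} (h : m < N) : 𝒜 m ≤ degLT 𝒜 N := by
  classical
  intro r hr
  rw [mem_degLT]
  refine ⟨Pi.single (M := fun m : Fin N => 𝒜 m) ⟨m, h⟩ ⟨r, hr⟩, ?_⟩
  rw [Finset.sum_eq_single ⟨m, h⟩]
  · rw [Pi.single_eq_same]
  · intro b _ hb
    rw [Pi.single_eq_of_ne hb, Submodule.coe_zero]
  · simp

theorem degLT_mono {M N : ℕ} (h : M ≤ N) : degLT 𝒜 M ≤ degLT 𝒜 N := by
  intro x hx
  obtain ⟨a, rfl⟩ := mem_degLT.mp hx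
  exact Submodule.sum_mem _ fun i _ => le_degLT (by omega) (a i).2

theorem sum_range_mul {M : Type*} [AddCommMonoid M] (f : ℕ → M) (n N : ℕ) :
    ∑ m ∈ Finset.range (n * N), f m =
      ∑ a ∈ Finset.range N, ∑ r ∈ Finset.range n, f (n * a + r) := by
  induction N with
  | zero => simp
  | succ N ih => rw [mul_add, mul_one, Finset.sum_range_add, ih, Finset.sum_range_succ]

theorem finrank_eq_zero_of_not_dvd (h : ∃ m, 0 < m ∧ 𝒜 m ≠ ⊥) {m : ℕ}
    (hm : ¬ gradingGcd 𝒜 ∣ m) : Module.finrank k (𝒜 m) = 0 := by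
  have : 𝒜 m = ⊥ := by
    by_contra h0
    exact hm (gradingGcd_dvd h h0)
  rw [this, finrank_bot]

theorem sum_finrank_mul (h : ∃ m, 0 < m ∧ 𝒜 m ≠ ⊥) (N : ℕ) :
    ∑ m ∈ Finset.range (gradingGcd 𝒜 * N), Module.finrank k (𝒜 m) =
      ∑ a ∈ Finset.range N, Module.finrank k (𝒜 (gradingGcd 𝒜 * a)) := by
  rw [sum_range_mul]
  refine Finset.sum_congr rfl fun a _ => ?_
  rw [Finset.sum_eq_single 0, add_zero]
  · intro r hr hr0
    refine finrank_eq_zero_of_not_dvd h fun hd => ?_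
    rw [Nat.dvd_add_right (dvd_mul_right _ _)] at hd
    exact absurd (Nat.le_of_dvd (Nat.pos_of_ne_zero hr0) hd) (by simpa using hr)
  · intro h0
    exact absurd (gradingGcd_pos h) (by simpa using h0)

variable [GradedAlgebra 𝒜]

theorem finrank_degLT (N : ℕ) (hfd : ∀ m, FiniteDimensional k (𝒜 m)) :
    Module.finrank k (degLT 𝒜 N) = ∑ m ∈ Finset.range N, Module.finrank k (𝒜 m) := by
  rw [degLT, LinearMap.finrank_range_of_inj, Module.finrank_pi_fintype,
    Finset.sum_range fun m => Module.finrank k (𝒜 m)]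
  rw [← LinearMap.ker_eq_bot, LinearMap.ker_eq_bot']
  intro x hx
  funext j
  have h1 := congrArg (GradedAlgebra.proj 𝒜 j) hx
  simp only [LinearMap.sum_apply, LinearMap.comp_apply, LinearMap.proj_apply,
    Submodule.subtype_apply, map_sum, map_zero, GradedAlgebra.proj_apply] at h1
  rw [Finset.sum_eq_single j] at h1
  · rw [DirectSum.decompose_of_mem_same 𝒜 (x j).2] at h1
    exact Subtype.ext h1
  · intro b _ hb
    exact DirectSum.decompose_of_mem_ne 𝒜 (x b).2 fun h => hb (Fin.ext h)
  · simp

theorem one_mem_degLT (N : ℕ) : (1 : R) ∈ degLT 𝒜 (N + 1) :=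
  le_degLT (Nat.succ_pos N) (SetLike.one_mem_graded 𝒜)

theorem mul_mem_degLT {M N : ℕ} {x y : R} (hx : x ∈ degLT 𝒜 (M + 1)) (hy : y ∈ degLT 𝒜 (N + 1)) :
    x * y ∈ degLT 𝒜 (M + N + 1) := by
  obtain ⟨a, rfl⟩ := mem_degLT.mp hx
  obtain ⟨b, rfl⟩ := mem_degLT.mp hy
  rw [Finset.sum_mul_sum]
  refine Submodule.sum_mem _ fun i _ => Submodule.sum_mem _ fun j _ => ?_
  exact le_degLT (by omega) (SetLike.mul_mem_graded (a i).2 (b j).2)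

theorem exists_mem_degLT (r : R) : ∃ N, r ∈ degLT 𝒜 (N + 1) := by
  classical
  refine ⟨(DirectSum.decompose 𝒜 r).support.sup id, ?_⟩
  nth_rewrite 2 [← DirectSum.sum_support_decompose 𝒜 r]
  refine Submodule.sum_mem _ fun i hi => le_degLT ?_ (DirectSum.decompose 𝒜 r i).2
  exact Nat.lt_succ_of_le (Finset.le_sup (f := id) hi)

/-- A polynomial subring in `s` variables forces the growth of `R` to be at least of order `s`. -/
theorem exists_pow_le_finrank_degLT (hfd : ∀ m, FiniteDimensional k (𝒜 m)) {s : ℕ}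
    (g : MvPolynomial (Fin s) k →ₐ[k] R) (hg : Function.Injective g) :
    ∃ c, ∀ M, (M + 1) ^ s ≤ Module.finrank k (degLT 𝒜 (c * M + 1)) := by
  choose e he using fun i => exists_mem_degLT (𝒜 := 𝒜) (g (MvPolynomial.X i))
  refine ⟨∑ i, e i, fun M => ?_⟩
  have hpow : ∀ i a, g (MvPolynomial.X i) ^ a ∈ degLT 𝒜 (e i * a + 1) := by
    intro i a
    induction a with
    | zero => rw [pow_zero]; exact one_mem_degLT _
    | succ a ih =>
      rw [pow_succ, mul_add, mul_one]
      exact mul_mem_degLT ih (he i)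
  have hprod : ∀ (n : Fin s →₀ ℕ) (t : Finset (Fin s)),
      ∏ i ∈ t, g (MvPolynomial.X i) ^ n i ∈ degLT 𝒜 (∑ i ∈ t, e i * n i + 1) := by
    intro n t
    induction t using Finset.induction_on with
    | empty => rw [Finset.prod_empty]; exact one_mem_degLT _
    | insert i t hi ih =>
      rw [Finset.prod_insert hi, Finset.sum_insert hi]
      exact mul_mem_degLT (hpow i _) ih
  have hle : (MvPolynomial.restrictDegree (Fin s) k M).map g.toLinearMap ≤
      degLT 𝒜 ((∑ i, e i) * M + 1) := by
    rw [MvPolynomial.restrictDegree, MvPolynomial.restrictSupport_eq_span, Submodule.map_span,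
      Submodule.span_le]
    rintro _ ⟨_, ⟨n, hn, rfl⟩, rfl⟩
    have h1 : g.toLinearMap (MvPolynomial.monomial n 1) =
        ∏ i, g (MvPolynomial.X i) ^ n i := by
      rw [AlgHom.toLinearMap_apply, MvPolynomial.monomial_eq, map_one, one_mul,
        Finsupp.prod_fintype _ _ (fun _ => pow_zero _), map_prod]
      simp_rw [map_pow]
    simp only [SetLike.mem_coe, h1]
    refine degLT_mono ?_ (hprod n Finset.univ)
    rw [Finset.sum_mul]
    exact Nat.succ_le_succ (Finset.sum_le_sum fun i _ => Nat.mul_le_mul_left _ (hn i))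
  have hfin : FiniteDimensional k (degLT 𝒜 ((∑ i, e i) * M + 1)) := by
    unfold degLT; infer_instance
  rw [← finrank_restrictDegree (k := k) s M,
    (Submodule.equivMapOfInjective g.toLinearMap hg _).finrank_eq]
  exact Submodule.finrank_mono hle

/-- A ring which is finite over a polynomial ring in `s` variables has growth of order at most
`s`. -/
theorem exists_finrank_degLT_le (G : HomogeneousGenerators 𝒜) {s : ℕ}
    (g : MvPolynomial (Fin s) k →ₐ[k] R) (hg : g.Finite) :
    ∃ K c, ∀ N, Module.finrank k (degLT 𝒜 (N + 1)) ≤ K * (c * (N + 1) + 1) ^ s := by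
  have : ∃ (K : ℕ) (w : Fin K → R), ∀ r, ∃ Q : Fin K → MvPolynomial (Fin s) k,
      r = ∑ j, g (Q j) * w j := by
    let := g.toRingHom.toAlgebra
    have hfin : Module.Finite (MvPolynomial (Fin s) k) R := hg
    obtain ⟨K, w, hw⟩ := Module.Finite.exists_fin (R := MvPolynomial (Fin s) k) (M := R)
    refine ⟨K, w, fun r => ?_⟩
    have hr : r ∈ Submodule.span (MvPolynomial (Fin s) k) (Set.range w) := by rw [hw]; trivial
    obtain ⟨Q, hQ⟩ := (Submodule.mem_span_range_iff_exists_fun _).mp hr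
    exact ⟨Q, hQ.symm⟩
  obtain ⟨K, w, hw⟩ := this
  choose Q hQ using hw
  let c : ℕ := ∑ j, (Q 1 j).totalDegree + ∑ i, ∑ l, ∑ j, (Q (G.gen i * w l) j).totalDegree
  have hc1 : ∀ j, (Q 1 j).totalDegree ≤ c := fun j =>
    (Finset.single_le_sum (f := fun j => (Q 1 j).totalDegree) (fun _ _ => Nat.zero_le _)
      (Finset.mem_univ j)).trans (Nat.le_add_right _ _)
  have hc2 : ∀ i l j, (Q (G.gen i * w l) j).totalDegree ≤ c := fun i l j =>
    (Finset.single_le_sum (f := fun j => (Q (G.gen i * w l) j).totalDegree)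
      (fun _ _ => Nat.zero_le _) (Finset.mem_univ j)).trans
    ((Finset.single_le_sum (f := fun l => ∑ j, (Q (G.gen i * w l) j).totalDegree)
      (fun _ _ => Nat.zero_le _) (Finset.mem_univ l)).trans
    ((Finset.single_le_sum (f := fun i => ∑ l, ∑ j, (Q (G.gen i * w l) j).totalDegree)
      (fun _ _ => Nat.zero_le _) (Finset.mem_univ i)).trans (Nat.le_add_left _ _)))
  refine ⟨K, c, fun N => ?_⟩
  -- `S M` consists of the combinations of the `w j` with coefficients of degree at most `M`
  let T : ∀ M, (Fin K → MvPolynomial.restrictDegree (Fin s) k M) →ₗ[k] R := fun M =>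
    ∑ j, (LinearMap.mulRight k (w j)) ∘ₗ g.toLinearMap ∘ₗ
      (MvPolynomial.restrictDegree (Fin s) k M).subtype ∘ₗ LinearMap.proj j
  have hT : ∀ M r, r ∈ LinearMap.range (T M) ↔ ∃ P : Fin K → MvPolynomial (Fin s) k,
      (∀ j, P j ∈ MvPolynomial.restrictDegree (Fin s) k M) ∧ r = ∑ j, g (P j) * w j := by
    intro M r
    constructor
    · rintro ⟨P, rfl⟩
      exact ⟨fun j => P j, fun j => (P j).2, by simp [T]⟩
    · rintro ⟨P, hP, rfl⟩
      exact ⟨fun j => ⟨P j, hP j⟩, by simp [T]⟩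
  have hmul : ∀ M i r, r ∈ LinearMap.range (T M) → G.gen i * r ∈ LinearMap.range (T (M + c)) := by
    intro M i r hr
    obtain ⟨P, hP, rfl⟩ := (hT M r).mp hr
    refine (hT _ _).mpr ⟨fun j => ∑ l, P l * Q (G.gen i * w l) j, fun j => ?_, ?_⟩
    · exact Submodule.sum_mem _ fun l _ => mul_mem_restrictDegree (hP l)
        (restrictDegree_mono (hc2 i l j) (mem_restrictDegree_totalDegree _))
    · simp_rw [map_sum, map_mul, Finset.sum_mul]
      rw [Finset.sum_comm, Finset.mul_sum]
      refine Finset.sum_congr rfl fun l _ => ?_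
      simp_rw [mul_assoc]
      rw [← Finset.mul_sum, ← hQ]
      ring
  have hmono : ∀ {M M'}, M ≤ M' → LinearMap.range (T M) ≤ LinearMap.range (T M') := by
    intro M M' h r hr
    obtain ⟨P, hP, rfl⟩ := (hT M r).mp hr
    exact (hT _ _).mpr ⟨P, fun j => restrictDegree_mono h (hP j), rfl⟩
  have hone : (1 : R) ∈ LinearMap.range (T c) :=
    (hT _ _).mpr ⟨Q 1, fun j => restrictDegree_mono (hc1 j) (mem_restrictDegree_totalDegree _),
      hQ 1⟩
  have hpow : ∀ i a M r, r ∈ LinearMap.range (T M) →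
      G.gen i ^ a * r ∈ LinearMap.range (T (M + a * c)) := by
    intro i a M r hr
    induction a with
    | zero => rwa [pow_zero, one_mul, zero_mul, add_zero]
    | succ a ih =>
      rw [pow_succ', mul_assoc, add_mul, one_mul, ← add_assoc]
      exact hmul _ i _ ih
  have hprod : ∀ (α : Fin G.card →₀ ℕ) (t : Finset (Fin G.card)),
      ∏ i ∈ t, G.gen i ^ α i ∈ LinearMap.range (T (c + (∑ i ∈ t, α i) * c)) := by
    intro α t
    induction t using Finset.induction_on with
    | empty => rwa [Finset.prod_empty, Finset.sum_empty, zero_mul, add_zero]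
    | insert i t hi ih =>
      rw [Finset.prod_insert hi, Finset.sum_insert hi, add_comm (α i), add_mul, ← add_assoc]
      exact hpow i _ _ _ ih
  have hle : degLT 𝒜 (N + 1) ≤ LinearMap.range (T (c * (N + 1))) := by
    intro r hr
    obtain ⟨x, rfl⟩ := mem_degLT.mp hr
    refine Submodule.sum_mem _ fun m _ => G.mem_of_monomials_mem (fun α hα => ?_) (x m).2
    refine hmono ?_ (hprod α Finset.univ)
    have h1 : ∑ i, α i ≤ N := by
      calc ∑ i, α i ≤ ∑ i, α i * G.deg i :=
            Finset.sum_le_sum fun i _ => Nat.le_mul_of_pos_right _ (G.deg_pos i)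
        _ ≤ N := by omega
    calc c + (∑ i, α i) * c ≤ c + N * c := by gcongr
      _ = c * (N + 1) := by ring
  have hfd := finite_restrictDegree (k := k) s (c * (N + 1))
  calc Module.finrank k (degLT 𝒜 (N + 1)) ≤ Module.finrank k (LinearMap.range (T (c * (N + 1)))) :=
        Submodule.finrank_mono hle
    _ ≤ Module.finrank k (Fin K → MvPolynomial.restrictDegree (Fin s) k (c * (N + 1))) :=
        LinearMap.finrank_range_le _
    _ = K * (c * (N + 1) + 1) ^ s := by
        rw [Module.finrank_pi_fintype]
        simp [finrank_restrictDegree]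

/-- Incomparability and going up. -/
theorem ringKrullDim_eq_of_isIntegral {A B : Type*} [CommRing A] [CommRing B] [Algebra A B]
    [Algebra.IsIntegral A B] (hinj : Function.Injective (algebraMap A B)) :
    ringKrullDim B = ringKrullDim A := by
  refine le_antisymm ?_ ?_
  · refine Order.krullDim_le_of_strictMono (PrimeSpectrum.comap (algebraMap A B)) fun P Q h => ?_
    exact Ideal.IsIntegral.comap_lt_comap h
  · refine iSup_le fun l => ?_
    obtain ⟨P, hP, hPp, hP2⟩ := Ideal.exists_ideal_over_prime_of_isIntegral
      (RelSeries.head l).asIdeal (⊥ : Ideal B) (by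
        rw [← RingHom.ker_eq_comap_bot, (RingHom.injective_iff_ker_eq_bot _).mp hinj]
        exact bot_le)
    have : P.LiesOver (RelSeries.head l).asIdeal := ⟨hP2.symm⟩
    obtain ⟨L, hL, -⟩ := Ideal.exists_ltSeries_of_hasGoingUp l P
    rw [← hL]
    exact le_iSup (fun L : LTSeries (PrimeSpectrum B) => (L.length : WithBot ℕ∞)) L

theorem exists_ne_bot_of_dim_pos [Nontrivial R]
    (h𝒜 : ∀ r ∈ 𝒜 0, ∃ c : k, algebraMap k R c = r) {d : ℕ}
    (hd : 0 < d) (hdim : ringKrullDim R = d) : ∃ m, 0 < m ∧ 𝒜 m ≠ ⊥ := by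
  by_contra! hall
  have hsurj : Function.Surjective (algebraMap k R) := by
    intro r
    obtain ⟨c, hc⟩ := exists_algebraMap_sub_mem h𝒜 r
    have h0 : r - algebraMap k R c = 0 := by
      classical
      rw [← DirectSum.sum_support_decompose 𝒜 (r - algebraMap k R c)]
      refine Finset.sum_eq_zero fun m _ => ?_
      rcases Nat.eq_zero_or_pos m with rfl | hm
      · exact (mem_irrelevant_iff_proj _).mp hc
      · have := (DirectSum.decompose 𝒜 (r - algebraMap k R c) m).2
        exact (Submodule.mem_bot k).mp ((hall m hm).le this)
    exact ⟨c, (sub_eq_zero.mp h0).symm⟩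
  have h1 := ringKrullDim_le_of_surjective (algebraMap k R) hsurj
  rw [hdim, ringKrullDim_eq_zero_of_field] at h1
  have : (d : WithBot ℕ∞) ≤ (0 : ℕ) := by exact_mod_cast h1
  have : d ≤ 0 := by exact_mod_cast this
  omega

/-- If the partial sums of `f` grow with order `s` and `f` with order `D`, then `s = D + 1`. -/
theorem growth_exponent_eq {f : ℕ → ℕ} {D s : ℕ} {C : ℝ} (hC : 0 < C)
    (hf : Tendsto (fun a => (f a : ℝ) / (a : ℝ) ^ D) atTop (𝓝 C)) {K c : ℕ} (hc : 0 < c)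
    (hup : ∀ N, 0 < N → ∑ a ∈ Finset.range N, f a ≤ K * N ^ s)
    (hlow : ∀ N, 0 < N → N ^ s ≤ ∑ a ∈ Finset.range (c * N), f a) : D + 1 = s := by
  have hlim := tendsto_sum_div_pow hf
  have hC' : 0 < C / (D + 1) := by positivity
  rcases lt_trichotomy (D + 1) s with hlt | heq | hgt
  · exfalso
    have hcN : Tendsto (fun N : ℕ => c * N) atTop atTop := tendsto_id.const_mul_atTop' hc
    have h1 := hlim.comp hcN
    have h2 : Tendsto (fun N : ℕ => (N : ℝ) / (c : ℝ) ^ (D + 1)) atTop atTop :=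
      tendsto_natCast_atTop_atTop.atTop_div_const (by positivity)
    refine not_tendsto_nhds_of_tendsto_atTop (tendsto_atTop_mono' _ ?_ h2) _ h1
    filter_upwards [eventually_gt_atTop 0] with N hN
    have hN1 : (1 : ℝ) ≤ N := by exact_mod_cast hN
    have h3 : ((N : ℝ)) ^ s ≤ ∑ a ∈ Finset.range (c * N), (f a : ℝ) := by exact_mod_cast hlow N hN
    simp only [Function.comp]
    push_cast
    rw [mul_pow, div_le_div_iff₀ (by positivity) (by positivity)]
    calc (N : ℝ) * ((c : ℝ) ^ (D + 1) * (N : ℝ) ^ (D + 1))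
        = (N : ℝ) ^ (D + 2) * (c : ℝ) ^ (D + 1) := by ring
      _ ≤ (N : ℝ) ^ s * (c : ℝ) ^ (D + 1) := by gcongr; omega
      _ ≤ _ := by gcongr
  · exact heq
  · exfalso
    have h2 : Tendsto (fun N : ℕ => (K : ℝ) / N) atTop (𝓝 0) :=
      tendsto_const_div_atTop_nhds_zero_nat _
    refine absurd (le_of_tendsto_of_tendsto hlim h2 ?_) (not_le.mpr hC')
    filter_upwards [eventually_gt_atTop 0] with N hN
    have hN1 : (1 : ℝ) ≤ N := by exact_mod_cast hN
    have hN0 : (0 : ℝ) < N := by linarith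
    have h3 : ∑ a ∈ Finset.range N, (f a : ℝ) ≤ K * (N : ℝ) ^ s := by exact_mod_cast hup N hN
    rw [div_le_div_iff₀ (by positivity) hN0]
    calc (∑ a ∈ Finset.range N, (f a : ℝ)) * N ≤ K * (N : ℝ) ^ s * N := by gcongr
      _ = K * (N : ℝ) ^ (s + 1) := by ring
      _ ≤ K * (N : ℝ) ^ (D + 1) := by gcongr; omega

/-- The growth of the Hilbert function is governed by the Krull dimension. -/
theorem exists_tendsto_hilbert [IsDomain R] [Algebra.FiniteType k R]
    (h𝒜 : ∀ r ∈ 𝒜 0, ∃ c : k, algebraMap k R c = r) {d : ℕ} (hd : 0 < d)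
    (hdim : ringKrullDim R = d) :
    ∃ C : ℝ, 0 < C ∧ Tendsto (fun a : ℕ =>
      (Module.finrank k (𝒜 (gradingGcd 𝒜 * a)) : ℝ) / (a : ℝ) ^ (d - 1)) atTop (𝓝 C) := by
  have hnoeth : IsNoetherianRing R := Algebra.FiniteType.isNoetherianRing k R
  obtain ⟨G⟩ := exists_homogeneousGenerators 𝒜 h𝒜
  have hne := exists_ne_bot_of_dim_pos h𝒜 hd hdim
  obtain ⟨D, C, hC, hlim⟩ := exists_tendsto_finrank_div_pow G hne
  obtain ⟨s, g, hginj, hgfin⟩ := exists_finite_inj_algHom_of_fg k R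
  have hs : d = s := by
    let := g.toRingHom.toAlgebra
    have hfin : Module.Finite (MvPolynomial (Fin s) k) R := hgfin
    have h1 := ringKrullDim_eq_of_isIntegral (A := MvPolynomial (Fin s) k) (B := R) hginj
    rw [hdim, MvPolynomial.ringKrullDim_of_isNoetherianRing, ringKrullDim_eq_zero_of_field,
      zero_add, Nat.card_eq_fintype_card, Fintype.card_fin] at h1
    exact_mod_cast h1
  have hn0 := gradingGcd_pos hne
  have hfd := G.finiteDimensional
  obtain ⟨c, hc⟩ := exists_pow_le_finrank_degLT hfd g hginj
  obtain ⟨K, c', hK⟩ := exists_finrank_degLT_le G g hgfin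
  have hfin : ∀ N, FiniteDimensional k (degLT 𝒜 N) := by
    intro N
    unfold degLT; infer_instance
  have hD : D + 1 = s := by
    refine growth_exponent_eq hC hlim (c := c + 1) (K := K * (c' * gradingGcd 𝒜 + 1) ^ s)
      (Nat.succ_pos _) (fun N hN => ?_) (fun N hN => ?_)
    · rw [← sum_finrank_mul hne, ← finrank_degLT _ hfd]
      have h1 := hK (gradingGcd 𝒜 * N - 1)
      have h2 : 0 < gradingGcd 𝒜 * N := Nat.mul_pos hn0 hN
      rw [Nat.sub_add_cancel h2] at h1
      refine h1.trans ?_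
      rw [mul_assoc, ← mul_pow]
      gcongr
      nlinarith
    · rw [← sum_finrank_mul hne, ← finrank_degLT _ hfd]
      refine (Nat.pow_le_pow_left (Nat.le_succ N) s).trans ((hc N).trans ?_)
      refine Submodule.finrank_mono (degLT_mono ?_)
      calc c * N + 1 ≤ (c + 1) * N := by rw [add_mul, one_mul]; omega
        _ ≤ gradingGcd 𝒜 * ((c + 1) * N) := Nat.le_mul_of_pos_left _ hn0
  refine ⟨C, hC, ?_⟩
  rwa [show d - 1 = D by omega]

end Growth

/-! ### Strands of graded free modules -/

section Strands

variable {k : Type v} [Field k] {R : Type u} [CommRing R] [Algebra k R]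

/-- The graded pieces of `R`, indexed by all integers. -/
def intPiece (𝒜 : ℕ → Submodule k R) (z : ℤ) : Submodule k R := if 0 ≤ z then 𝒜 z.toNat else ⊥

theorem intPiece_natCast (𝒜 : ℕ → Submodule k R) (m : ℕ) : intPiece 𝒜 (m : ℤ) = 𝒜 m := by
  simp [intPiece]

theorem intPiece_of_neg (𝒜 : ℕ → Submodule k R) {z : ℤ} (hz : z < 0) : intPiece 𝒜 z = ⊥ := by
  simp [intPiece, not_le.mpr hz]

/-- The elements of degree `z` in the graded free module `⨁_a R(-shift a)`. -/
def strand (𝒜 : ℕ → Submodule k R) {r : ℕ} (shift : Fin r → ℤ) (z : ℤ) :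
    Submodule k (Fin r → R) :=
  Submodule.pi Set.univ fun a => intPiece 𝒜 (z - shift a)

/-- The matrix `D` describes a map of degree zero between graded free modules with the given
shifts. -/
def IsHomogeneousMatrix (𝒜 : ℕ → Submodule k R) {r s : ℕ} (shift : Fin r → ℤ)
    (shift' : Fin s → ℤ) (D : Matrix (Fin r) (Fin s) R) : Prop :=
  ∀ a c, D a c = 0 ∨ ∃ n : ℕ, shift' c = shift a + n ∧ D a c ∈ 𝒜 n

theorem mem_strand {𝒜 : ℕ → Submodule k R} {r : ℕ} {shift : Fin r → ℤ} {z : ℤ} {v : Fin r → R} :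
    v ∈ strand 𝒜 shift z ↔ ∀ a, v a ∈ intPiece 𝒜 (z - shift a) := by
  simp [strand, Submodule.mem_pi]

theorem strand_eq_range (𝒜 : ℕ → Submodule k R) {r : ℕ} (shift : Fin r → ℤ) (z : ℤ) :
    strand 𝒜 shift z = LinearMap.range (LinearMap.pi fun a =>
      (intPiece 𝒜 (z - shift a)).subtype ∘ₗ
        (LinearMap.proj a : ((a : Fin r) → intPiece 𝒜 (z - shift a)) →ₗ[k] _)) := by
  ext v
  rw [mem_strand]
  constructor
  · exact fun h => ⟨fun a => ⟨v a, h a⟩, rfl⟩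
  · rintro ⟨x, rfl⟩ a
    exact (x a).2

theorem finiteDimensional_intPiece {𝒜 : ℕ → Submodule k R} (hfd : ∀ m, FiniteDimensional k (𝒜 m))
    (z : ℤ) : FiniteDimensional k (intPiece 𝒜 z) := by
  by_cases hz : 0 ≤ z
  · rw [intPiece, if_pos hz]
    exact hfd _
  · rw [intPiece, if_neg hz]
    infer_instance

theorem finiteDimensional_strand {𝒜 : ℕ → Submodule k R} (hfd : ∀ m, FiniteDimensional k (𝒜 m))
    {r : ℕ} (shift : Fin r → ℤ) (z : ℤ) : FiniteDimensional k (strand 𝒜 shift z) := by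
  have := finiteDimensional_intPiece hfd
  rw [strand_eq_range]
  infer_instance

theorem finrank_strand {𝒜 : ℕ → Submodule k R} (hfd : ∀ m, FiniteDimensional k (𝒜 m))
    {r : ℕ} (shift : Fin r → ℤ) (z : ℤ) :
    Module.finrank k (strand 𝒜 shift z) =
      ∑ a, Module.finrank k (intPiece 𝒜 (z - shift a)) := by
  have := finiteDimensional_intPiece hfd
  rw [strand_eq_range, LinearMap.finrank_range_of_inj, Module.finrank_pi_fintype]
  intro x y hxy
  funext a
  exact Subtype.ext (congrFun hxy a)

variable (𝒜 : ℕ → Submodule k R) [GradedAlgebra 𝒜]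

/-- The projection of `R` to its graded piece of degree `z ∈ ℤ`. -/
def intProj (z : ℤ) : R →ₗ[k] R := if 0 ≤ z then GradedAlgebra.proj 𝒜 z.toNat else 0

theorem intProj_mem (z : ℤ) (r : R) : intProj 𝒜 z r ∈ intPiece 𝒜 z := by
  unfold intProj intPiece
  split_ifs
  · exact (DirectSum.decompose 𝒜 r _).2
  · exact Submodule.zero_mem _

variable {𝒜}

theorem intProj_of_mem {z : ℤ} {r : R} (hr : r ∈ intPiece 𝒜 z) : intProj 𝒜 z r = r := by
  unfold intProj
  unfold intPiece at hr
  split_ifs at hr ⊢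
  · exact DirectSum.decompose_of_mem_same 𝒜 hr
  · exact ((Submodule.mem_bot k).mp hr).symm

theorem intProj_mul {n : ℕ} {a : R} (ha : a ∈ 𝒜 n) (z : ℤ) (r : R) :
    intProj 𝒜 (z + n) (a * r) = a * intProj 𝒜 z r := by
  unfold intProj
  by_cases hz : 0 ≤ z
  · rw [if_pos hz, if_pos (by omega), GradedAlgebra.proj_apply, GradedAlgebra.proj_apply,
      show (z + n).toNat = n + z.toNat by omega,
      DirectSum.coe_decompose_mul_add_of_left_mem 𝒜 ha]
  · rw [if_neg hz, LinearMap.zero_apply, mul_zero]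
    split_ifs with h
    · exact DirectSum.coe_decompose_mul_of_left_mem_of_not_le 𝒜 ha (by omega)
    · rfl

variable (𝒜) in
/-- The projection of a graded free module to its elements of degree `z`. -/
def strandProj {r : ℕ} (shift : Fin r → ℤ) (z : ℤ) : (Fin r → R) →ₗ[k] (Fin r → R) :=
  LinearMap.pi fun a => intProj 𝒜 (z - shift a) ∘ₗ LinearMap.proj a

theorem strandProj_apply {r : ℕ} (shift : Fin r → ℤ) (z : ℤ) (v : Fin r → R) (a : Fin r) :
    strandProj 𝒜 shift z v a = intProj 𝒜 (z - shift a) (v a) := rfl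

theorem strandProj_mem {r : ℕ} (shift : Fin r → ℤ) (z : ℤ) (v : Fin r → R) :
    strandProj 𝒜 shift z v ∈ strand 𝒜 shift z :=
  mem_strand.mpr fun _ => intProj_mem 𝒜 _ _

theorem strandProj_of_mem {r : ℕ} {shift : Fin r → ℤ} {z : ℤ} {v : Fin r → R}
    (hv : v ∈ strand 𝒜 shift z) : strandProj 𝒜 shift z v = v :=
  funext fun a => intProj_of_mem (mem_strand.mp hv a)

theorem IsHomogeneousMatrix.mulVec_strandProj {r s : ℕ} {shift : Fin r → ℤ} {shift' : Fin s → ℤ}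
    {D : Matrix (Fin r) (Fin s) R} (hD : IsHomogeneousMatrix 𝒜 shift shift' D) (z : ℤ)
    (v : Fin s → R) :
    D.mulVecLin (strandProj 𝒜 shift' z v) = strandProj 𝒜 shift z (D.mulVecLin v) := by
  funext a
  rw [strandProj_apply, Matrix.mulVecLin_apply, Matrix.mulVecLin_apply, Matrix.mulVec,
    Matrix.mulVec, dotProduct, dotProduct, map_sum]
  refine Finset.sum_congr rfl fun c _ => ?_
  rw [strandProj_apply]
  rcases hD a c with h0 | ⟨n, hn, hmem⟩
  · rw [h0, zero_mul, zero_mul, map_zero]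
  · rw [← intProj_mul hmem]
    congr 2
    omega

theorem IsHomogeneousMatrix.map_strand {r s : ℕ} {shift : Fin r → ℤ} {shift' : Fin s → ℤ}
    {D : Matrix (Fin r) (Fin s) R} (hD : IsHomogeneousMatrix 𝒜 shift shift' D) (z : ℤ) :
    (strand 𝒜 shift' z).map (D.mulVecLin.restrictScalars k) =
      strand 𝒜 shift z ⊓ (LinearMap.range D.mulVecLin).restrictScalars k := by
  ext v
  constructor
  · rintro ⟨w, hw, rfl⟩
    refine ⟨?_, ⟨w, rfl⟩⟩
    rw [LinearMap.restrictScalars_apply, ← strandProj_of_mem hw, hD.mulVec_strandProj]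
    exact strandProj_mem _ _ _
  · rintro ⟨hv, w, hw⟩
    refine ⟨strandProj 𝒜 shift' z w, strandProj_mem _ _ _, ?_⟩
    rw [LinearMap.restrictScalars_apply, hD.mulVec_strandProj, hw, strandProj_of_mem hv]

variable {rank : ℕ → ℕ} {E : (i : ℕ) → Matrix (Fin (rank i)) (Fin (rank (i + 1))) R}
  {shift : (i : ℕ) → Fin (rank i) → ℤ}

/-- The alternating sum of the Hilbert functions of the terms of a graded complex which is exact in
positive degrees. -/
theorem alternating_sum_finrank_strand (hfd : ∀ m, FiniteDimensional k (𝒜 m))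
    (hE : ∀ i, IsHomogeneousMatrix 𝒜 (shift i) (shift (i + 1)) (E i))
    (hex : ∀ i, Function.Exact (E (i + 1)).mulVecLin (E i).mulVecLin) {t : ℕ}
    (ht : rank (t + 1) = 0) (z : ℤ) :
    ∑ i ∈ Finset.range (t + 1),
      (-1 : ℤ) ^ i * (∑ a, Module.finrank k (intPiece 𝒜 (z - shift i a)) : ℕ) =
    Module.finrank k (strand 𝒜 (shift 0) z) -
      Module.finrank k ↥(strand 𝒜 (shift 0) z ⊓
        (LinearMap.range (E 0).mulVecLin).restrictScalars k) := by
  set B : ℕ → ℕ := fun i => Module.finrank k ↥(strand 𝒜 (shift i) z ⊓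
    (LinearMap.range (E i).mulVecLin).restrictScalars k) with hB
  have hfs := fun i => finiteDimensional_strand hfd (shift i) z
  have hstep : ∀ i, Module.finrank k (strand 𝒜 (shift (i + 1)) z) = B i + B (i + 1) := by
    intro i
    have h1 := LinearMap.finrank_range_add_finrank_ker
      (((E i).mulVecLin.restrictScalars k).domRestrict (strand 𝒜 (shift (i + 1)) z))
    rw [LinearMap.range_domRestrict, (hE i).map_strand] at h1
    rw [← h1]
    congr 1
    have h2 : (LinearMap.ker (((E i).mulVecLin.restrictScalars k).domRestrict
        (strand 𝒜 (shift (i + 1)) z))).map (strand 𝒜 (shift (i + 1)) z).subtype =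
        strand 𝒜 (shift (i + 1)) z ⊓
          (LinearMap.range (E (i + 1)).mulVecLin).restrictScalars k := by
      ext v
      constructor
      · rintro ⟨w, hw, rfl⟩
        exact ⟨w.2, (hex i _).mp hw⟩
      · rintro ⟨hv, hv'⟩
        exact ⟨⟨v, hv⟩, (hex i _).mpr hv', rfl⟩
    rw [hB]
    simp only
    rw [← h2]
    exact (Submodule.equivMapOfInjective _ (Submodule.injective_subtype _) _).finrank_eq
  have hsum : ∀ t, ∑ i ∈ Finset.range (t + 1),
      (-1 : ℤ) ^ i * (Module.finrank k (strand 𝒜 (shift i) z) : ℕ) =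
      Module.finrank k (strand 𝒜 (shift 0) z) - B 0 + (-1 : ℤ) ^ t * B t := by
    intro t
    induction t with
    | zero => simp
    | succ t ih =>
      rw [Finset.sum_range_succ, ih, hstep t]
      push_cast
      ring
  have hBt : B t = 0 := by
    have h1 := hstep t
    have : IsEmpty (Fin (rank (t + 1))) := by rw [ht]; infer_instance
    rw [finrank_strand hfd, Finset.univ_eq_empty, Finset.sum_empty] at h1
    omega
  have h3 := hsum t
  rw [hBt, Nat.cast_zero, mul_zero, add_zero] at h3
  rw [← h3]
  refine Finset.sum_congr rfl fun i _ => ?_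
  rw [finrank_strand hfd]

theorem IsHomogeneousMatrix.map_pow {r s : ℕ} {shift : Fin r → ℤ} {shift' : Fin s → ℤ}
    {D : Matrix (Fin r) (Fin s) R} (hD : IsHomogeneousMatrix 𝒜 shift shift' D) (f : R →+* R)
    {q : ℕ} (hf : ∀ x, f x = x ^ q) :
    IsHomogeneousMatrix 𝒜 (fun a => (q : ℤ) * shift a) (fun c => (q : ℤ) * shift' c)
      (D.map f) := by
  intro a c
  rcases hD a c with h | ⟨n, hn, hmem⟩
  · exact Or.inl (by rw [Matrix.map_apply, h, map_zero])
  · refine Or.inr ⟨q * n, ?_, ?_⟩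
    · simp only [hn]
      push_cast
      ring
    · rw [Matrix.map_apply, hf]
      have := SetLike.pow_mem_graded q hmem
      rwa [smul_eq_mul] at this

end Strands

/-! ### Minimal graded resolutions of `R / I` -/

section Resolution

variable {k : Type v} [Field k] {R : Type u} [CommRing R] [Algebra k R]
  {𝒜 : ℕ → Submodule k R} [GradedAlgebra 𝒜] {I : Ideal R}

namespace MinimalGradedResolution

theorem isHomogeneousMatrix (F : MinimalGradedResolution 𝒜 I) (i : ℕ) :
    IsHomogeneousMatrix 𝒜 (F.shift i) (F.shift (i + 1)) (F.diff i) := F.diff_homogeneous i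

/-- The module `F₀` is `R`, and the augmentation is the projection to `R / I` up to a unit. -/
theorem exists_unique_basis_zero [Nontrivial R]
    (h𝒜 : ∀ r ∈ 𝒜 0, ∃ c : k, algebraMap k R c = r) (hI : I.IsHomogeneous 𝒜) (hI_ne : I ≠ ⊤)
    (F : MinimalGradedResolution 𝒜 I) :
    ∃ a₀ : Fin (F.rank 0), (∀ a, a = a₀) ∧ F.shift 0 a₀ = 0 ∧
      ∀ v, v ∈ LinearMap.range (F.diff 0).mulVecLin ↔ v a₀ ∈ I := by
  set m := (HomogeneousIdeal.irrelevant 𝒜).toIdeal with hm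
  have hmax : m.IsMaximal := irrelevant_isMaximal h𝒜
  have hmp : m.IsPrime := hmax.isPrime
  have hIm : I ≤ m := le_irrelevant h𝒜 hI hI_ne
  have hnt : Nontrivial (R ⧸ I) := Ideal.Quotient.nontrivial_iff.mpr hI_ne
  have h1m : (1 : R) ∉ m := fun h => hmax.ne_top ((Ideal.eq_top_iff_one m).mpr h)
  have hker : ∀ v, F.aug v = 0 → ∀ a, v a ∈ m := by
    intro v hv a
    obtain ⟨w, rfl⟩ := (F.exact_zero v).mp hv
    rw [Matrix.mulVecLin_apply, Matrix.mulVec, dotProduct]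
    exact Ideal.sum_mem _ fun c _ => m.mul_mem_right _ (F.minimal 0 a c)
  obtain ⟨v, hv⟩ := F.aug_surjective 1
  have hbasis : ∀ a, ∃ r, ∀ b, (Pi.single a 1 : Fin (F.rank 0) → R) b - r * v b ∈ m := by
    intro a
    obtain ⟨r, hr⟩ := Ideal.Quotient.mk_surjective (F.aug (Pi.single a 1))
    refine ⟨r, fun b => hker (Pi.single a 1 - r • v) ?_ b⟩
    rw [map_sub, map_smul, hv, ← hr, Algebra.smul_def, mul_one, Ideal.Quotient.algebraMap_eq,
      sub_self]
  have hne : Nonempty (Fin (F.rank 0)) := by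
    by_contra hemp
    rw [not_nonempty_iff] at hemp
    rw [Subsingleton.elim v 0, map_zero] at hv
    exact zero_ne_one hv
  obtain ⟨a₀⟩ := hne
  have huniq : ∀ a, a = a₀ := by
    intro a
    by_contra hne
    obtain ⟨r, hr⟩ := hbasis a
    obtain ⟨r', hr'⟩ := hbasis a₀
    have h1 := hr a
    have h2 := hr a₀
    have h3 := hr' a₀
    rw [Pi.single_eq_same] at h1 h3
    rw [Pi.single_eq_of_ne (Ne.symm hne), zero_sub, neg_mem_iff] at h2
    rcases hmp.mem_or_mem h2 with h | h
    · exact h1m (by simpa using m.add_mem h1 (m.mul_mem_right (v a) h))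
    · exact h1m (by simpa using m.add_mem h3 (m.mul_mem_left r' h))
  have hv0 : ∀ w : Fin (F.rank 0) → R, w = w a₀ • Pi.single a₀ 1 := by
    intro w
    funext a
    rw [huniq a]
    simp
  have haug : ∀ w, F.aug w = w a₀ • F.aug (Pi.single a₀ 1) := by
    intro w
    conv_lhs => rw [hv0 w, map_smul]
  rcases F.aug_homogeneous a₀ with h0 | ⟨n, hn, r, hr, hrn⟩
  · rw [haug v, h0, smul_zero] at hv
    exact absurd hv zero_ne_one
  · have hrn' : F.aug (Pi.single a₀ 1) = Ideal.Quotient.mk I r := hrn.symm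
    have haug' : ∀ w, F.aug w = Ideal.Quotient.mk I (w a₀ * r) := by
      intro w
      rw [haug, hrn', Algebra.smul_def, Ideal.Quotient.algebraMap_eq, map_mul]
    have h1 : 1 - v a₀ * r ∈ I := by
      rw [← Ideal.Quotient.eq, ← haug', hv, map_one]
    have hn0 : n = 0 := by
      by_contra hn0
      have hrm : r ∈ m := HomogeneousIdeal.mem_irrelevant_of_mem 𝒜 (Nat.pos_of_ne_zero hn0) hr
      exact h1m (by simpa using m.add_mem (hIm h1) (m.mul_mem_left (v a₀) hrm))
    subst hn0
    obtain ⟨c, rfl⟩ := h𝒜 r hr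
    have hc : c ≠ 0 := by
      rintro rfl
      rw [map_zero, mul_zero, sub_zero] at h1
      exact h1m (hIm h1)
    refine ⟨a₀, huniq, by simpa using hn, fun w => ?_⟩
    change w ∈ Set.range (F.diff 0).mulVecLin ↔ _
    rw [← F.exact_zero w, haug', Ideal.Quotient.eq_zero_iff_mem]
    refine ⟨fun h => ?_, fun h => I.mul_mem_right _ h⟩
    have := I.mul_mem_right (algebraMap k R c⁻¹) h
    rwa [mul_assoc, ← map_mul, mul_inv_cancel₀ hc, map_one, mul_one] at this

/-- Every basis element of `F_{i+1}` maps to a vector with a nonzero entry of positive degree. -/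
theorem exists_shift_succ [Nontrivial R] (F : MinimalGradedResolution 𝒜 I) (i : ℕ)
    (c : Fin (F.rank (i + 1))) :
    ∃ (a : Fin (F.rank i)) (n : ℕ), 0 < n ∧ 𝒜 n ≠ ⊥ ∧ F.shift (i + 1) c = F.shift i a + n := by
  have hcol : ∃ a, F.diff i a c ≠ 0 := by
    by_contra! h0
    obtain ⟨w, hw⟩ := (F.exact_succ i (Pi.single c 1)).mp (by
      funext a
      rw [Matrix.mulVecLin_apply, Matrix.mulVec_single_one]
      exact h0 a)
    have h1 := congrFun hw c
    rw [Pi.single_eq_same, Matrix.mulVecLin_apply, Matrix.mulVec, dotProduct] at h1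
    refine irrelevant_ne_top (𝒜 := 𝒜) ((Ideal.eq_top_iff_one _).mpr (h1 ▸ ?_))
    exact Ideal.sum_mem _ fun b _ => Ideal.mul_mem_right _ _ (F.minimal _ _ _)
  obtain ⟨a, ha⟩ := hcol
  rcases F.diff_homogeneous i a c with h0 | ⟨n, hn, hmem⟩
  · exact absurd h0 ha
  · refine ⟨a, n, Nat.pos_of_ne_zero ?_, (Submodule.ne_bot_iff _).mpr ⟨_, hmem, ha⟩, hn⟩
    rintro rfl
    have h1 := (mem_irrelevant_iff_proj _).mp (F.minimal i a c)
    rw [GradedAlgebra.proj_apply, DirectSum.decompose_of_mem_same 𝒜 hmem] at h1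
    exact ha h1

/-- All shifts are multiples of `n₀`, and they increase along the resolution. -/
theorem shift_eq_mul [Nontrivial R] (h : ∃ m, 0 < m ∧ 𝒜 m ≠ ⊥) (F : MinimalGradedResolution 𝒜 I)
    (h0 : ∀ a, F.shift 0 a = 0) (i : ℕ) :
    ∀ a, ∃ j : ℕ, F.shift i a = (gradingGcd 𝒜 : ℤ) * j ∧ i ≤ j := by
  induction i with
  | zero => exact fun a => ⟨0, by simp [h0 a], le_rfl⟩
  | succ i ih =>
    intro c
    obtain ⟨a, n, hn, hne, hs⟩ := F.exists_shift_succ i c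
    obtain ⟨j, hj, hij⟩ := ih a
    obtain ⟨b, rfl⟩ := gradingGcd_dvd h hne
    have hb : 0 < b := Nat.pos_of_mul_pos_left hn
    exact ⟨j + b, by rw [hs, hj]; push_cast; ring, by omega⟩

/-- The resolution has length at most `d`. -/
theorem exists_length [IsDomain R] [IsNoetherianRing R]
    (h𝒜 : ∀ r ∈ 𝒜 0, ∃ c : k, algebraMap k R c = r)
    (hm : (HomogeneousIdeal.irrelevant 𝒜).toIdeal ≠ ⊥)
    (hI : I.IsHomogeneous 𝒜) (hI_ne : I ≠ ⊤) {d : ℕ} (hdim : ringKrullDim R = d)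
    (hpd : CategoryTheory.projectiveDimension (ModuleCat.of R (R ⧸ I)) < ⊤)
    (F : MinimalGradedResolution 𝒜 I) :
    ∃ s ≤ d, 0 < F.rank s ∧ ∀ i, s < i → F.rank i = 0 := by
  obtain ⟨a₀, -, -, -⟩ := F.exists_unique_basis_zero h𝒜 hI hI_ne
  have hmax := irrelevant_isMaximal h𝒜
  obtain ⟨s, hs⟩ := exists_rank_eq_zero _ (irrelevant_ne_top (𝒜 := 𝒜)) F.minimal F.exact_succ F.aug
    F.aug_surjective F.exact_zero hpd
  have hpos0 : 0 < F.rank 0 := a₀.pos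
  set s' := Nat.findGreatest (fun i => 0 < F.rank i) s with hs'
  have hpos : 0 < F.rank s' :=
    Nat.findGreatest_spec (P := fun i => 0 < F.rank i) (Nat.zero_le s) hpos0
  have hzero : ∀ i, s' < i → F.rank i = 0 := by
    intro i hi
    by_cases his : i ≤ s
    · have := Nat.findGreatest_is_greatest hi his
      omega
    · exact hs i (by omega)
  refine ⟨s', ?_, hpos, hzero⟩
  have h1 := le_ringKrullDim_of_extVanishes _ (irrelevant_ne_top (𝒜 := 𝒜))
    (extVanishes_of_minimal _ hm hzero hpos F.minimal F.exact_succ)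
  rw [hdim] at h1
  exact_mod_cast h1

/-- The Hilbert function of `R / I^[q]` in terms of the shifts in a minimal resolution of `R / I`
and of the Hilbert function of `R`. -/
theorem pieceLength_bracketPower [IsDomain R] [IsNoetherianRing R] (p : ℕ) [Fact p.Prime]
    [CharP R p] (h𝒜 : ∀ r ∈ 𝒜 0, ∃ c : k, algebraMap k R c = r)
    (hfd : ∀ m, FiniteDimensional k (𝒜 m))
    (hm : (HomogeneousIdeal.irrelevant 𝒜).toIdeal ≠ ⊥)
    (hI : I.IsHomogeneous 𝒜) (hI_ne : I ≠ ⊤) (hI_len : IsFiniteLength R (R ⧸ I))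
    {d : ℕ} (hdim : ringKrullDim R = d)
    (hpd : CategoryTheory.projectiveDimension (ModuleCat.of R (R ⧸ I)) < ⊤)
    (F : MinimalGradedResolution 𝒜 I) (n m : ℕ) :
    (pieceLength 𝒜 (bracketPower I (p ^ n)) m : ℤ) =
      ∑ i ∈ Finset.range (d + 1), (-1 : ℤ) ^ i * (∑ a, Module.finrank k
        (intPiece 𝒜 ((m : ℤ) - ((p ^ n : ℕ) : ℤ) * F.shift i a)) : ℕ) := by
  have : ExpChar R p := ExpChar.prime Fact.out
  obtain ⟨a₀, huniq, hshift, hrange⟩ := F.exists_unique_basis_zero h𝒜 hI hI_ne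
  obtain ⟨s, hsd, hpos, hzero⟩ := F.exists_length h𝒜 hm hI hI_ne hdim hpd
  have hmax := irrelevant_isMaximal h𝒜
  have hf : ∀ x : R, iterateFrobenius R p n x = x ^ p ^ n := iterateFrobenius_def p n
  have hsupp : ∀ x ∈ (HomogeneousIdeal.irrelevant 𝒜).toIdeal, ∃ N : ℕ, ∀ v,
      x ^ N • v ∈ LinearMap.range (F.diff 0).mulVecLin := by
    intro x hx
    obtain ⟨N, hN⟩ := exists_pow_mem h𝒜 hI hI_ne hI_len hx
    exact ⟨N, fun v => (hrange _).mpr (I.mul_mem_right _ hN)⟩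
  have hex := exact_map_of_minimal _ hm hzero F.minimal F.exact_succ hpos hsupp
    (iterateFrobenius R p n) (p ^ n) hf
  have key := alternating_sum_finrank_strand
    (shift := fun i a => ((p ^ n : ℕ) : ℤ) * F.shift i a) hfd
    (fun i => (F.isHomogeneousMatrix i).map_pow _ hf) hex (hzero (d + 1) (by omega)) (m : ℤ)
  rw [key]
  -- the coordinate identifies `F₀` with `R` and the image of `F₁^[q]` with `I^[q]`
  have hrangeq : ∀ v, v ∈ LinearMap.range ((F.diff 0).map (iterateFrobenius R p n)).mulVecLin ↔
      v a₀ ∈ bracketPower I (p ^ n) := by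
    intro v
    have hvs : v = LinearMap.single R (fun _ => R) a₀ (v a₀) := by
      funext a
      rw [huniq a]
      simp
    constructor
    · rintro ⟨w, rfl⟩
      rw [Matrix.mulVecLin_apply, Matrix.mulVec, dotProduct]
      refine Ideal.sum_mem _ fun c _ => Ideal.mul_mem_right _ _ (Ideal.subset_span ⟨_, ?_,
        (hf _).symm⟩)
      have h1 := (hrange _).mp ⟨Pi.single c 1, rfl⟩
      rwa [Matrix.mulVecLin_apply, Matrix.mulVec_single_one] at h1
    · intro hv
      rw [hvs]
      suffices hle : bracketPower I (p ^ n) ≤ Submodule.comap (LinearMap.single R (fun _ => R) a₀)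
          (LinearMap.range ((F.diff 0).map (iterateFrobenius R p n)).mulVecLin) from hle hv
      refine Ideal.span_le.mpr ?_
      rintro _ ⟨y, hy, rfl⟩
      obtain ⟨w, hw⟩ := (hrange (Pi.single a₀ y)).mpr (by rwa [Pi.single_eq_same])
      refine ⟨fun c => iterateFrobenius R p n (w c), ?_⟩
      funext a
      rw [huniq a]
      have h1 := congrFun hw a₀
      rw [Pi.single_eq_same, Matrix.mulVecLin_apply, Matrix.mulVec, dotProduct] at h1
      rw [LinearMap.coe_single, Pi.single_eq_same]
      change _ = y ^ p ^ n
      rw [← hf, ← h1, map_sum, Matrix.mulVecLin_apply, Matrix.mulVec, dotProduct]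
      simp_rw [map_mul]
      rfl
  have hproj : Function.Injective (LinearMap.proj a₀ : (Fin (F.rank 0) → R) →ₗ[k] R) := by
    intro v w hvw
    funext a
    rw [huniq a]
    exact hvw
  have hstrand : (strand 𝒜 (fun a => ((p ^ n : ℕ) : ℤ) * F.shift 0 a) (m : ℤ)).map
      (LinearMap.proj a₀ : (Fin (F.rank 0) → R) →ₗ[k] R) = 𝒜 m := by
    ext r
    constructor
    · rintro ⟨v, hv, rfl⟩
      have := mem_strand.mp hv a₀
      rwa [hshift, mul_zero, sub_zero, intPiece_natCast] at this
    · intro hr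
      refine ⟨Pi.single a₀ r, mem_strand.mpr fun a => ?_, by simp⟩
      rw [huniq a, Pi.single_eq_same, hshift, mul_zero, sub_zero, intPiece_natCast]
      exact hr
  have hinf : (strand 𝒜 (fun a => ((p ^ n : ℕ) : ℤ) * F.shift 0 a) (m : ℤ) ⊓
      (LinearMap.range ((F.diff 0).map (iterateFrobenius R p n)).mulVecLin).restrictScalars k).map
      (LinearMap.proj a₀ : (Fin (F.rank 0) → R) →ₗ[k] R) =
      𝒜 m ⊓ (bracketPower I (p ^ n)).restrictScalars k := by
    rw [Submodule.map_inf _ hproj, hstrand]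
    congr 1
    ext r
    constructor
    · rintro ⟨v, hv, rfl⟩
      exact (hrangeq v).mp hv
    · intro hr
      exact ⟨Pi.single a₀ r, (hrangeq _).mpr (by rwa [Pi.single_eq_same]), by simp⟩
  have h1 := (Submodule.equivMapOfInjective _ hproj
    (strand 𝒜 (fun a => ((p ^ n : ℕ) : ℤ) * F.shift 0 a) (m : ℤ))).finrank_eq
  have h2 := (Submodule.equivMapOfInjective _ hproj
    (strand 𝒜 (fun a => ((p ^ n : ℕ) : ℤ) * F.shift 0 a) (m : ℤ) ⊓
      (LinearMap.range ((F.diff 0).map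
        (iterateFrobenius R p n)).mulVecLin).restrictScalars k)).finrank_eq
  rw [hstrand] at h1
  rw [hinf] at h2
  have h3 := pieceLength_add_finrank 𝒜 (bracketPower I (p ^ n)) m
  rw [h1, h2]
  omega

end MinimalGradedResolution

end Resolution

/-! ### Existence of minimal graded resolutions -/

section Existence

variable {k : Type v} [Field k] {R : Type u} [CommRing R] [Algebra k R]
  {𝒜 : ℕ → Submodule k R} [GradedAlgebra 𝒜]

/-- Sums over finite sets of degrees containing the support of `r` recover `r`. -/
theorem exists_sum_intProj (r : R) : ∃ Z : Finset ℤ, ∀ Z', Z ⊆ Z' →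
    ∑ z ∈ Z', intProj 𝒜 z r = r := by
  classical
  refine ⟨(DirectSum.decompose 𝒜 r).support.image (fun n : ℕ => (n : ℤ)), fun Z' hZ => ?_⟩
  rw [← Finset.sum_subset hZ, Finset.sum_image (g := fun n : ℕ => (n : ℤ))
    (fun _ _ _ _ h => Int.ofNat_injective h)]
  · conv_rhs => rw [← DirectSum.sum_support_decompose 𝒜 r]
    refine Finset.sum_congr rfl fun n _ => ?_
    rw [intProj, if_pos (Int.natCast_nonneg n), Int.toNat_natCast, GradedAlgebra.proj_apply]
  · intro z _ hz
    rw [intProj]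
    split_ifs with h
    · rw [GradedAlgebra.proj_apply]
      by_contra hne
      refine hz (Finset.mem_image.mpr ⟨z.toNat, ?_, Int.toNat_of_nonneg h⟩)
      rw [DFinsupp.mem_support_iff]
      exact fun h0 => hne (by rw [h0]; rfl)
    · rfl

theorem exists_sum_strandProj {r : ℕ} (shift : Fin r → ℤ) (v : Fin r → R) :
    ∃ Z : Finset ℤ, ∑ z ∈ Z, strandProj 𝒜 shift z v = v := by
  classical
  choose Z hZ using fun r : R => exists_sum_intProj (𝒜 := 𝒜) r
  refine ⟨Finset.univ.biUnion fun a => (Z (v a)).image (fun z => z + shift a), ?_⟩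
  funext a
  rw [Finset.sum_apply]
  simp only [strandProj_apply]
  rw [← Finset.sum_image (f := fun z => intProj 𝒜 z (v a)) (g := fun z => z - shift a)
    (fun _ _ _ _ h => by simpa using h)]
  refine hZ (v a) _ fun z hz => ?_
  refine Finset.mem_image.mpr ⟨z + shift a, Finset.mem_biUnion.mpr ⟨a, Finset.mem_univ a,
    Finset.mem_image_of_mem _ hz⟩, by ring⟩

variable (𝒜) in
/-- A homogeneous submodule of `R₊ F` in a graded free module `F = ⨁_a R(-shift a)`. -/
structure MinimalSyzygy where
  /-- the rank of `F` -/
  rank : ℕ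
  /-- the degrees of the basis elements of `F` -/
  shift : Fin rank → ℤ
  /-- the submodule of `F` -/
  carrier : Submodule R (Fin rank → R)
  strandProj_mem : ∀ z, ∀ v ∈ carrier, strandProj 𝒜 shift z v ∈ carrier
  mem_irrelevant : ∀ v ∈ carrier, ∀ a, v a ∈ (HomogeneousIdeal.irrelevant 𝒜).toIdeal

theorem MinimalSyzygy.exists_generators [IsNoetherianRing R] (S : MinimalSyzygy 𝒜) :
    ∃ (s : ℕ) (σ : Fin s → ℤ) (D : Matrix (Fin S.rank) (Fin s) R),
      IsHomogeneousMatrix 𝒜 S.shift σ D ∧ LinearMap.range D.mulVecLin = S.carrier := by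
  have hspan : Submodule.span R {v | v ∈ S.carrier ∧ ∃ z, v ∈ strand 𝒜 S.shift z} = S.carrier := by
    refine le_antisymm (Submodule.span_le.mpr fun v hv => hv.1) fun v hv => ?_
    obtain ⟨Z, hZ⟩ := exists_sum_strandProj (𝒜 := 𝒜) S.shift v
    rw [← hZ]
    exact Submodule.sum_mem _ fun z _ => Submodule.subset_span
      ⟨S.strandProj_mem z v hv, z, HKDensity.strandProj_mem _ _ _⟩
  obtain ⟨T, hT, hTspan⟩ := (Submodule.fg_span_iff_fg_span_finset_subset _).mp
    (hspan ▸ IsNoetherian.noetherian S.carrier)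
  rw [hspan] at hTspan
  have hz : ∀ c : Fin T.card, ∃ z, ((T.equivFin.symm c : T) : Fin S.rank → R) ∈
      strand 𝒜 S.shift z := fun c => (hT (T.equivFin.symm c).2).2
  choose σ hσ using hz
  refine ⟨T.card, σ, Matrix.of fun a c => ((T.equivFin.symm c : T) : Fin S.rank → R) a, ?_, ?_⟩
  · intro a c
    have h1 := mem_strand.mp (hσ c) a
    unfold intPiece at h1
    split_ifs at h1 with h
    · exact Or.inr ⟨(σ c - S.shift a).toNat, by omega, h1⟩
    · exact Or.inl ((Submodule.mem_bot k).mp h1)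
  · rw [Matrix.range_mulVecLin, hTspan]
    congr 1
    ext v
    constructor
    · rintro ⟨c, rfl⟩
      exact (T.equivFin.symm c).2
    · intro hv
      exact ⟨T.equivFin ⟨v, hv⟩, by funext a; simp [Matrix.col]⟩

/-- A homogeneous generating family of least cardinality has its relations in `R₊ F`. -/
theorem MinimalSyzygy.exists_minimal_generators [IsNoetherianRing R] (S : MinimalSyzygy 𝒜)
    (h𝒜 : ∀ r ∈ 𝒜 0, ∃ c : k, algebraMap k R c = r) :
    ∃ (s : ℕ) (σ : Fin s → ℤ) (D : Matrix (Fin S.rank) (Fin s) R),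
      IsHomogeneousMatrix 𝒜 S.shift σ D ∧ LinearMap.range D.mulVecLin = S.carrier ∧
      ∀ v, D.mulVecLin v = 0 → ∀ c, v c ∈ (HomogeneousIdeal.irrelevant 𝒜).toIdeal := by
  classical
  obtain ⟨σ, D, hD, hrange⟩ := Nat.find_spec S.exists_generators
  have hmin := fun t => Nat.find_min (m := t) S.exists_generators
  generalize Nat.find S.exists_generators = s at σ D hmin
  refine ⟨s, σ, D, hD, hrange, fun v hv c => ?_⟩
  by_contra hvc
  obtain ⟨s, rfl⟩ : ∃ t, s = t + 1 := ⟨s - 1, by have := c.pos; omega⟩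
  -- the component of the relation in the degree of the generator `c` has a unit coefficient
  have hw : D.mulVecLin (strandProj 𝒜 σ (σ c) v) = 0 := by
    rw [hD.mulVec_strandProj, hv, map_zero]
  set w := strandProj 𝒜 σ (σ c) v with hwdef
  have hwc : w c = GradedAlgebra.proj 𝒜 0 (v c) := by
    rw [hwdef, strandProj_apply, sub_self, intProj, if_pos le_rfl, Int.toNat_zero]
  obtain ⟨u, hu⟩ := h𝒜 (w c) (by rw [hwc]; exact (DirectSum.decompose 𝒜 (v c) 0).2)
  have hu0 : u ≠ 0 := by
    rintro rfl
    rw [map_zero, hwc] at hu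
    exact hvc ((mem_irrelevant_iff_proj _).mpr hu.symm)
  have hdel : ∀ y : Fin (s + 1) → R, y c = 0 →
      D.mulVecLin y = (D.submatrix id c.succAbove).mulVecLin (fun b => y (c.succAbove b)) := by
    intro y hy
    funext a
    rw [Matrix.mulVecLin_apply, Matrix.mulVecLin_apply, Matrix.mulVec, Matrix.mulVec, dotProduct,
      dotProduct, Fin.sum_univ_succAbove _ c, hy, mul_zero, zero_add]
    rfl
  refine hmin s (Nat.lt_succ_self s) ⟨fun b => σ (c.succAbove b), D.submatrix id c.succAbove,
    fun a b => hD a _, ?_⟩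
  rw [← hrange]
  apply le_antisymm
  · rintro _ ⟨y, rfl⟩
    refine ⟨c.insertNth 0 y, ?_⟩
    rw [hdel _ (Fin.insertNth_apply_same _ _ _)]
    simp
  · rintro _ ⟨y, rfl⟩
    have h1 : D.mulVecLin y = D.mulVecLin (y - (y c * algebraMap k R u⁻¹) • w) := by
      rw [map_sub, map_smul, hw, smul_zero, sub_zero]
    rw [h1, hdel]
    · exact ⟨_, rfl⟩
    · rw [Pi.sub_apply, Pi.smul_apply, smul_eq_mul, ← hu, mul_assoc, ← map_mul,
        inv_mul_cancel₀ hu0, map_one, mul_one, sub_self]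

theorem MinimalSyzygy.exists_next [IsNoetherianRing R]
    (h𝒜 : ∀ r ∈ 𝒜 0, ∃ c : k, algebraMap k R c = r) (S : MinimalSyzygy 𝒜) :
    ∃ (T : MinimalSyzygy 𝒜) (D : Matrix (Fin S.rank) (Fin T.rank) R),
      IsHomogeneousMatrix 𝒜 S.shift T.shift D ∧ LinearMap.range D.mulVecLin = S.carrier ∧
      T.carrier = LinearMap.ker D.mulVecLin := by
  obtain ⟨s, σ, D, hD, hrange, hker⟩ := S.exists_minimal_generators h𝒜
  refine ⟨⟨s, σ, LinearMap.ker D.mulVecLin, fun z v hv => ?_, hker⟩, D, hD, hrange, rfl⟩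
  rw [LinearMap.mem_ker] at hv ⊢
  rw [hD.mulVec_strandProj, hv, map_zero]

theorem nonempty_minimalGradedResolution [IsNoetherianRing R]
    (h𝒜 : ∀ r ∈ 𝒜 0, ∃ c : k, algebraMap k R c = r) {I : Ideal R} (hI : I.IsHomogeneous 𝒜)
    (hI_ne : I ≠ ⊤) : Nonempty (MinimalGradedResolution 𝒜 I) := by
  choose next D hD hrange hker using MinimalSyzygy.exists_next (𝒜 := 𝒜) h𝒜
  let S₀ : MinimalSyzygy 𝒜 :=
    { rank := 1
      shift := fun _ => 0
      carrier := Submodule.comap (LinearMap.proj 0 : (Fin 1 → R) →ₗ[R] R) I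
      strandProj_mem := by
        intro z v hv
        rw [Submodule.mem_comap, LinearMap.proj_apply] at hv ⊢
        rw [strandProj_apply, intProj]
        split_ifs
        · exact hI _ hv
        · exact I.zero_mem
      mem_irrelevant := by
        intro v hv a
        rw [Subsingleton.elim a 0]
        exact le_irrelevant h𝒜 hI hI_ne hv }
  let S : ℕ → MinimalSyzygy 𝒜 := fun n => Nat.rec S₀ (fun _ T => next T) n
  refine ⟨{ rank := fun i => (S i).rank
            shift := fun i => (S i).shift
            diff := fun i => D (S i)
            aug := I.mkQ ∘ₗ (LinearMap.proj 0 : (Fin 1 → R) →ₗ[R] R)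
            diff_homogeneous := fun i => hD (S i)
            aug_homogeneous := ?_
            aug_surjective := ?_
            exact_zero := ?_
            exact_succ := ?_
            minimal := ?_ }⟩
  · intro a
    refine Or.inr ⟨0, rfl, 1, SetLike.one_mem_graded 𝒜, ?_⟩
    have : a = (0 : Fin 1) := Subsingleton.elim (α := Fin 1) _ _
    subst this
    change Ideal.Quotient.mk I 1 = Ideal.Quotient.mk I ((Pi.single (0 : Fin 1) (1 : R) :
      Fin 1 → R) 0)
    rw [Pi.single_eq_same]
  · intro x
    obtain ⟨r, rfl⟩ := Ideal.Quotient.mk_surjective x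
    exact ⟨fun _ => r, rfl⟩
  · rw [LinearMap.exact_iff]
    change _ = LinearMap.range (D S₀).mulVecLin
    rw [hrange, LinearMap.ker_comp, Submodule.ker_mkQ]
  · intro i
    rw [LinearMap.exact_iff]
    exact (hker (S i)).symm.trans (hrange (S (i + 1))).symm
  · intro i a c
    have h1 : (D (S i)).mulVecLin (Pi.single c 1) ∈ (S i).carrier := by
      rw [← hrange]
      exact ⟨_, rfl⟩
    have h2 := (S i).mem_irrelevant _ h1 a
    rwa [Matrix.mulVecLin_apply, Matrix.mulVec_single_one] at h2

end Existence

/-! ### Lengths of graded quotients -/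

section Length

variable {k : Type v} [Field k] {R : Type u} [CommRing R] [Algebra k R]

/-- If the residue field of `𝔪` is `k`, then lengths of modules killed by a power of `𝔪` are
dimensions over `k`. -/
theorem length_eq_finrank {𝔪 : Ideal R} (h𝔪 : ∀ r : R, ∃ c : k, r - algebraMap k R c ∈ 𝔪) {N : ℕ} :
    ∀ (n : ℕ) (M : Type u) [AddCommGroup M] [Module R M] [Module k M] [IsScalarTower k R M]
      [FiniteDimensional k M], (∀ x ∈ 𝔪 ^ N, ∀ v : M, x • v = 0) → Module.finrank k M = n →
      Module.length R M = n := by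
  intro n
  induction n with
  | zero =>
    intro M _ _ _ _ _ _ hn
    have := Module.finrank_zero_iff.mp hn
    exact Module.length_eq_zero
  | succ n ih =>
    intro M _ _ _ _ _ hM hn
    have hnt : Nontrivial M := Module.nontrivial_of_finrank_pos (R := k) (by omega)
    obtain ⟨v, hv⟩ := exists_ne (0 : M)
    -- a nonzero element of the socle
    obtain ⟨w, hw, hmw⟩ : ∃ w : M, w ≠ 0 ∧ ∀ x ∈ 𝔪, x • w = 0 := by
      have hex : ∃ t, ∀ x ∈ 𝔪 ^ t, x • v = 0 := ⟨N, fun x hx => hM x hx v⟩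
      classical
      have hspec := Nat.find_spec hex
      have hmin := fun t => Nat.find_min (m := t) hex
      generalize Nat.find hex = t at hspec hmin
      have ht : t ≠ 0 := by
        rintro rfl
        exact hv (by simpa using hspec 1 (by simp))
      have h1 := hmin (t - 1) (by omega)
      push Not at h1
      obtain ⟨y, hy, hyv⟩ := h1
      refine ⟨y • v, hyv, fun x hx => ?_⟩
      rw [smul_smul]
      refine hspec _ ?_
      obtain ⟨s, rfl⟩ := Nat.exists_eq_succ_of_ne_zero ht
      rw [Nat.succ_eq_add_one, pow_succ']
      exact Ideal.mul_mem_mul hx hy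
    have hsmul : ∀ r : R, ∃ c : k, r • w = c • w := by
      intro r
      obtain ⟨c, hc⟩ := h𝔪 r
      refine ⟨c, ?_⟩
      rw [← sub_eq_zero, ← algebraMap_smul R c w, ← sub_smul]
      exact hmw _ hc
    set L := Submodule.span R {w} with hL
    have hmemL : ∀ x : L, ∃ c : k, c • w = x := by
      intro x
      obtain ⟨r, hr⟩ := Submodule.mem_span_singleton.mp x.2
      obtain ⟨c, hc⟩ := hsmul r
      exact ⟨c, hc ▸ hr⟩
    have hsimple : IsSimpleModule R L := by
      refine isSimpleModule_iff_toSpanSingleton_surjective.mpr ⟨⟨⟨w,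
        Submodule.mem_span_singleton_self w⟩, 0, fun h => hw (congrArg Subtype.val h)⟩,
        fun x hx y => ?_⟩
      obtain ⟨c, hc⟩ := hmemL x
      obtain ⟨c', hc'⟩ := hmemL y
      have hc0 : c ≠ 0 := by
        rintro rfl
        exact hx (Subtype.ext (by rw [← hc, zero_smul]; rfl))
      refine ⟨algebraMap k R (c' * c⁻¹), Subtype.ext ?_⟩
      rw [LinearMap.toSpanSingleton_apply, Submodule.coe_smul, algebraMap_smul, ← hc, ← hc',
        smul_smul, mul_assoc, inv_mul_cancel₀ hc0, mul_one]
    have h1 := Module.length_eq_add_of_exact L.subtype L.mkQ (Submodule.subtype_injective _)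
      (Submodule.mkQ_surjective _) (LinearMap.exact_subtype_mkQ L)
    have hrank := LinearMap.finrank_range_add_finrank_ker (L.mkQ.restrictScalars k)
    have hker : LinearMap.ker (L.mkQ.restrictScalars k) = L.restrictScalars k := by
      ext x
      simp
    have hL1 : Module.finrank k ↥(L.restrictScalars k) = 1 := by
      refine (finrank_eq_one_iff_of_nonzero' (⟨w, Submodule.mem_span_singleton_self w⟩ :
        ↥(L.restrictScalars k)) (fun h => hw (congrArg Subtype.val h))).mpr fun x => ?_
      obtain ⟨c, hc⟩ := hmemL x
      exact ⟨c, Subtype.ext hc⟩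
    have hsurj : LinearMap.range (L.mkQ.restrictScalars k) = ⊤ :=
      LinearMap.range_eq_top.mpr (Submodule.mkQ_surjective L)
    rw [hsurj, hker, hL1, finrank_top, hn] at hrank
    have hfin : FiniteDimensional k (M ⧸ L) :=
      Module.Finite.of_surjective (L.mkQ.restrictScalars k) (Submodule.mkQ_surjective L)
    have h2 := ih (M ⧸ L) (fun x hx v => by
      obtain ⟨u, rfl⟩ := Submodule.mkQ_surjective L v
      rw [← map_smul, hM x hx, map_zero]) (by omega)
    rw [h1, Module.length_eq_one, h2]
    push_cast
    ring

theorem finiteDimensional_quotientPiece {𝒜 : ℕ → Submodule k R}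
    (hfd : ∀ m, FiniteDimensional k (𝒜 m)) (J : Ideal R) (m : ℕ) : FiniteDimensional k (quotientPiece 𝒜 J m) := by
  have := hfd m
  unfold quotientPiece
  infer_instance

variable {𝒜 : ℕ → Submodule k R} [GradedAlgebra 𝒜]

/-- The power `R₊^n` has no nonzero elements of degree less than `n₀ n`. -/
theorem decompose_eq_zero_of_mem_irrelevant_pow (h : ∃ m, 0 < m ∧ 𝒜 m ≠ ⊥) (n : ℕ) :
    ∀ r ∈ (HomogeneousIdeal.irrelevant 𝒜).toIdeal ^ n, ∀ i < gradingGcd 𝒜 * n,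
      (DirectSum.decompose 𝒜 r i : R) = 0 := by
  classical
  induction n with
  | zero => intro r _ i hi; omega
  | succ n ih =>
    intro r hr
    rw [pow_succ'] at hr
    refine Submodule.mul_induction_on hr (fun x hx y hy i hi => ?_) fun x y hx hy i hi => ?_
    · rw [← DirectSum.sum_support_decompose 𝒜 x, Finset.sum_mul, DirectSum.decompose_sum,
        DFinsupp.finsetSum_apply, AddSubmonoidClass.coe_finsetSum]
      refine Finset.sum_eq_zero fun j hj => ?_
      have hj0 : (DirectSum.decompose 𝒜 x j : R) ≠ 0 := by
        rw [DFinsupp.mem_support_iff] at hj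
        exact fun h0 => hj (Subtype.ext h0)
      have hjpos : j ≠ 0 := by
        rintro rfl
        exact hj0 ((mem_irrelevant_iff_proj _).mp hx)
      have hdvd := Nat.le_of_dvd (Nat.pos_of_ne_zero hjpos) (gradingGcd_dvd h
        ((Submodule.ne_bot_iff _).mpr ⟨_, (DirectSum.decompose 𝒜 x j).2, hj0⟩))
      rw [DirectSum.coe_decompose_mul_of_left_mem 𝒜 i (DirectSum.decompose 𝒜 x j).2]
      split_ifs with hji
      · rw [ih y hy (i - j) (by rw [mul_add, mul_one] at hi; omega), mul_zero]
      · rfl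
    · rw [DirectSum.decompose_add, DirectSum.add_apply, Submodule.coe_add, hx i hi, hy i hi,
        add_zero]

theorem mem_of_decompose_mem {J : Ideal R} {N : ℕ} (hJ : ∀ m, N ≤ m → ∀ r ∈ 𝒜 m, r ∈ J) {r : R}
    (hr : ∀ i < N, (DirectSum.decompose 𝒜 r i : R) ∈ J) : r ∈ J := by
  classical
  rw [← DirectSum.sum_support_decompose 𝒜 r]
  refine J.sum_mem fun i _ => ?_
  by_cases hi : i < N
  · exact hr i hi
  · exact hJ i (not_lt.mp hi) _ (DirectSum.decompose 𝒜 r i).2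

/-- A graded quotient of `R` is the direct sum of its graded pieces. -/
theorem finrank_quotient (hfd : ∀ m, FiniteDimensional k (𝒜 m)) {J : Ideal R}
    (hJ : J.IsHomogeneous 𝒜) {N : ℕ} (hN : ∀ m, N ≤ m → ∀ r ∈ 𝒜 m, r ∈ J) :
    FiniteDimensional k (R ⧸ J) ∧
      Module.finrank k (R ⧸ J) = ∑ m ∈ Finset.range N, pieceLength 𝒜 J m := by
  classical
  have hfq := finiteDimensional_quotientPiece hfd J
  let f : ((m : Fin N) → quotientPiece 𝒜 J m) →ₗ[k] R ⧸ J :=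
    ∑ m : Fin N, (quotientPiece 𝒜 J m).subtype ∘ₗ LinearMap.proj m
  have hf : ∀ x, f x = ∑ m : Fin N, (x m : R ⧸ J) := by
    intro x
    simp [f]
  have hinj : Function.Injective f := by
    rw [← LinearMap.ker_eq_bot, LinearMap.ker_eq_bot']
    intro x hx
    choose r hr hrx using fun m => (x m).2
    have h1 : ∑ m : Fin N, r m ∈ J := by
      rw [← Ideal.Quotient.eq_zero_iff_mem, map_sum, ← hx, hf]
      exact Finset.sum_congr rfl fun m _ => hrx m
    funext m
    refine Subtype.ext ?_
    rw [← hrx m]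
    refine Ideal.Quotient.eq_zero_iff_mem.mpr ?_
    have h2 := hJ m h1
    rwa [DirectSum.decompose_sum, DFinsupp.finsetSum_apply, AddSubmonoidClass.coe_finsetSum,
      Finset.sum_eq_single m, DirectSum.decompose_of_mem_same 𝒜 (hr m)] at h2
    · intro j _ hj
      exact DirectSum.decompose_of_mem_ne 𝒜 (hr j) (fun h => hj (Fin.ext h))
    · exact fun h => absurd (Finset.mem_univ m) h
  have hsurj : Function.Surjective f := by
    intro y
    obtain ⟨r, rfl⟩ := Ideal.Quotient.mk_surjective y
    refine ⟨fun m => ⟨Ideal.Quotient.mk J (DirectSum.decompose 𝒜 r m), _,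
      (DirectSum.decompose 𝒜 r m).2, rfl⟩, ?_⟩
    rw [hf, ← map_sum, eq_comm, Ideal.Quotient.eq]
    refine mem_of_decompose_mem hN fun i hi => ?_
    have h0 : (DirectSum.decompose 𝒜 (r - ∑ m : Fin N, (DirectSum.decompose 𝒜 r m : R)) i : R) =
        0 := by
      rw [DirectSum.decompose_sub, DirectSum.sub_apply, Submodule.coe_sub, DirectSum.decompose_sum,
        DFinsupp.finsetSum_apply, AddSubmonoidClass.coe_finsetSum,
        Finset.sum_eq_single ⟨i, hi⟩,
        DirectSum.decompose_of_mem_same 𝒜 (DirectSum.decompose 𝒜 r i).2, sub_self]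
      · intro j _ hj
        exact DirectSum.decompose_of_mem_ne 𝒜 (DirectSum.decompose 𝒜 r j).2
          (fun h => hj (Fin.ext h))
      · exact fun h => absurd (Finset.mem_univ _) h
    rw [h0]
    exact J.zero_mem
  refine ⟨Module.Finite.of_surjective f hsurj, ?_⟩
  rw [← (LinearEquiv.ofBijective f ⟨hinj, hsurj⟩).finrank_eq, Module.finrank_pi_fintype,
    Finset.sum_range fun m => pieceLength 𝒜 J m]
  rfl

theorem length_quotient_eq_sum (h𝒜 : ∀ r ∈ 𝒜 0, ∃ c : k, algebraMap k R c = r)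
    (hfd : ∀ m, FiniteDimensional k (𝒜 m)) (h : ∃ m, 0 < m ∧ 𝒜 m ≠ ⊥) {J : Ideal R}
    (hJ : J.IsHomogeneous 𝒜) {N : ℕ} (hN : ∀ m, N ≤ m → ∀ r ∈ 𝒜 m, r ∈ J) :
    Module.length R (R ⧸ J) = (∑ m ∈ Finset.range N, pieceLength 𝒜 J m : ℕ) := by
  obtain ⟨hfin, hrank⟩ := finrank_quotient hfd hJ hN
  refine length_eq_finrank (exists_algebraMap_sub_mem h𝒜) (N := N) _ _ (fun x hx v => ?_) hrank
  obtain ⟨r, rfl⟩ := Ideal.Quotient.mk_surjective v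
  rw [Algebra.smul_def, Ideal.Quotient.algebraMap_eq, ← map_mul, Ideal.Quotient.eq_zero_iff_mem]
  refine J.mul_mem_right r (mem_of_decompose_mem hN fun i hi => ?_)
  rw [decompose_eq_zero_of_mem_irrelevant_pow h N x hx i
    (lt_of_lt_of_le hi (Nat.le_mul_of_pos_left _ (gradingGcd_pos h)))]
  exact J.zero_mem

/-- The quotients `R / I^[q]` vanish in degrees at least a constant multiple of `q`. -/
theorem exists_forall_mem_bracketPower [IsDomain R] [IsNoetherianRing R]
    (G : HomogeneousGenerators 𝒜) (h𝒜 : ∀ r ∈ 𝒜 0, ∃ c : k, algebraMap k R c = r) {I : Ideal R}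
    (hI : I.IsHomogeneous 𝒜) (hI_ne : I ≠ ⊤) (hI_len : IsFiniteLength R (R ⧸ I)) :
    ∃ M : ℕ, 0 < M ∧ ∀ q, 0 < q → ∀ m, M * q ≤ m → ∀ r ∈ 𝒜 m, r ∈ bracketPower I q := by
  choose N hN using fun i => exists_pow_mem h𝒜 hI hI_ne hI_len
    (HomogeneousIdeal.mem_irrelevant_of_mem 𝒜 (G.deg_pos i) (G.mem i))
  have hle : ∀ i, G.gen i ^ (∑ j, N j + 1) ∈ I := fun i => I.pow_mem_of_pow_mem (hN i)
    ((Finset.single_le_sum (fun _ _ => Nat.zero_le _) (Finset.mem_univ i)).trans (Nat.le_succ _))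
  refine ⟨(1 + ∑ i, G.deg i) * (∑ j, N j + 1), by positivity, fun q hq m hm => ?_⟩
  refine G.le_of_pow_mem (M := (∑ j, N j + 1) * q) (by positivity) (fun i => ?_)
    (by rwa [← mul_assoc])
  rw [pow_mul]
  exact Ideal.subset_span ⟨_, hle i, rfl⟩

/-- If `R` is generated in degree `n₀`, then `𝔪^n` is the part of `R` of degree at least `n₀ n`. -/
theorem mem_irrelevant_pow_of_adjoin (h : ∃ m, 0 < m ∧ 𝒜 m ≠ ⊥)
    (hgen : Algebra.adjoin k (𝒜 (gradingGcd 𝒜) : Set R) = ⊤) (n a : ℕ) (ha : n ≤ a) :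
    ∀ r ∈ 𝒜 (gradingGcd 𝒜 * a), r ∈ (HomogeneousIdeal.irrelevant 𝒜).toIdeal ^ n := by
  have hpos := gradingGcd_pos h
  set m := (HomogeneousIdeal.irrelevant 𝒜).toIdeal with hm
  -- monomials of degree `n₀ a` in elements of degree `n₀` have `a` factors
  intro r hr
  have hmem : r ∈ Subalgebra.toSubmodule (Algebra.adjoin k (𝒜 (gradingGcd 𝒜) : Set R)) := by
    rw [hgen]
    trivial
  rw [Algebra.adjoin_eq_span] at hmem
  have hclosure : ∀ x ∈ Submonoid.closure (𝒜 (gradingGcd 𝒜) : Set R),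
      ∃ b, x ∈ 𝒜 (gradingGcd 𝒜 * b) ∧ x ∈ m ^ b := by
    intro x hx
    induction hx using Submonoid.closure_induction with
    | mem x hx =>
      exact ⟨1, by rwa [mul_one], by
        rw [pow_one]; exact HomogeneousIdeal.mem_irrelevant_of_mem 𝒜 hpos hx⟩
    | one => exact ⟨0, SetLike.one_mem_graded 𝒜, by simp⟩
    | mul x y _ _ hx hy =>
      obtain ⟨b, hb, hb'⟩ := hx
      obtain ⟨c, hc, hc'⟩ := hy
      exact ⟨b + c, by rw [mul_add]; exact SetLike.mul_mem_graded hb hc, by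
        rw [pow_add]; exact Ideal.mul_mem_mul hb' hc'⟩
  have hproj : ∀ x ∈ Submodule.span k (Submonoid.closure (𝒜 (gradingGcd 𝒜) : Set R) : Set R),
      (DirectSum.decompose 𝒜 x (gradingGcd 𝒜 * a) : R) ∈ m ^ n := by
    intro x hx
    induction hx using Submodule.span_induction with
    | mem x hx =>
      obtain ⟨b, hb, hb'⟩ := hclosure x hx
      by_cases hab : b = a
      · subst hab
        rw [DirectSum.decompose_of_mem_same 𝒜 hb]
        exact Ideal.pow_le_pow_right ha hb'
      · rw [DirectSum.decompose_of_mem_ne 𝒜 hb fun h => hab (Nat.eq_of_mul_eq_mul_left hpos h)]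
        exact Ideal.zero_mem _
    | zero => rw [DirectSum.decompose_zero]; exact Ideal.zero_mem _
    | add x y _ _ hx hy =>
      rw [DirectSum.decompose_add, DirectSum.add_apply, Submodule.coe_add]
      exact Ideal.add_mem _ hx hy
    | smul c x _ hx =>
      rw [DirectSum.decompose_smul, DirectSum.smul_apply, Submodule.coe_smul, Algebra.smul_def]
      exact Ideal.mul_mem_left _ _ hx
  have := hproj r hmem
  rwa [DirectSum.decompose_of_mem_same 𝒜 hr] at this

/-- The length of `R / 𝔪^n` if `R` is generated in degree `n₀`. -/
theorem length_quotient_irrelevant_pow (h𝒜 : ∀ r ∈ 𝒜 0, ∃ c : k, algebraMap k R c = r)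
    (hfd : ∀ m, FiniteDimensional k (𝒜 m)) (h : ∃ m, 0 < m ∧ 𝒜 m ≠ ⊥)
    (hgen : Algebra.adjoin k (𝒜 (gradingGcd 𝒜) : Set R) = ⊤) (n : ℕ) :
    Module.length R (R ⧸ (HomogeneousIdeal.irrelevant 𝒜).toIdeal ^ n) =
      (∑ a ∈ Finset.range n, Module.finrank k (𝒜 (gradingGcd 𝒜 * a)) : ℕ) := by
  have hhom : ((HomogeneousIdeal.irrelevant 𝒜).toIdeal ^ n).IsHomogeneous 𝒜 := by
    induction n with
    | zero => rw [pow_zero, Ideal.one_eq_top]; exact Ideal.IsHomogeneous.top 𝒜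
    | succ n ih => rw [pow_succ]; exact ih.mul (HomogeneousIdeal.irrelevant 𝒜).isHomogeneous
  rw [length_quotient_eq_sum h𝒜 hfd h hhom (N := gradingGcd 𝒜 * n)]
  · rw [← sum_finrank_mul h]
    congr 1
    refine Finset.sum_congr rfl fun i hi => ?_
    have h1 := pieceLength_add_finrank 𝒜 ((HomogeneousIdeal.irrelevant 𝒜).toIdeal ^ n) i
    have h2 : 𝒜 i ⊓ ((HomogeneousIdeal.irrelevant 𝒜).toIdeal ^ n).restrictScalars k = ⊥ := by
      rw [eq_bot_iff]
      rintro x ⟨hx, hx'⟩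
      have := decompose_eq_zero_of_mem_irrelevant_pow h n x hx' i (Finset.mem_range.mp hi)
      rwa [DirectSum.decompose_of_mem_same 𝒜 hx] at this
    rw [h2, finrank_bot] at h1
    exact h1
  · intro i hi r hr
    by_cases hr0 : r = 0
    · rw [hr0]; exact Ideal.zero_mem _
    · obtain ⟨a, rfl⟩ := gradingGcd_dvd h ((Submodule.ne_bot_iff _).mpr ⟨r, hr, hr0⟩)
      exact mem_irrelevant_pow_of_adjoin h hgen n a
        (Nat.le_of_mul_le_mul_left hi (gradingGcd_pos h)) r hr

end Length

/-! ### Graded Betti numbers -/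

section Betti

variable {k : Type v} [Field k] {R : Type u} [CommRing R] [Algebra k R]

/-- The Hilbert function `z ↦ dim R_{z n₀}`, on all integers. -/
def hilbertFun (𝒜 : ℕ → Submodule k R) (z : ℤ) : ℕ :=
  Module.finrank k (intPiece 𝒜 ((gradingGcd 𝒜 : ℤ) * z))

variable {𝒜 : ℕ → Submodule k R}

theorem hilbertFun_natCast (a : ℕ) :
    hilbertFun 𝒜 a = Module.finrank k (𝒜 (gradingGcd 𝒜 * a)) := by
  rw [hilbertFun, ← Nat.cast_mul, intPiece_natCast]

theorem hilbertFun_of_neg (h : ∃ m, 0 < m ∧ 𝒜 m ≠ ⊥) {z : ℤ} (hz : z < 0) :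
    hilbertFun 𝒜 z = 0 := by
  have := gradingGcd_pos h
  rw [hilbertFun, intPiece_of_neg _ (mul_neg_of_pos_of_neg (by exact_mod_cast this) hz),
    finrank_bot]

theorem sum_finrank_intPiece (h : ∃ m, 0 < m ∧ 𝒜 m ≠ ⊥) (z : ℤ) :
    ∑ r ∈ Finset.range (gradingGcd 𝒜),
      Module.finrank k (intPiece 𝒜 ((gradingGcd 𝒜 : ℤ) * z + r)) = hilbertFun 𝒜 z := by
  have hpos := gradingGcd_pos h
  rw [Finset.sum_eq_single 0]
  · rw [Nat.cast_zero, add_zero, hilbertFun]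
  · intro r hr hr0
    by_cases hz : 0 ≤ (gradingGcd 𝒜 : ℤ) * z + r
    · rw [intPiece, if_pos hz]
      refine finrank_eq_zero_of_not_dvd h fun hdvd => ?_
      have h1 : (gradingGcd 𝒜 : ℤ) ∣ gradingGcd 𝒜 * z + r := by
        rw [← Int.toNat_of_nonneg hz]
        exact_mod_cast hdvd
      have h2 : gradingGcd 𝒜 ∣ r := by
        exact_mod_cast (Int.dvd_add_right (dvd_mul_right _ z)).mp h1
      have := Nat.le_of_dvd (Nat.pos_of_ne_zero hr0) h2
      have := Finset.mem_range.mp hr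
      omega
    · rw [intPiece, if_neg hz, finrank_bot]
  · exact fun h0 => absurd (Finset.mem_range.mpr hpos) h0

variable [GradedAlgebra 𝒜] {I : Ideal R}

namespace MinimalGradedResolution

variable (F : MinimalGradedResolution 𝒜 I)

theorem betti_ne_zero_iff {i : ℕ} {j : ℤ} : F.betti i j ≠ 0 ↔ ∃ a, F.shift i a = j := by
  rw [betti, Finset.card_ne_zero]
  simp [Finset.Nonempty]

theorem exists_shift_eq [Nontrivial R] (h : ∃ m, 0 < m ∧ 𝒜 m ≠ ⊥) (h0 : ∀ a, F.shift 0 a = 0)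
    {i : ℕ} {j : ℤ} (hj : F.betti i j ≠ 0) : ∃ b : ℕ, j = (gradingGcd 𝒜 : ℤ) * b ∧ i ≤ b := by
  obtain ⟨a, ha⟩ := F.betti_ne_zero_iff.mp hj
  obtain ⟨b, hb, hib⟩ := F.shift_eq_mul h h0 i a
  exact ⟨b, by rw [← ha, hb], hib⟩

theorem altBetti_of_neg [Nontrivial R] (h : ∃ m, 0 < m ∧ 𝒜 m ≠ ⊥) (h0 : ∀ a, F.shift 0 a = 0)
    (d : ℕ) {j : ℤ} (hj : j < 0) : F.altBetti d j = 0 := by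
  refine Finset.sum_eq_zero fun i _ => ?_
  by_cases hne : F.betti i j = 0
  · rw [hne, Nat.cast_zero, mul_zero]
  · obtain ⟨b, rfl, -⟩ := F.exists_shift_eq h h0 hne
    exact absurd hj (not_lt.mpr (by positivity))

theorem altBetti_zero [Nontrivial R] (h : ∃ m, 0 < m ∧ 𝒜 m ≠ ⊥) {a₀ : Fin (F.rank 0)}
    (hu : ∀ a, a = a₀) (h0 : F.shift 0 a₀ = 0) (d : ℕ) : F.altBetti d 0 = 1 := by
  have hpos := gradingGcd_pos h
  rw [altBetti, Finset.sum_eq_single 0]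
  · have : F.betti 0 0 = 1 := by
      rw [betti, Finset.card_eq_one]
      refine ⟨a₀, ?_⟩
      ext a
      simp [hu a, h0]
    rw [this]
    rfl
  · intro i _ hi
    by_cases hne : F.betti i 0 = 0
    · rw [hne, Nat.cast_zero, mul_zero]
    · obtain ⟨b, hb, hib⟩ := F.exists_shift_eq h (fun a => by rw [hu a, h0]) hne
      have : 0 < b := by omega
      have : (0 : ℤ) < (gradingGcd 𝒜 : ℤ) * b := by positivity
      omega
  · exact fun h1 => absurd (Finset.mem_range.mpr (Nat.succ_pos d)) h1

theorem exists_isGreatest [Nontrivial R] (h : ∃ m, 0 < m ∧ 𝒜 m ≠ ⊥)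
    (h0 : ∀ a, F.shift 0 a = 0) (hne : 0 < F.rank 0) {d : ℕ} (hd : ∀ i, d < i → F.rank i = 0) :
    ∃ l : ℕ, IsGreatest {j : ℤ | ∃ i, F.betti i j ≠ 0} ((gradingGcd 𝒜 : ℤ) * l) := by
  have hfin : {j : ℤ | ∃ i, F.betti i j ≠ 0}.Finite := by
    refine (Set.finite_range fun x : (i : Fin (d + 1)) × Fin (F.rank i) =>
      F.shift x.1 x.2).subset ?_
    rintro j ⟨i, hj⟩
    obtain ⟨a, ha⟩ := F.betti_ne_zero_iff.mp hj
    have hi : i < d + 1 := by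
      by_contra hi
      have := hd i (by omega)
      have := a.pos
      omega
    exact ⟨⟨⟨i, hi⟩, a⟩, ha⟩
  have hnonempty : hfin.toFinset.Nonempty :=
    ⟨F.shift 0 ⟨0, hne⟩, hfin.mem_toFinset.mpr ⟨0, F.betti_ne_zero_iff.mpr ⟨_, rfl⟩⟩⟩
  have hmax := hfin.toFinset.isGreatest_max' hnonempty
  rw [hfin.coe_toFinset] at hmax
  obtain ⟨i, hi⟩ := hmax.1
  obtain ⟨l, hl, -⟩ := F.exists_shift_eq h h0 hi
  exact ⟨l, hl ▸ hmax⟩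

theorem altBetti_eq_zero_of_lt (h : ∃ m, 0 < m ∧ 𝒜 m ≠ ⊥) {l : ℕ}
    (hl : IsGreatest {j : ℤ | ∃ i, F.betti i j ≠ 0} ((gradingGcd 𝒜 : ℤ) * l)) (d : ℕ) {j : ℕ}
    (hj : l < j) : F.altBetti d ((gradingGcd 𝒜 : ℤ) * j) = 0 := by
  have hpos := gradingGcd_pos h
  refine Finset.sum_eq_zero fun i _ => ?_
  by_cases hne : F.betti i ((gradingGcd 𝒜 : ℤ) * j) = 0
  · rw [hne, Nat.cast_zero, mul_zero]
  · have h1 := hl.2 ⟨i, hne⟩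
    have h2 : (gradingGcd 𝒜 : ℤ) * l < gradingGcd 𝒜 * j := by
      gcongr
    omega

/-- Sums over the shifts of a resolution, in terms of the alternating sums of Betti numbers. -/
theorem sum_shift_eq [Nontrivial R] (h : ∃ m, 0 < m ∧ 𝒜 m ≠ ⊥) (h0 : ∀ a, F.shift 0 a = 0) {l : ℕ}
    (hl : IsGreatest {j : ℤ | ∃ i, F.betti i j ≠ 0} ((gradingGcd 𝒜 : ℤ) * l)) (d : ℕ)
    (ψ : ℤ → ℤ) :
    ∑ i ∈ Finset.range (d + 1), (-1 : ℤ) ^ i * ∑ a, ψ (F.shift i a) =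
      ∑ j ∈ Finset.range (l + 1),
        F.altBetti d ((gradingGcd 𝒜 : ℤ) * j) * ψ ((gradingGcd 𝒜 : ℤ) * j) := by
  have hpos := gradingGcd_pos h
  simp only [altBetti, Finset.sum_mul]
  rw [Finset.sum_comm]
  refine Finset.sum_congr rfl fun i _ => ?_
  simp only [mul_assoc, ← Finset.mul_sum]
  congr 1
  choose J hJ _ using F.shift_eq_mul h h0 i
  have hmaps : ∀ a ∈ (Finset.univ : Finset (Fin (F.rank i))), J a ∈ Finset.range (l + 1) := by
    intro a _
    have h1 := hl.2 ⟨i, F.betti_ne_zero_iff.mpr ⟨a, rfl⟩⟩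
    rw [hJ a] at h1
    have h2 : (J a : ℤ) ≤ l := le_of_mul_le_mul_left h1 (by exact_mod_cast hpos)
    rw [Finset.mem_range]
    omega
  rw [← Finset.sum_fiberwise_of_maps_to hmaps]
  refine Finset.sum_congr rfl fun j _ => ?_
  rw [betti, ← nsmul_eq_mul, ← Finset.sum_const]
  have hfilter : (Finset.univ.filter fun a : Fin (F.rank i) => J a = j) =
      Finset.univ.filter fun a : Fin (F.rank i) => F.shift i a = (gradingGcd 𝒜 : ℤ) * j := by
    ext a
    simp only [Finset.mem_filter, Finset.mem_univ, true_and, hJ a]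
    constructor
    · rintro rfl
      rfl
    · intro h1
      exact_mod_cast mul_left_cancel₀ (by exact_mod_cast hpos.ne') h1
  rw [← hfilter]
  refine Finset.sum_congr rfl fun a ha => ?_
  rw [hJ a, (Finset.mem_filter.mp ha).2]

/-- The lengths of the graded pieces of `R / I^[q]`, grouped in blocks of length `n₀`, are
alternating sums of shifted Hilbert functions of `R`. -/
theorem sum_pieceLength_bracketPower [IsDomain R] [IsNoetherianRing R] (p : ℕ) [Fact p.Prime]
    [CharP R p] (h𝒜 : ∀ r ∈ 𝒜 0, ∃ c : k, algebraMap k R c = r)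
    (hfd : ∀ m, FiniteDimensional k (𝒜 m)) (h : ∃ m, 0 < m ∧ 𝒜 m ≠ ⊥)
    (hm : (HomogeneousIdeal.irrelevant 𝒜).toIdeal ≠ ⊥)
    (hI : I.IsHomogeneous 𝒜) (hI_ne : I ≠ ⊤) (hI_len : IsFiniteLength R (R ⧸ I))
    {d : ℕ} (hdim : ringKrullDim R = d)
    (hpd : CategoryTheory.projectiveDimension (ModuleCat.of R (R ⧸ I)) < ⊤)
    (h0 : ∀ a, F.shift 0 a = 0) {l : ℕ}
    (hl : IsGreatest {j : ℤ | ∃ i, F.betti i j ≠ 0} ((gradingGcd 𝒜 : ℤ) * l)) (n u : ℕ) :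
    ((∑ r ∈ Finset.range (gradingGcd 𝒜),
      pieceLength 𝒜 (bracketPower I (p ^ n)) (u * gradingGcd 𝒜 + r) : ℕ) : ℤ) =
      ∑ j ∈ Finset.range (l + 1), F.altBetti d ((gradingGcd 𝒜 : ℤ) * j) *
        hilbertFun 𝒜 ((u : ℤ) - (p ^ n : ℕ) * j) := by
  rw [Nat.cast_sum]
  have h1 : ∀ r, (pieceLength 𝒜 (bracketPower I (p ^ n)) (u * gradingGcd 𝒜 + r) : ℤ) =
      ∑ j ∈ Finset.range (l + 1), F.altBetti d ((gradingGcd 𝒜 : ℤ) * j) *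
        (Module.finrank k (intPiece 𝒜
          ((gradingGcd 𝒜 : ℤ) * ((u : ℤ) - (p ^ n : ℕ) * j) + r)) : ℤ) := by
    intro r
    rw [F.pieceLength_bracketPower p h𝒜 hfd hm hI hI_ne hI_len hdim hpd]
    have h2 := F.sum_shift_eq h h0 hl d fun z => (Module.finrank k (intPiece 𝒜
      (((u * gradingGcd 𝒜 + r : ℕ) : ℤ) - ((p ^ n : ℕ) : ℤ) * z)) : ℤ)
    simp only [Nat.cast_sum (R := ℤ)]
    rw [h2]
    refine Finset.sum_congr rfl fun j _ => ?_
    have h3 : ∀ z w : ℤ, z = w →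
        Module.finrank k (intPiece 𝒜 z) = Module.finrank k (intPiece 𝒜 w) := by
      rintro z _ rfl
      rfl
    rw [h3 _ ((gradingGcd 𝒜 : ℤ) * ((u : ℤ) - (p ^ n : ℕ) * j) + r) (by push_cast; ring)]
  rw [Finset.sum_congr rfl fun r _ => h1 r, Finset.sum_comm]
  refine Finset.sum_congr rfl fun j _ => ?_
  rw [← Finset.mul_sum, ← sum_finrank_intPiece h, Nat.cast_sum]

end MinimalGradedResolution

end Betti

/-! ### Limits of alternating sums of shifted functions -/

section Analysis

variable {H : ℤ → ℝ} {D : ℕ} {c : ℝ}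

/-- An asymptotically monomial function on `ℤ` that vanishes on negative integers is within
`ε z₊^D + O(1)` of `c z₊^D`. -/
theorem exists_abs_sub_le_add (hneg : ∀ z < 0, H z = 0) (hD : D ≠ 0)
    (hlim : Tendsto (fun a : ℕ => H a / (a : ℝ) ^ D) atTop (𝓝 c)) {ε : ℝ} (hε : 0 < ε) :
    ∃ C, 0 ≤ C ∧ ∀ z : ℤ, |H z - c * max (z : ℝ) 0 ^ D| ≤ ε * max (z : ℝ) 0 ^ D + C := by
  obtain ⟨N, hN⟩ := (Metric.tendsto_atTop.mp hlim) ε hε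
  refine ⟨∑ a ∈ Finset.range (N + 1), |H a - c * (a : ℝ) ^ D|, by positivity, fun z => ?_⟩
  have hC : 0 ≤ ∑ a ∈ Finset.range (N + 1), |H a - c * (a : ℝ) ^ D| := by positivity
  rcases lt_or_ge z 0 with hz | hz
  · rw [hneg z hz, max_eq_right (by exact_mod_cast hz.le), zero_pow hD, mul_zero, sub_zero,
      abs_zero, mul_zero, zero_add]
    exact hC
  · obtain ⟨a, rfl⟩ := Int.eq_ofNat_of_zero_le hz
    rw [Int.cast_natCast, max_eq_left (Nat.cast_nonneg a)]
    by_cases ha : a < N + 1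
    · have h1 := Finset.single_le_sum (f := fun a : ℕ => |H a - c * (a : ℝ) ^ D|)
        (fun i _ => abs_nonneg _) (Finset.mem_range.mpr ha)
      have : 0 ≤ ε * (a : ℝ) ^ D := by positivity
      linarith
    · have hapos : (0 : ℝ) < (a : ℝ) ^ D := by
        have : 0 < a := by omega
        positivity
      have h1 := hN a (by omega)
      rw [Real.dist_eq, div_sub' hapos.ne', abs_div, abs_of_pos hapos, div_lt_iff₀ hapos] at h1
      rw [mul_comm c]
      linarith

/-- The rescaled Hilbert function converges uniformly to `c y₊^D`, for `y` bounded above. -/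
theorem exists_abs_div_sub_le (hneg : ∀ z < 0, H z = 0) (hD : D ≠ 0)
    (hlim : Tendsto (fun a : ℕ => H a / (a : ℝ) ^ D) atTop (𝓝 c)) {L : ℝ} (hL : 0 ≤ L) {ε : ℝ}
    (hε : 0 < ε) :
    ∃ q₀ : ℝ, 1 ≤ q₀ ∧ ∀ q : ℝ, q₀ ≤ q → ∀ y ≤ L, ∀ z : ℤ, |(z : ℝ) - y * q| ≤ 1 →
      |H z / q ^ D - c * max y 0 ^ D| ≤ ε := by
  have hLD : 0 < (L + 1) ^ D := by positivity
  obtain ⟨C, hC, hH⟩ := exists_abs_sub_le_add hneg hD hlim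
    (ε := ε / 2 / (L + 1) ^ D) (by positivity)
  set K := C + |c| * (D * (L + 1) ^ (D - 1)) with hK
  have hK0 : 0 ≤ K := by positivity
  refine ⟨max 1 (2 * K / ε), le_max_left _ _, fun q hq y hy z hz => ?_⟩
  have hq1 : 1 ≤ q := (le_max_left _ _).trans hq
  have hq0 : 0 < q := by linarith
  have hqD : 0 < q ^ D := by positivity
  have hqD' : q ≤ q ^ D := le_self_pow₀ hq1 hD
  set a := max (z : ℝ) 0 / q with ha
  set b := max y 0 with hb
  have ha0 : 0 ≤ a := by positivity
  have hb0 : 0 ≤ b := le_max_right _ _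
  have hbL : b ≤ L := max_le hy hL
  have hab : |a - b| ≤ 1 / q := by
    have h1 : max (y * q) 0 = b * q := by
      rw [hb, max_mul_of_nonneg _ _ hq0.le, zero_mul]
    have h2 := abs_max_sub_max_le_abs (z : ℝ) (y * q) 0
    rw [h1] at h2
    rw [ha, div_sub' hq0.ne', abs_div, abs_of_pos hq0, mul_comm q b]
    gcongr
    exact h2.trans hz
  have hq1' : 1 / q ≤ 1 := by rw [div_le_one hq0]; exact hq1
  have haL : a ≤ L + 1 := by linarith [le_abs_self (a - b)]
  have h1 : |H z / q ^ D - c * a ^ D| ≤ ε / 2 + C / q := by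
    have h2 : H z / q ^ D - c * a ^ D = (H z - c * max (z : ℝ) 0 ^ D) / q ^ D := by
      rw [ha, div_pow]
      field_simp
    rw [h2, abs_div, abs_of_pos hqD, div_le_iff₀ hqD]
    refine (hH z).trans ?_
    have h3 : max (z : ℝ) 0 ^ D = a ^ D * q ^ D := by
      rw [ha, div_pow, div_mul_cancel₀ _ hqD.ne']
    have h4 : ε / 2 / (L + 1) ^ D * a ^ D ≤ ε / 2 := by
      rw [div_mul_eq_mul_div, div_le_iff₀ hLD]
      gcongr
    have h5 : C ≤ C / q * q ^ D := by
      rw [div_mul_eq_mul_div, le_div_iff₀ hq0]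
      gcongr
    rw [h3, add_mul, ← mul_assoc]
    gcongr
  have h2 : |c * a ^ D - c * b ^ D| ≤ |c| * (D * (L + 1) ^ (D - 1)) / q := by
    rw [← mul_sub, abs_mul, mul_div_assoc]
    gcongr
    refine (abs_pow_sub_pow_le a b D).trans ?_
    rw [abs_of_nonneg ha0, abs_of_nonneg hb0]
    have h3 : max a b ^ (D - 1) ≤ (L + 1) ^ (D - 1) := by
      gcongr
      exact max_le haL (by linarith)
    calc |a - b| * D * max a b ^ (D - 1) ≤ 1 / q * D * (L + 1) ^ (D - 1) := by gcongr
      _ = D * (L + 1) ^ (D - 1) / q := by ring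
  have h3 : K / q ≤ ε / 2 := by
    have h4 := (le_max_right _ _).trans hq
    rw [div_le_iff₀ hε] at h4
    rw [div_le_iff₀ hq0]
    linarith
  have h4 := abs_sub_le (H z / q ^ D) (c * a ^ D) (c * b ^ D)
  have h5 : C / q + |c| * (D * (L + 1) ^ (D - 1)) / q = K / q := by rw [hK, add_div]
  linarith

/-- The limit function `c ∑_j B_j (x - j)₊^D`. -/
def truncatedSum (c : ℝ) (B : ℕ → ℝ) (D l : ℕ) (x : ℝ) : ℝ :=
  c * ∑ j ∈ Finset.range (l + 1), B j * max (x - j) 0 ^ D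

/-- The alternating sum of shifted Hilbert functions. -/
def shiftedSum (H : ℤ → ℝ) (B : ℕ → ℝ) (l q u : ℕ) : ℝ :=
  ∑ j ∈ Finset.range (l + 1), B j * H ((u : ℤ) - (q : ℤ) * j)

/-- Convergence of the rescaled alternating sums, uniform for `x` bounded above. -/
theorem exists_abs_shiftedSum_sub_le (hneg : ∀ z < 0, H z = 0) (hD : D ≠ 0)
    (hlim : Tendsto (fun a : ℕ => H a / (a : ℝ) ^ D) atTop (𝓝 c)) (B : ℕ → ℝ) (l : ℕ) {L : ℝ}
    (hL : 0 ≤ L) {ε : ℝ} (hε : 0 < ε) :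
    ∃ q₀ : ℝ, ∀ q : ℕ, q₀ ≤ q → ∀ x ≤ L, ∀ u : ℕ, |(u : ℝ) - x * q| ≤ 1 →
      |shiftedSum H B l q u / (q : ℝ) ^ D - truncatedSum c B D l x| ≤ ε := by
  set A := ∑ j ∈ Finset.range (l + 1), |B j| with hA
  have hA0 : 0 ≤ A := by positivity
  obtain ⟨q₀, -, hq₀⟩ := exists_abs_div_sub_le hneg hD hlim hL (ε := ε / (A + 1)) (by positivity)
  refine ⟨q₀, fun q hq x hx u hu => ?_⟩
  rw [shiftedSum, truncatedSum, Finset.sum_div, Finset.mul_sum, ← Finset.sum_sub_distrib]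
  calc |∑ j ∈ Finset.range (l + 1), (B j * H ((u : ℤ) - (q : ℤ) * j) / (q : ℝ) ^ D -
        c * (B j * max (x - j) 0 ^ D))|
      ≤ ∑ j ∈ Finset.range (l + 1), |B j| * (ε / (A + 1)) := by
        refine (Finset.abs_sum_le_sum_abs _ _).trans (Finset.sum_le_sum fun j _ => ?_)
        rw [show B j * H ((u : ℤ) - (q : ℤ) * j) / (q : ℝ) ^ D - c * (B j * max (x - j) 0 ^ D) =
          B j * (H ((u : ℤ) - (q : ℤ) * j) / (q : ℝ) ^ D - c * max (x - j) 0 ^ D) by ring, abs_mul]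
        gcongr
        refine hq₀ q hq (x - j) (by linarith [(Nat.cast_nonneg j : (0 : ℝ) ≤ j)]) _ ?_
        push_cast
        rwa [show (u : ℝ) - q * j - (x - j) * q = u - x * q by ring]
    _ = A * (ε / (A + 1)) := by rw [← Finset.sum_mul]
    _ ≤ ε := by
        rw [mul_div_assoc', div_le_iff₀ (by positivity)]
        nlinarith

section Vanishing

variable {B : ℕ → ℝ} {l : ℕ} {Q : ℕ → ℕ} {M : ℕ}

theorem truncatedSum_eq_zero_of_le (hneg : ∀ z < 0, H z = 0) (hD : D ≠ 0)
    (hlim : Tendsto (fun a : ℕ => H a / (a : ℝ) ^ D) atTop (𝓝 c)) (hQ : Tendsto Q atTop atTop)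
    (hM : ∀ n u, M * Q n ≤ u → shiftedSum H B l (Q n) u = 0) {x : ℝ} (hx : (M : ℝ) ≤ x) :
    truncatedSum c B D l x = 0 := by
  have hx0 : 0 ≤ x := (Nat.cast_nonneg M).trans hx
  rw [← abs_nonpos_iff]
  refine le_of_forall_pos_le_add fun ε hε => ?_
  rw [zero_add]
  obtain ⟨q₀, hq₀⟩ := exists_abs_shiftedSum_sub_le hneg hD hlim B l hx0 hε
  obtain ⟨n, hn⟩ := ((tendsto_natCast_atTop_atTop (R := ℝ)).comp hQ |>.eventually
    (eventually_ge_atTop q₀)).exists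
  have hxq : 0 ≤ x * Q n := by positivity
  have h1 := hq₀ (Q n) hn x le_rfl ⌈x * Q n⌉₊ (by
    rw [abs_le]
    constructor <;> linarith [Nat.le_ceil (x * Q n), Nat.ceil_lt_add_one hxq])
  rwa [hM, zero_div, zero_sub, abs_neg] at h1
  have : (M : ℝ) * Q n ≤ ⌈x * Q n⌉₊ := le_trans (by gcongr) (Nat.le_ceil _)
  exact_mod_cast this

/-- Uniform convergence of the rescaled alternating sums on `[0, ∞)`. -/
theorem eventually_abs_shiftedSum_sub_le (hneg : ∀ z < 0, H z = 0) (hD : D ≠ 0)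
    (hlim : Tendsto (fun a : ℕ => H a / (a : ℝ) ^ D) atTop (𝓝 c)) (hQ : Tendsto Q atTop atTop)
    (hQpos : ∀ n, 0 < Q n)
    (hM : ∀ n u, M * Q n ≤ u → shiftedSum H B l (Q n) u = 0) {ε : ℝ} (hε : 0 < ε) :
    ∀ᶠ n in atTop, ∀ x : ℝ, ∀ u : ℕ, |(u : ℝ) - x * Q n| ≤ 1 →
      |shiftedSum H B l (Q n) u / (Q n : ℝ) ^ D - truncatedSum c B D l x| ≤ ε := by
  obtain ⟨q₀, hq₀⟩ := exists_abs_shiftedSum_sub_le hneg hD hlim B l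
    (L := (M : ℝ) + 1) (by positivity) hε
  filter_upwards [(tendsto_natCast_atTop_atTop (R := ℝ)).comp hQ |>.eventually
    (eventually_ge_atTop q₀)] with n hn x u hu
  rcases le_or_gt x (M + 1) with hx | hx
  · exact hq₀ (Q n) hn x hx u hu
  · have h1 : (1 : ℝ) ≤ Q n := by exact_mod_cast hQpos n
    rw [truncatedSum_eq_zero_of_le hneg hD hlim hQ hM (by linarith), hM, zero_div, sub_zero,
      abs_zero]
    · exact hε.le
    · have h2 : ((M : ℝ) + 1) * Q n ≤ x * Q n := by gcongr
      have h3 := (abs_le.mp hu).1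
      have : (M : ℝ) * Q n ≤ u := by linarith
      exact_mod_cast this

end Vanishing

/-- If the limit function has bounded support, its last polynomial piece is zero. -/
theorem sum_mul_pow_eq_zero (hc : c ≠ 0) {B : ℕ → ℝ} {l : ℕ} {M : ℝ}
    (hM : ∀ x, M ≤ x → truncatedSum c B D l x = 0) (x : ℝ) :
    ∑ j ∈ Finset.range (l + 1), B j * (x - j) ^ D = 0 := by
  set P : Polynomial ℝ := ∑ j ∈ Finset.range (l + 1),
    Polynomial.C (B j) * (Polynomial.X - Polynomial.C (j : ℝ)) ^ D with hP
  have heval : ∀ x, P.eval x = ∑ j ∈ Finset.range (l + 1), B j * (x - j) ^ D := by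
    intro x
    simp [hP, Polynomial.eval_finsetSum]
  have hP0 : P = 0 := by
    refine Polynomial.eq_zero_of_infinite_isRoot P
      ((Set.Ici_infinite (max M l)).mono fun y hy => ?_)
    rw [Set.mem_ofPred_eq, Polynomial.IsRoot, heval]
    have hyM : M ≤ y := (le_max_left _ _).trans hy
    have hyl : (l : ℝ) ≤ y := (le_max_right _ _).trans hy
    have h1 := hM y hyM
    rw [truncatedSum] at h1
    rw [← (mul_eq_zero.mp h1).resolve_left hc]
    refine Finset.sum_congr rfl fun j hj => ?_
    have : (j : ℝ) ≤ l := by exact_mod_cast Nat.lt_succ_iff.mp (Finset.mem_range.mp hj)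
    rw [max_eq_left (by linarith)]
  rw [← heval, hP0, Polynomial.eval_zero]

/-- On `[i, i + 1]` only the terms with `j ≤ i` contribute. -/
theorem truncatedSum_eq_of_mem_Icc (hD : D ≠ 0) {B : ℕ → ℝ} {l : ℕ} (hB : ∀ j, l < j → B j = 0)
    (c : ℝ) {i : ℕ} {x : ℝ} (hx : x ∈ Icc (i : ℝ) (i + 1)) :
    truncatedSum c B D l x = c * ∑ j ∈ Finset.range (i + 1), B j * (x - j) ^ D := by
  rw [truncatedSum]
  congr 1
  have h1 : ∑ j ∈ Finset.range (l + 1), B j * max (x - j) 0 ^ D =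
      ∑ j ∈ Finset.range (l + i + 1), B j * max (x - j) 0 ^ D := by
    refine Finset.sum_subset (Finset.range_mono (by omega)) fun j _ hj => ?_
    rw [hB j (by rw [Finset.mem_range] at hj; omega), zero_mul]
  have h2 : ∑ j ∈ Finset.range (i + 1), B j * (x - j) ^ D =
      ∑ j ∈ Finset.range (i + 1), B j * max (x - j) 0 ^ D := by
    refine Finset.sum_congr rfl fun j hj => ?_
    have : (j : ℝ) ≤ i := by exact_mod_cast Nat.lt_succ_iff.mp (Finset.mem_range.mp hj)
    rw [max_eq_left (by linarith [hx.1])]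
  rw [h1, h2]
  refine (Finset.sum_subset (Finset.range_mono (by omega)) fun j _ hj => ?_).symm
  have : (i : ℝ) + 1 ≤ j := by
    have : i + 1 ≤ j := by rw [Finset.mem_range] at hj; omega
    exact_mod_cast this
  rw [max_eq_right (by linarith [hx.2]), zero_pow hD, mul_zero]

theorem truncatedSum_eq_zero {B : ℕ → ℝ} {l : ℕ}
    (h0 : ∀ x : ℝ, ∑ j ∈ Finset.range (l + 1), B j * (x - j) ^ D = 0) (c : ℝ) {x : ℝ}
    (hx : (l : ℝ) ≤ x) : truncatedSum c B D l x = 0 := by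
  rw [truncatedSum, mul_eq_zero]
  refine Or.inr ((Finset.sum_congr rfl fun j hj => ?_).trans (h0 x))
  have : (j : ℝ) ≤ l := by exact_mod_cast Nat.lt_succ_iff.mp (Finset.mem_range.mp hj)
  rw [max_eq_left (by linarith)]

theorem isPiecewisePolynomial_truncatedSum (hD : D ≠ 0) (hc : c ≠ 0) {B : ℕ → ℝ} {l : ℕ}
    (hB : ∀ j, l < j → B j = 0) (hB0 : B 0 ≠ 0)
    (h0 : ∀ x : ℝ, ∑ j ∈ Finset.range (l + 1), B j * (x - j) ^ D = 0) {f : ℝ → ℝ}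
    (hf : ∀ x, 0 ≤ x → f x = truncatedSum c B D l x) : IsPiecewisePolynomial f D := by
  set P : ℕ → Polynomial ℝ := fun i => Polynomial.C c * ∑ j ∈ Finset.range (i + 1),
    Polynomial.C (B j) * (Polynomial.X - Polynomial.C (j : ℝ)) ^ D with hP
  have heval : ∀ i x, (P i).eval x = c * ∑ j ∈ Finset.range (i + 1), B j * (x - j) ^ D := by
    intro i x
    simp [hP, Polynomial.eval_finsetSum]
  refine ⟨l, fun i => i, P, Nat.cast_zero, Nat.strictMono_cast, fun i _ x hx => ?_, fun x hx => ?_,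
    fun i _ => ?_, 0, Nat.zero_le l, ?_⟩
  · push_cast at hx
    rw [hf x ((Nat.cast_nonneg i).trans hx.1), heval, truncatedSum_eq_of_mem_Icc hD hB c hx]
  · rw [hf x ((Nat.cast_nonneg l).trans hx), heval, truncatedSum_eq_zero h0 c hx, h0, mul_zero]
  · refine Polynomial.degree_C_mul_of_isUnit (isUnit_iff_ne_zero.mpr hc) _ |>.trans_le ?_
    refine (Polynomial.degree_sum_le _ _).trans (Finset.sup_le fun j _ => ?_)
    rw [Polynomial.C_mul']
    refine (Polynomial.degree_smul_le _ _).trans ?_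
    rw [Polynomial.degree_pow, Polynomial.degree_X_sub_C]
    simp
  · simp only [hP, zero_add, Finset.range_one, Finset.sum_singleton]
    rw [← mul_assoc, ← Polynomial.C_mul, Polynomial.degree_C_mul (mul_ne_zero hc hB0),
      Polynomial.degree_pow, Polynomial.degree_X_sub_C]
    simp

/-- The antiderivative of the zero function `∑ B_j (x - j)^D` is constant. -/
theorem sum_mul_pow_succ_eq {B : ℕ → ℝ} {l : ℕ}
    (h0 : ∀ x : ℝ, ∑ j ∈ Finset.range (l + 1), B j * (x - j) ^ D = 0) (x y : ℝ) :
    ∑ j ∈ Finset.range (l + 1), B j * (x - j) ^ (D + 1) =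
      ∑ j ∈ Finset.range (l + 1), B j * (y - j) ^ (D + 1) := by
  have hderiv : ∀ x : ℝ, HasDerivAt
      (fun x : ℝ => ∑ j ∈ Finset.range (l + 1), B j * (x - j) ^ (D + 1)) 0 x := by
    intro x
    have h1 : HasDerivAt (fun x : ℝ => ∑ j ∈ Finset.range (l + 1), B j * (x - j) ^ (D + 1))
        (∑ j ∈ Finset.range (l + 1), B j * ((D + 1 : ℕ) * (x - j) ^ D * 1)) x := by
      refine HasDerivAt.fun_sum fun j _ => HasDerivAt.const_mul _ ?_
      exact ((hasDerivAt_id x).sub_const (j : ℝ)).pow (D + 1)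
    convert h1 using 1
    rw [← mul_zero ((D + 1 : ℕ) : ℝ), ← h0 x, Finset.mul_sum]
    exact Finset.sum_congr rfl fun j _ => by ring
  exact is_const_of_deriv_eq_zero (fun x => (hderiv x).differentiableAt)
    (fun x => (hderiv x).deriv) x y

theorem sum_shift_eq_sum (hneg : ∀ z < 0, H z = 0) (N b : ℕ) :
    ∑ u ∈ Finset.range (b + N), H ((u : ℤ) - b) = ∑ a ∈ Finset.range N, H a := by
  rw [Finset.sum_range_add, Finset.sum_eq_zero, zero_add]
  · refine Finset.sum_congr rfl fun a _ => ?_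
    congr 1
    push_cast
    ring
  · intro u hu
    have := Finset.mem_range.mp hu
    exact hneg _ (by omega)

/-- The total mass of the rescaled alternating sums converges. -/
theorem tendsto_sum_shiftedSum (hneg : ∀ z < 0, H z = 0)
    (hlim : Tendsto (fun a : ℕ => H a / (a : ℝ) ^ D) atTop (𝓝 c)) {B : ℕ → ℝ} {l M : ℕ}
    (hlM : l < M) {Q : ℕ → ℕ} (hQ : Tendsto Q atTop atTop) :
    Tendsto (fun n => (∑ u ∈ Finset.range (M * Q n), shiftedSum H B l (Q n) u) /
      (Q n : ℝ) ^ (D + 1)) atTop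
      (𝓝 (c / (D + 1) * ∑ j ∈ Finset.range (l + 1), B j * ((M : ℝ) - j) ^ (D + 1))) := by
  have hsum := tendsto_sum_div_pow (f := fun a : ℕ => H a) hlim
  have h1 : ∀ n, (∑ u ∈ Finset.range (M * Q n), shiftedSum H B l (Q n) u) / (Q n : ℝ) ^ (D + 1) =
      ∑ j ∈ Finset.range (l + 1), B j *
        ((∑ a ∈ Finset.range ((M - j) * Q n), H a) / (Q n : ℝ) ^ (D + 1)) := by
    intro n
    simp only [shiftedSum]
    rw [Finset.sum_comm, Finset.sum_div]
    refine Finset.sum_congr rfl fun j hj => ?_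
    rw [← Finset.mul_sum, mul_div_assoc, ← sum_shift_eq_sum hneg ((M - j) * Q n) (Q n * j)]
    have hjM : j ≤ M := by have := Finset.mem_range.mp hj; omega
    rw [show Q n * j + (M - j) * Q n = M * Q n by
      rw [mul_comm (Q n) j, ← add_mul, Nat.add_sub_cancel' hjM]]
    push_cast
    rfl
  simp_rw [h1]
  rw [Finset.mul_sum]
  refine tendsto_finsetSum _ fun j hj => ?_
  have hjM : j < M := by have := Finset.mem_range.mp hj; omega
  have hMj : (0 : ℝ) < (M : ℝ) - j := by
    rw [sub_pos]
    exact_mod_cast hjM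
  have hQj : Tendsto (fun n => (M - j) * Q n) atTop atTop :=
    hQ.const_mul_atTop' (by omega)
  have h2 := ((hsum.comp hQj).const_mul (((M : ℝ) - j) ^ (D + 1))).const_mul (B j)
  rw [show c / (D + 1) * (B j * ((M : ℝ) - j) ^ (D + 1)) =
    B j * (((M : ℝ) - j) ^ (D + 1) * (c / (D + 1))) by ring]
  refine h2.congr fun n => ?_
  simp only [Function.comp_apply]
  rw [Nat.cast_mul, Nat.cast_sub hjM.le, mul_pow]
  field_simp

end Analysis

/-! ### The density function -/

section Density

variable {k : Type v} [Field k] {R : Type u} [CommRing R] [Algebra k R] {𝒜 : ℕ → Submodule k R}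

/-- The sum of `n₀` consecutive graded pieces in the definition of `stepFun`. -/
def blockLength (𝒜 : ℕ → Submodule k R) (J : Ideal R) (u : ℕ) : ℕ :=
  ∑ r ∈ Finset.range (gradingGcd 𝒜), pieceLength 𝒜 J (u * gradingGcd 𝒜 + r)

theorem stepFun_eq (I : Ideal R) (p d n : ℕ) (x : ℝ) :
    stepFun 𝒜 I p d n x =
      (blockLength 𝒜 (bracketPower I (p ^ n)) ⌊x * (p : ℝ) ^ n⌋₊ : ℝ) /
        ((p : ℝ) ^ n) ^ (d - 1) := by
  rw [stepFun, blockLength, Nat.cast_sum]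

/-- `g_n(x)` is a convex combination of values at the two integers around `x q`. -/
theorem abs_linearFun_sub_le {I : Ideal R} {p d n : ℕ} (hp : 0 < p) {x y ε : ℝ} (hx : 0 ≤ x)
    (h : ∀ u : ℕ, |(u : ℝ) - x * (p : ℝ) ^ n| ≤ 1 →
      |(blockLength 𝒜 (bracketPower I (p ^ n)) u : ℝ) / ((p : ℝ) ^ n) ^ (d - 1) - y| ≤ ε) :
    |linearFun 𝒜 I p d n x - y| ≤ ε := by
  have hq : (0 : ℝ) < (p : ℝ) ^ n := by positivity
  have hxq : 0 ≤ x * (p : ℝ) ^ n := by positivity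
  have h1 := Nat.floor_le hxq
  have h2 := Nat.lt_floor_add_one (x * (p : ℝ) ^ n)
  have hA := h ⌊x * (p : ℝ) ^ n⌋₊ (by rw [abs_le]; constructor <;> linarith)
  have hB := h (⌊x * (p : ℝ) ^ n⌋₊ + 1) (by
    push_cast
    rw [abs_le]
    constructor <;> linarith)
  have hfl : ⌊(x + 1 / (p : ℝ) ^ n) * (p : ℝ) ^ n⌋₊ = ⌊x * (p : ℝ) ^ n⌋₊ + 1 := by
    rw [add_mul, one_div, inv_mul_cancel₀ hq.ne', Nat.floor_add_one hxq]
  rw [linearFun, stepFun_eq, stepFun_eq, hfl]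
  set t := Int.fract (x * (p : ℝ) ^ n) with ht
  have ht0 : 0 ≤ t := Int.fract_nonneg _
  have ht1 : 0 ≤ 1 - t := by linarith [Int.fract_lt_one (x * (p : ℝ) ^ n)]
  set a := (blockLength 𝒜 (bracketPower I (p ^ n)) ⌊x * (p : ℝ) ^ n⌋₊ : ℝ) /
    ((p : ℝ) ^ n) ^ (d - 1)
  set b := (blockLength 𝒜 (bracketPower I (p ^ n)) (⌊x * (p : ℝ) ^ n⌋₊ + 1) : ℝ) /
    ((p : ℝ) ^ n) ^ (d - 1)
  calc |(1 - t) * a + t * b - y| = |(1 - t) * (a - y) + t * (b - y)| := by ring_nf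
    _ ≤ (1 - t) * |a - y| + t * |b - y| := by
        refine (abs_add_le _ _).trans ?_
        rw [abs_mul, abs_mul, abs_of_nonneg ht0, abs_of_nonneg ht1]
    _ ≤ (1 - t) * ε + t * ε := by gcongr
    _ = ε := by ring

theorem blockLength_eq_zero (h : ∃ m, 0 < m ∧ 𝒜 m ≠ ⊥) {J : Ideal R} {N u : ℕ}
    (hN : ∀ m, N ≤ m → ∀ r ∈ 𝒜 m, r ∈ J) (hu : N ≤ u) : blockLength 𝒜 J u = 0 :=
  Finset.sum_eq_zero fun _ _ => pieceLength_eq_zero (hN _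
    ((hu.trans (Nat.le_mul_of_pos_right _ (gradingGcd_pos h))).trans (Nat.le_add_right _ _)))

theorem tendsto_hilbertRatio {d : ℕ} {c : ℝ} (hc : Tendsto (fun a : ℕ =>
      (Module.finrank k (𝒜 (gradingGcd 𝒜 * a)) : ℝ) / (a : ℝ) ^ (d - 1)) atTop (𝓝 c)) :
    Tendsto (hilbertRatio 𝒜 d) atTop (𝓝 (((d - 1)! : ℝ) * c)) := by
  refine (hc.const_mul _).congr fun m => ?_
  rw [hilbertRatio, mul_div_assoc, mul_comm m]

variable [GradedAlgebra 𝒜]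

theorem length_quotient_eq_sum_blockLength (h𝒜 : ∀ r ∈ 𝒜 0, ∃ c : k, algebraMap k R c = r)
    (hfd : ∀ m, FiniteDimensional k (𝒜 m)) (h : ∃ m, 0 < m ∧ 𝒜 m ≠ ⊥) {J : Ideal R}
    (hJ : J.IsHomogeneous 𝒜) {N : ℕ} (hN : ∀ m, N ≤ m → ∀ r ∈ 𝒜 m, r ∈ J) :
    Module.length R (R ⧸ J) = (∑ u ∈ Finset.range N, blockLength 𝒜 J u : ℕ) := by
  rw [length_quotient_eq_sum h𝒜 hfd h hJ (N := gradingGcd 𝒜 * N)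
    (fun m hm => hN m ((Nat.le_mul_of_pos_left _ (gradingGcd_pos h)).trans hm)), sum_range_mul]
  simp only [blockLength, mul_comm]

/-- The Hilbert-Samuel function of `R` if `R` is generated in degree `n₀`. -/
theorem tendsto_hilbertSamuel (h𝒜 : ∀ r ∈ 𝒜 0, ∃ c : k, algebraMap k R c = r)
    (hfd : ∀ m, FiniteDimensional k (𝒜 m)) (h : ∃ m, 0 < m ∧ 𝒜 m ≠ ⊥)
    (hgen : Algebra.adjoin k (𝒜 (gradingGcd 𝒜) : Set R) = ⊤) {D : ℕ} {c : ℝ}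
    (hc : Tendsto (fun a : ℕ =>
      (Module.finrank k (𝒜 (gradingGcd 𝒜 * a)) : ℝ) / (a : ℝ) ^ D) atTop (𝓝 c)) :
    Tendsto (fun n : ℕ => ((D + 1)! : ℝ) *
      ((Module.length R (R ⧸ (HomogeneousIdeal.irrelevant 𝒜).toIdeal ^ n)).toNat : ℝ) /
        (n : ℝ) ^ (D + 1)) atTop (𝓝 ((D ! : ℝ) * c)) := by
  have h1 := (tendsto_sum_div_pow hc).const_mul (((D + 1)! : ℝ))
  have h2 : ((D + 1)! : ℝ) * (c / (D + 1)) = (D ! : ℝ) * c := by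
    have : (D : ℝ) + 1 ≠ 0 := by positivity
    rw [Nat.factorial_succ]
    push_cast
    field_simp
  rw [h2] at h1
  refine h1.congr fun n => ?_
  rw [length_quotient_irrelevant_pow h𝒜 hfd h hgen, ENat.toNat_natCast, mul_div_assoc]
  push_cast
  rfl

end Density

end HKDensity

end

theorem proposition7p1
    {k : Type*} [Field k] [PerfectField k] (p : ℕ) [Fact p.Prime] [CharP k p]
    {R : Type*} [CommRing R] [IsDomain R] [Algebra k R] [Algebra.FiniteType k R]
    (𝒜 : ℕ → Submodule k R) [GradedAlgebra 𝒜]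
    (h𝒜 : ∀ r ∈ 𝒜 0, ∃ c : k, algebraMap k R c = r)
    (d : ℕ) (hd : 2 ≤ d) (hdim : ringKrullDim R = d)
    (I : Ideal R) (hI : I.IsHomogeneous 𝒜) (hI_ne : I ≠ ⊤) (hI_len : IsFiniteLength R (R ⧸ I))
    (hpd : CategoryTheory.projectiveDimension (ModuleCat.of R (R ⧸ I)) < ⊤) :
    -- the density function, the Hilbert-Kunz multiplicity and `e₀` are well defined
    TendstoUniformlyOn (HKDensity.linearFun 𝒜 I p d) (HKDensity.density 𝒜 I p d) Filter.atTop
      (Set.Ici 0) ∧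
    Filter.Tendsto (HKDensity.hkRatio I p d) Filter.atTop (nhds (HKDensity.hkMultiplicity I p d)) ∧
    Filter.Tendsto (HKDensity.hilbertRatio 𝒜 d) Filter.atTop
      (nhds (HKDensity.multiplicity 𝒜 d)) ∧
    0 < HKDensity.multiplicity 𝒜 d ∧
    -- `e₀` is the Hilbert-Samuel multiplicity if `R` is standard graded
    (Algebra.adjoin k (𝒜 (HKDensity.gradingGcd 𝒜) : Set R) = ⊤ →
      Filter.Tendsto
        (fun n : ℕ => (Nat.factorial d : ℝ) *
          ((Module.length R
            (R ⧸ (HomogeneousIdeal.irrelevant 𝒜).toIdeal ^ n)).toNat : ℝ) / (n : ℝ) ^ d)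
        Filter.atTop (nhds (HKDensity.multiplicity 𝒜 d))) ∧
    HKDensity.IsPiecewisePolynomial (HKDensity.density 𝒜 I p d) (d - 1) ∧
    Nonempty (HKDensity.MinimalGradedResolution 𝒜 I) ∧
    ∀ F : HKDensity.MinimalGradedResolution 𝒜 I,
      (∀ i, d < i → F.rank i = 0) ∧
      (∀ j < 0, F.altBetti d j = 0) ∧
      F.altBetti d 0 = 1 ∧
      ∃ l : ℕ,
        IsGreatest {j : ℤ | ∃ i, F.betti i j ≠ 0} ((HKDensity.gradingGcd 𝒜 : ℤ) * l) ∧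
        (∀ i : ℕ, ∀ x ∈ Set.Icc (i : ℝ) (i + 1),
          HKDensity.density 𝒜 I p d x =
            HKDensity.multiplicity 𝒜 d / (Nat.factorial (d - 1) : ℝ) *
              ∑ j ∈ Finset.range (i + 1),
                (F.altBetti d ((HKDensity.gradingGcd 𝒜 : ℤ) * j) : ℝ) * (x - j) ^ (d - 1)) ∧
        (∀ x : ℝ, (l : ℝ) ≤ x → HKDensity.density 𝒜 I p d x = 0) ∧
        (∀ x : ℝ, ∑ j ∈ Finset.range (l + 1),
          (F.altBetti d ((HKDensity.gradingGcd 𝒜 : ℤ) * j) : ℝ) * (x - j) ^ (d - 1) = 0) ∧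
        HKDensity.hkMultiplicity I p d =
          HKDensity.multiplicity 𝒜 d / (Nat.factorial d : ℝ) *
            ∑ j ∈ Finset.range l,
              (F.altBetti d ((HKDensity.gradingGcd 𝒜 : ℤ) * j) : ℝ) * ((l : ℝ) - j) ^ d := by
  open HKDensity in
  have hnoeth : IsNoetherianRing R := Algebra.FiniteType.isNoetherianRing k R
  have hchar : CharP R p := charP_of_injective_algebraMap (algebraMap k R).injective p
  have hprime : p.Prime := Fact.out
  obtain ⟨G⟩ := exists_homogeneousGenerators 𝒜 h𝒜
  have hfd := G.finiteDimensional
  have h := exists_ne_bot_of_dim_pos (𝒜 := 𝒜) h𝒜 (by omega) hdim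
  have hm : (HomogeneousIdeal.irrelevant 𝒜).toIdeal ≠ ⊥ := by
    obtain ⟨m, hm, hne⟩ := h
    obtain ⟨r, hr, hr0⟩ := (Submodule.ne_bot_iff _).mp hne
    exact (Submodule.ne_bot_iff _).mpr ⟨r, HomogeneousIdeal.mem_irrelevant_of_mem 𝒜 hm hr, hr0⟩
  obtain ⟨c, hc, hclim⟩ := exists_tendsto_hilbert (𝒜 := 𝒜) h𝒜 (by omega) hdim
  obtain ⟨M, hM, hvan⟩ := exists_forall_mem_bracketPower G h𝒜 hI hI_ne hI_len
  have hQ : Tendsto (fun n => p ^ n) atTop atTop := tendsto_pow_atTop_atTop_of_one_lt hprime.one_lt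
  have hQpos : ∀ n, 0 < p ^ n := fun n => pow_pos hprime.pos n
  have hratio := tendsto_hilbertRatio hclim
  have hmult : HKDensity.multiplicity 𝒜 d = ((d - 1)! : ℝ) * c := hratio.limUnder_eq
  obtain ⟨D, rfl⟩ : ∃ D, d = D + 1 := ⟨d - 1, by omega⟩
  have hD : D ≠ 0 := by omega
  rw [Nat.add_sub_cancel] at hmult hclim hratio
  -- the formulas in terms of a resolution
  set H : ℤ → ℝ := fun z => hilbertFun 𝒜 z with hH
  have hHneg : ∀ z < 0, H z = 0 := fun z hz => by rw [hH]; simp [hilbertFun_of_neg h hz]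
  have hHlim : Tendsto (fun a : ℕ => H a / (a : ℝ) ^ D) atTop (𝓝 c) := by
    simpa only [hH, hilbertFun_natCast] using hclim
  have key : ∀ F : MinimalGradedResolution 𝒜 I,
      (∀ i, D + 1 < i → F.rank i = 0) ∧ (∀ j < 0, F.altBetti (D + 1) j = 0) ∧
      F.altBetti (D + 1) 0 = 1 ∧ ∃ l : ℕ,
        IsGreatest {j : ℤ | ∃ i, F.betti i j ≠ 0} ((gradingGcd 𝒜 : ℤ) * l) ∧
        (∀ j : ℕ, l < j → F.altBetti (D + 1) ((gradingGcd 𝒜 : ℤ) * j) = 0) ∧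
        ∀ n u, (blockLength 𝒜 (bracketPower I (p ^ n)) u : ℝ) = shiftedSum H
          (fun j => (F.altBetti (D + 1) ((gradingGcd 𝒜 : ℤ) * j) : ℝ)) l (p ^ n) u := by
    intro F
    obtain ⟨a₀, hu, h0, -⟩ := F.exists_unique_basis_zero h𝒜 hI hI_ne
    have h0' : ∀ a, F.shift 0 a = 0 := fun a => by rw [hu a, h0]
    obtain ⟨s, hsd, -, hs⟩ := F.exists_length h𝒜 hm hI hI_ne hdim hpd
    have hrank : ∀ i, D + 1 < i → F.rank i = 0 := fun i hi => hs i (by omega)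
    obtain ⟨l, hl⟩ := F.exists_isGreatest h h0' a₀.pos hrank
    refine ⟨hrank, fun j hj => F.altBetti_of_neg h h0' _ hj, F.altBetti_zero h hu h0 _, l, hl,
      fun j hj => F.altBetti_eq_zero_of_lt h hl _ hj, fun n u => ?_⟩
    have h1 := F.sum_pieceLength_bracketPower p h𝒜 hfd h hm hI hI_ne hI_len hdim hpd h0' hl n u
    have h2 := congrArg (Int.cast : ℤ → ℝ) h1
    rw [Int.cast_natCast] at h2
    rw [blockLength, h2, shiftedSum]
    push_cast
    rfl
  have main : ∀ (B : ℕ → ℝ) (l : ℕ), (∀ n u, (blockLength 𝒜 (bracketPower I (p ^ n)) u : ℝ) =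
      shiftedSum H B l (p ^ n) u) →
      TendstoUniformlyOn (linearFun 𝒜 I p (D + 1)) (truncatedSum c B D l) atTop (Ici 0) ∧
      (∀ x : ℝ, ∑ j ∈ Finset.range (l + 1), B j * (x - j) ^ D = 0) ∧
      Tendsto (hkRatio I p (D + 1)) atTop (𝓝 (((D ! : ℝ) * c) / ((D + 1)! : ℝ) *
        ∑ j ∈ Finset.range l, B j * ((l : ℝ) - j) ^ (D + 1))) := by
    intro B l hblock
    have hzero : ∀ n u, M * p ^ n ≤ u → shiftedSum H B l (p ^ n) u = 0 := by
      intro n u hu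
      rw [← hblock, blockLength_eq_zero h (hvan _ (hQpos n)) hu, Nat.cast_zero]
    have hpoly := sum_mul_pow_eq_zero hc.ne' (B := B) (l := l) (D := D)
      fun x hx => truncatedSum_eq_zero_of_le hHneg hD hHlim hQ hzero hx
    refine ⟨?_, hpoly, ?_⟩
    · rw [Metric.tendstoUniformlyOn_iff]
      intro ε hε
      filter_upwards [eventually_abs_shiftedSum_sub_le hHneg hD hHlim hQ hQpos hzero
        (half_pos hε)] with n hn x hx
      rw [dist_comm, Real.dist_eq]
      refine (abs_linearFun_sub_le hprime.pos hx fun u hu => ?_).trans_lt (half_lt_self hε)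
      have := hn x u (by rwa [Nat.cast_pow])
      rwa [← hblock, Nat.cast_pow] at this
    · have h1 := tendsto_sum_shiftedSum hHneg hHlim (B := B) (l := l) (M := M + l) (by omega) hQ
      -- the limit does not depend on the upper end of the summation, which may be moved to `l`
      rw [sum_mul_pow_succ_eq hpoly _ (l : ℝ), Finset.sum_range_succ, sub_self,
        zero_pow (Nat.succ_ne_zero D), mul_zero, add_zero] at h1
      have h2 : (D ! : ℝ) * c / ((D + 1)! : ℝ) = c / (D + 1) := by
        rw [Nat.factorial_succ]
        push_cast
        have : (D ! : ℝ) ≠ 0 := by positivity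
        field_simp
      rw [h2]
      refine h1.congr fun n => ?_
      rw [hkRatio, length_quotient_eq_sum_blockLength h𝒜 hfd h
        (bracketPower_isHomogeneous hI p n) (N := (M + l) * p ^ n)
        (fun m hm => hvan _ (hQpos n) m ((Nat.mul_le_mul_right _ (Nat.le_add_right M l)).trans hm)),
        ENat.toNat_natCast, Nat.cast_sum, Nat.cast_pow]
      simp only [hblock]
  obtain ⟨F₀⟩ := nonempty_minimalGradedResolution h𝒜 hI hI_ne
  obtain ⟨-, -, hF₀, l₀, -, hl₀, hblock₀⟩ := key F₀
  obtain ⟨hunif, hpoly₀, hhk⟩ := main _ l₀ hblock₀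
  have hdens : ∀ (B : ℕ → ℝ) (l : ℕ),
      TendstoUniformlyOn (linearFun 𝒜 I p (D + 1)) (truncatedSum c B D l) atTop (Ici 0) →
      ∀ x, 0 ≤ x → density 𝒜 I p (D + 1) x = truncatedSum c B D l x :=
    fun B l hB x hx => (hB.tendsto_at hx).limUnder_eq
  rw [Nat.add_sub_cancel, hmult]
  refine ⟨hunif.congr_right fun x hx => (hdens _ _ hunif x hx).symm, ?_, hratio, by positivity,
    fun hgen => tendsto_hilbertSamuel h𝒜 hfd h hgen hclim,
    isPiecewisePolynomial_truncatedSum hD hc.ne' (fun j hj => by rw [hl₀ j hj, Int.cast_zero]) ?_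
      hpoly₀ (hdens _ _ hunif), ⟨F₀⟩, fun F => ?_⟩
  · rw [hkMultiplicity, hhk.limUnder_eq]
    exact hhk
  · rw [Nat.cast_zero, mul_zero, hF₀]
    simp
  · obtain ⟨hrank, hneg, hone, l, hl, hB, hblock⟩ := key F
    obtain ⟨hunif', hpoly, hhk'⟩ := main _ l hblock
    have hcD : (D ! : ℝ) * c / (D ! : ℝ) = c := mul_div_cancel_left₀ _ (by positivity)
    refine ⟨hrank, hneg, hone, l, hl, fun i x hx => ?_, fun x hx => ?_, hpoly, hhk'.limUnder_eq⟩
    · rw [hdens _ _ hunif' x ((Nat.cast_nonneg i).trans hx.1), hcD]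
      exact truncatedSum_eq_of_mem_Icc hD (fun j hj => by rw [hB j hj, Int.cast_zero]) c hx
    · rw [hdens _ _ hunif' x ((Nat.cast_nonneg l).trans hx)]
      exact truncatedSum_eq_zero hpoly c hx
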